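/- **Setting.** A monoid $P$ is a *right Ore monoid* if (O1) for all $x_1,x_2\in P$ there are $y_1,y_2\in P$ with $x_1y_1=x_2y_2$, and (O2) $xy_1=xy_2$ implies $y_1z=y_2z$ for some $z\in P$. Its *group completion* $G$ is the group of formal quotients $pq^{-1}$, $p,q\in P$, where $p_1q_1^{-1}=p_2q_2^{-1}$ iff $(p_1t_1,q_1t_1)=(p_2t_2,q_2t_2)$ for some $t_1,t_2\in P$, with product $p_1q_1^{-1}\cdot p_2q_2^{-1}=(p_1t_1)(q_2t_2)^{-1}$ whenever $q_1t_1=p_2t_2$. Let $A$ be a C*-algebra. A *correspondence* on $A$ is a (right) Hilbert $A$-module with a nondegenerate left action of $A$ by adjointable operators; it is *proper* if $A$ acts by compact operators. $\mathbb K(E,F)$ denotes the closed linear span of the operators $|\xi\rangle\langle\eta|\colon\zeta\mapsto\xi\langle\eta,\zeta\rangle$, and $\mathbb K(E)=\mathbb K(E,E)$. A *proper, nondegenerate product system* $(A,E_p,\mu_{p,q})$ over $P$ consists of proper correspondences $E_p$ on $A$ for $p\in P$ with $E_1=A$, and isomorphisms of correspondences $\mu_{p,q}\colon E_p\otimes_A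 E_q\to E_{pq}$ that are associative, where $\mu_{1,q}$ and $\mu_{p,1}$ are the canonical isomorphisms given by the module structures. A *representation* of it in a C*-algebra $D$ consists of linear maps $S_p\colon E_p\to D$ such that $\pi=S_1\colon A\to D$ is a $*$-homomorphism, $S_p(\xi)S_q(\eta)=S_{pq}(\mu_{p,q}(\xi\otimes\eta))$ and $S_p(\xi)^*S_p(\eta)=\pi(\langle\xi,\eta\rangle)$. It is *Cuntz–Pimsner covariant* if, for each $p$, the induced $*$-homomorphism $\vartheta_p\colon\mathbb K(E_p)\to D$, $|\xi\rangle\langle\eta|\mapsto S_p(\xi)S_p(\eta)^*$, satisfies $\vartheta_p(\varphi_p(a))=\pi(a)$ for all $a\in A$ whose left action $\varphi_p(a)$ on $E_p$ is compact. The *Cuntz–Pimsner algebra* is the universal C*-algebra for Cuntz–Pimsner covariant representations. The *full sectional C*-algebra* of a Fell bundle over the discrete group $G$ is the universal C*-algebra for its representations, that is, for families of linear maps $\pi_g$ from the fibres to a C*-algebra that are compatible with multiplication and involution. **Theorem.** Let $P$ be a right Ore monoid with group completion $G$, and let $(A,E_p,\mu_{p,q})$ be a proper, nondegenerate product system over $P$.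 For all $p_1,p_2,q\in P$, the formula $T\mapsto\mu_{p_1,q}(T\otimes_A\mathrm{id}_{E_q})\mu_{p_2,q}^*$ defines a map $\varphi_{p_1,p_2,q}\colon\mathbb K(E_{p_2},E_{p_1})\to\mathbb K(E_{p_2q},E_{p_1q})$. There are a Fell bundle $(\mathcal O_g)_{g\in G}$ over $G$ and bounded linear maps $\iota_{p_1,p_2}\colon\mathbb K(E_{p_2},E_{p_1})\to\mathcal O_{p_1p_2^{-1}}$ such that 1. for each $g\in G$, the maps $\iota_{p_1,p_2}$ with $p_1p_2^{-1}=g$ exhibit $\mathcal O_g$ as the colimit, in the category of Banach spaces and linear contractions, of the spaces $\mathbb K(E_{p_2},E_{p_1})$ with $p_1p_2^{-1}=g$ along the maps $\varphi_{p_1,p_2,q}$; 2. the Fell bundle structure is induced by composition and adjoints of compact operators: $\iota_{p_1,p_2}(T)\,\iota_{p_2,p_3}(S)=\iota_{p_1,p_3}(TS)$ and $\iota_{p_1,p_2}(T)^*=\iota_{p_2,p_1}(T^*)$; 3. the maps $\iota_{p,p}$ are $*$-homomorphisms and exhibit the unit fibre $\mathcal O_1$ as the colimit (inductive limit) of the C*-algebras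 $\mathbb K(E_p)$, $p\in P$, along the $*$-homomorphisms $\varphi_{p,p,q}\colon\mathbb K(E_p)\to\mathbb K(E_{pq})$; 4. the Cuntz–Pimsner algebra of $(A,E_p,\mu_{p,q})$ is isomorphic to the full sectional C*-algebra of $(\mathcal O_g)_{g\in G}$. -/

import Mathlib

open scoped ENNReal

universe u v w f

noncomputable section

/-! ## Hilbert modules and compact operators -/

/-- A (right) Hilbert `B`-module structure on the Banach space `E` over a C⋆-algebra `B`: a
`B`-valued inner product, linear in the second variable, and a right action `act ξ b = ξ b`,
such that the norm is `‖ξ‖ = ‖⟨ξ, ξ⟩‖^(1/2)`.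
(Mathlib's `CStarModule` is about left actions: `⟨x, b y⟩ = b ⟨x, y⟩`.)
The axioms of a right module and the definiteness of the inner product follow from these. -/
class HilbertModule (B : Type*) (E : Type*) [NonUnitalCStarAlgebra B] [NormedAddCommGroup E]
    [NormedSpace ℂ E] [CompleteSpace E] where
  ip : E → E → B
  act : E → B → E
  ip_add_right : ∀ ξ η ζ, ip ξ (η + ζ) = ip ξ η + ip ξ ζ
  ip_smul_right : ∀ (c : ℂ) (ξ η), ip ξ (c • η) = c • ip ξ η
  ip_act_right : ∀ (ξ η) (b : B), ip ξ (act η b) = ip ξ η * b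
  star_ip : ∀ ξ η, star (ip ξ η) = ip η ξ
  ip_self_nonneg : ∀ ξ, ∃ b : B, ip ξ ξ = star b * b
  norm_sq : ∀ ξ, ‖ξ‖ ^ 2 = ‖ip ξ ξ‖

namespace HilbertModule

variable {B : Type*} [NonUnitalCStarAlgebra B]
variable {E : Type*} [NormedAddCommGroup E] [NormedSpace ℂ E] [CompleteSpace E]
variable {F : Type*} [NormedAddCommGroup F] [NormedSpace ℂ F] [CompleteSpace F]
variable {H : Type*} [NormedAddCommGroup H] [NormedSpace ℂ H] [CompleteSpace H]
variable [HilbertModule B E] [HilbertModule B F] [HilbertModule B H]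

theorem ip_add_left (ξ η ζ : E) : ip (B := B) (ξ + η) ζ = ip ξ ζ + ip η ζ := by
  rw [← star_ip, ip_add_right, star_add, star_ip, star_ip]

theorem ip_smul_left (c : ℂ) (ξ η : E) : ip (B := B) (c • ξ) η = star c • ip ξ η := by
  rw [← star_ip, ip_smul_right, star_smul, star_ip]

theorem ip_act_left (ξ η : E) (b : B) : ip (act ξ b) η = star b * ip ξ η := by
  rw [← star_ip, ip_act_right, star_mul, star_ip]

theorem ip_sub_right (ξ η ζ : E) : ip (B := B) ξ (η - ζ) = ip ξ η - ip ξ ζ := by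
  have := ip_add_right (B := B) ξ (η - ζ) ζ
  rw [sub_add_cancel] at this
  rw [this, add_sub_cancel_right]

theorem ip_sub_left (ξ η ζ : E) : ip (B := B) (ξ - η) ζ = ip ξ ζ - ip η ζ := by
  rw [← star_ip, ip_sub_right, star_sub, star_ip, star_ip]

theorem eq_zero_of_ip_self {ξ : E} (h : ip (B := B) ξ ξ = 0) : ξ = 0 := by
  have := norm_sq (B := B) ξ
  rw [h, norm_zero] at this
  exact norm_eq_zero.1 (by simpa using this)

variable (B) in
theorem ext_ip {ξ η : E} (h : ∀ ζ : E, ip (B := B) ζ ξ = ip ζ η) : ξ = η := by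
  rw [← sub_eq_zero]
  apply eq_zero_of_ip_self (B := B)
  rw [ip_sub_right, h, sub_self]

/-- The Cauchy--Schwarz inequality. -/
theorem norm_ip_le (ξ η : E) : ‖ip (B := B) ξ η‖ ≤ ‖ξ‖ * ‖η‖ := by
  let _ := CStarAlgebra.spectralOrder B
  have _ := CStarAlgebra.spectralOrderedRing B
  have nn : ∀ ζ : E, 0 ≤ ip (B := B) ζ ζ := fun ζ => by
    obtain ⟨b, hb⟩ := ip_self_nonneg (B := B) ζ
    rw [hb]; exact star_mul_self_nonneg b
  by_cases h0 : ξ = 0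
  · subst h0
    have : ip (B := B) (0 : E) η = 0 := by
      have := ip_smul_left (B := B) 0 (0 : E) η
      simpa using this
    simp [this]
  have hpos : 0 < ‖ξ‖ := norm_pos_iff.2 h0
  set c := ip (B := B) ξ η with hc
  have hcs : ip (B := B) η ξ = star c := by rw [hc, star_ip]
  have hz := nn (act ξ c - ((‖ξ‖ ^ 2 : ℝ) : ℂ) • η)
  have h1 : star c * ip ξ ξ * c ≤ (‖ξ‖ ^ 2) • (star c * c) := by
    have := CStarAlgebra.star_left_conjugate_le_norm_smul (a := c) (b := ip (B := B) ξ ξ)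
      (hb := (star_ip ξ ξ : IsSelfAdjoint (ip (B := B) ξ ξ)))
    rwa [← norm_sq] at this
  have key : (‖ξ‖ ^ 2) • (star c * c) ≤ (‖ξ‖ ^ 2) • ((‖ξ‖ ^ 2) • ip (B := B) η η) := by
    have e : ip (B := B) (act ξ c - ((‖ξ‖ ^ 2 : ℝ) : ℂ) • η) (act ξ c - ((‖ξ‖ ^ 2 : ℝ) : ℂ) • η)
        = star c * ip ξ ξ * c - (‖ξ‖ ^ 2) • (star c * c) - (‖ξ‖ ^ 2) • (star c * c)
          + (‖ξ‖ ^ 2) • ((‖ξ‖ ^ 2) • ip (B := B) η η) := by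
      simp only [ip_sub_left, ip_sub_right, ip_smul_left, ip_smul_right, ip_act_left,
        ip_act_right, hcs, ← hc, mul_assoc, Complex.star_def, Complex.conj_ofReal]
      simp only [Complex.coe_smul, smul_mul_assoc, sub_mul, smul_sub, mul_assoc]
      abel
    rw [e] at hz
    have h2 : star c * ip ξ ξ * c - (‖ξ‖ ^ 2) • (star c * c) ≤ 0 := sub_nonpos.2 h1
    have h3 := add_le_add_left h2
      (-((‖ξ‖ ^ 2) • (star c * c)) + (‖ξ‖ ^ 2) • ((‖ξ‖ ^ 2) • ip (B := B) η η))
    have h4 : 0 ≤ -((‖ξ‖ ^ 2) • (star c * c)) + (‖ξ‖ ^ 2) • ((‖ξ‖ ^ 2) • ip (B := B) η η) := by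
      refine hz.trans (le_trans (le_of_eq ?_) (h3.trans (le_of_eq ?_)))
      · abel
      · abel
    rw [neg_add_eq_sub] at h4
    exact sub_nonneg.1 h4
  have hn := CStarAlgebra.norm_le_norm_of_nonneg_of_le
    (smul_nonneg (by positivity) (star_mul_self_nonneg c)) key
  rw [norm_smul, norm_smul, norm_smul, CStarRing.norm_star_mul_self, ← norm_sq] at hn
  simp only [norm_pow, norm_norm] at hn
  have h5 : ‖c‖ * ‖c‖ ≤ ‖ξ‖ ^ 2 * ‖η‖ ^ 2 := le_of_mul_le_mul_left hn (by positivity)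
  exact abs_le_of_sq_le_sq' (by nlinarith) (by positivity) |>.2

theorem norm_act_le (ξ : E) (b : B) : ‖act ξ b‖ ≤ ‖ξ‖ * ‖b‖ := by
  refine abs_le_of_sq_le_sq' ?_ (by positivity) |>.2
  rw [norm_sq (B := B), ip_act_left, ip_act_right]
  calc ‖star b * (ip ξ ξ * b)‖ ≤ ‖star b‖ * (‖ip (B := B) ξ ξ‖ * ‖b‖) :=
        (norm_mul_le _ _).trans (by gcongr; exact norm_mul_le _ _)
    _ = (‖ξ‖ * ‖b‖) ^ 2 := by rw [norm_star, ← norm_sq]; ring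

theorem act_add (ξ : E) (a b : B) : act ξ (a + b) = act ξ a + act ξ b := by
  apply ext_ip B; intro ζ
  simp only [ip_act_right, ip_add_right, mul_add]

theorem act_smul (c : ℂ) (ξ : E) (b : B) : act ξ (c • b) = c • act ξ b := by
  apply ext_ip B; intro ζ
  simp only [ip_act_right, ip_smul_right, mul_smul_comm]

theorem act_act (ξ : E) (a b : B) : act (act ξ a) b = act ξ (a * b) := by
  apply ext_ip B; intro ζ
  simp only [ip_act_right, mul_assoc]

variable (B) in
/-- The operator `|ξ⟩⟨η| : E → F`, `ζ ↦ ξ ⟨η, ζ⟩`, for `ξ ∈ F`, `η ∈ E`. -/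
def rankOne (ξ : F) (η : E) : E →L[ℂ] F :=
  LinearMap.mkContinuous
    { toFun := fun ζ => act ξ (ip (B := B) η ζ)
      map_add' := fun ζ ζ' => by rw [ip_add_right, act_add]
      map_smul' := fun c ζ => by rw [ip_smul_right, act_smul, RingHom.id_apply] }
    (‖ξ‖ * ‖η‖) fun ζ => by
      refine (norm_act_le _ _).trans ?_
      rw [mul_assoc]
      exact mul_le_mul_of_nonneg_left (norm_ip_le η ζ) (norm_nonneg _)

@[simp] theorem rankOne_apply (ξ : F) (η ζ : E) :
    rankOne B ξ η ζ = act ξ (ip (B := B) η ζ) := rfl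

variable (B E F) in
/-- The space `𝕂(E, F)` of compact operators between Hilbert `B`-modules: the closed linear span
of the operators `|ξ⟩⟨η|` in the operator norm. -/
def compactOperators : Submodule ℂ (E →L[ℂ] F) :=
  (Submodule.span ℂ {T | ∃ (ξ : F) (η : E), T = rankOne B ξ η}).topologicalClosure

theorem isClosed_compactOperators : IsClosed (compactOperators B E F : Set (E →L[ℂ] F)) :=
  Submodule.isClosed_topologicalClosure _

theorem rankOne_mem (ξ : F) (η : E) : rankOne B ξ η ∈ compactOperators B E F :=
  Submodule.le_topologicalClosure _ (Submodule.subset_span ⟨ξ, η, rfl⟩)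

instance : CompleteSpace (compactOperators B E F) :=
  isClosed_compactOperators.completeSpace_coe

variable (B) in
/-- `S` is the adjoint of `T`. -/
def IsAdjoint (T : E →L[ℂ] F) (S : F →L[ℂ] E) : Prop :=
  ∀ ξ η, ip (B := B) (T ξ) η = ip ξ (S η)

theorem IsAdjoint.symm {T : E →L[ℂ] F} {S : F →L[ℂ] E} (h : IsAdjoint B T S) :
    IsAdjoint B S T := fun ξ η => by
  rw [← star_ip, ← h, star_ip]

theorem IsAdjoint.unique {T : E →L[ℂ] F} {S S' : F →L[ℂ] E} (h : IsAdjoint B T S)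
    (h' : IsAdjoint B T S') : S = S' := by
  ext η
  apply ext_ip B; intro ζ
  rw [← h, ← h']

theorem IsAdjoint.norm_le {T : E →L[ℂ] F} {S : F →L[ℂ] E} (h : IsAdjoint B T S) : ‖S‖ ≤ ‖T‖ := by
  refine ContinuousLinearMap.opNorm_le_bound _ (norm_nonneg _) fun η => ?_
  by_cases h0 : ‖S η‖ = 0
  · rw [h0]; positivity
  have hp : 0 < ‖S η‖ := lt_of_le_of_ne (norm_nonneg _) (Ne.symm h0)
  have : ‖S η‖ * ‖S η‖ ≤ ‖S η‖ * (‖T‖ * ‖η‖) := by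
    calc ‖S η‖ * ‖S η‖ = ‖ip (B := B) (S η) (S η)‖ := by rw [← norm_sq]; ring
      _ = ‖ip (B := B) (T (S η)) η‖ := by rw [h]
      _ ≤ ‖T (S η)‖ * ‖η‖ := norm_ip_le _ _
      _ ≤ (‖T‖ * ‖S η‖) * ‖η‖ := by gcongr; exact T.le_opNorm _
      _ = _ := by ring
  exact le_of_mul_le_mul_left this hp

theorem IsAdjoint.norm_eq {T : E →L[ℂ] F} {S : F →L[ℂ] E} (h : IsAdjoint B T S) : ‖S‖ = ‖T‖ :=
  le_antisymm h.norm_le h.symm.norm_le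

theorem IsAdjoint.add {T T' : E →L[ℂ] F} {S S' : F →L[ℂ] E} (h : IsAdjoint B T S)
    (h' : IsAdjoint B T' S') : IsAdjoint B (T + T') (S + S') := fun ξ η => by
  simp only [_root_.add_apply, ip_add_left, ip_add_right, h ξ η, h' ξ η]

theorem IsAdjoint.sub {T T' : E →L[ℂ] F} {S S' : F →L[ℂ] E} (h : IsAdjoint B T S)
    (h' : IsAdjoint B T' S') : IsAdjoint B (T - T') (S - S') := fun ξ η => by
  simp only [_root_.sub_apply, ip_sub_left, ip_sub_right, h ξ η, h' ξ η]

theorem IsAdjoint.smul (c : ℂ) {T : E →L[ℂ] F} {S : F →L[ℂ] E} (h : IsAdjoint B T S) :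
    IsAdjoint B (c • T) (star c • S) := fun ξ η => by
  simp only [_root_.smul_apply, ip_smul_left, ip_smul_right, h ξ η]

theorem IsAdjoint.comp {T : F →L[ℂ] H} {S : H →L[ℂ] F} {T' : E →L[ℂ] F} {S' : F →L[ℂ] E}
    (h : IsAdjoint B T S) (h' : IsAdjoint B T' S') : IsAdjoint B (T.comp T') (S'.comp S) :=
  fun ξ η => by
    simp only [ContinuousLinearMap.comp_apply, h _ _, h' _ _]

theorem isAdjoint_rankOne (ξ : F) (η : E) : IsAdjoint B (rankOne B ξ η) (rankOne B η ξ) :=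
  fun ζ ζ' => by
    rw [rankOne_apply, rankOne_apply, ip_act_left, ip_act_right, star_ip]

/-- Compact operators are adjointable, with compact adjoint. -/
theorem exists_adjoint {T : E →L[ℂ] F} (hT : T ∈ compactOperators B E F) :
    ∃ S ∈ compactOperators B F E, IsAdjoint B T S := by
  have hspan : ∀ T ∈ Submodule.span ℂ {T : E →L[ℂ] F | ∃ (ξ : F) (η : E), T = rankOne B ξ η},
      ∃ S ∈ compactOperators B F E, IsAdjoint B T S := by
    intro T hT
    induction hT using Submodule.span_induction with
    | mem T h =>
      obtain ⟨ξ, η, rfl⟩ := h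
      exact ⟨_, rankOne_mem η ξ, isAdjoint_rankOne ξ η⟩
    | zero => exact ⟨0, zero_mem _, fun ξ η => by
        have h := ip_smul_left (B := B) 0 (0 : F) η
        have h' := ip_smul_right (B := B) 0 ξ (0 : E)
        rw [zero_smul ℂ (0 : F), star_zero, zero_smul] at h
        rw [zero_smul ℂ (0 : E), zero_smul] at h'
        rw [_root_.zero_apply, _root_.zero_apply, h, h']⟩
    | add T T' _ _ h h' =>
      obtain ⟨S, hS, h⟩ := h
      obtain ⟨S', hS', h'⟩ := h'
      exact ⟨_, add_mem hS hS', h.add h'⟩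
    | smul c T _ h =>
      obtain ⟨S, hS, h⟩ := h
      exact ⟨_, Submodule.smul_mem _ _ hS, h.smul c⟩
  obtain ⟨t, ht, hlim⟩ := mem_closure_iff_seq_limit.1
    (show T ∈ closure (_ : Set (E →L[ℂ] F)) from hT)
  choose s hs hadj using fun n => hspan (t n) (ht n)
  have hc : CauchySeq s := by
    have := hlim.cauchySeq
    rw [Metric.cauchySeq_iff'] at this ⊢
    intro ε hε
    obtain ⟨N, hN⟩ := this ε hε
    refine ⟨N, fun n hn => ?_⟩
    have := hN n hn
    rwa [dist_eq_norm, ← ((hadj n).sub (hadj N)).norm_eq, ← dist_eq_norm] at this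
  obtain ⟨S, hS⟩ := cauchySeq_tendsto_of_complete hc
  refine ⟨S, isClosed_compactOperators.mem_of_tendsto hS (Filter.Eventually.of_forall hs),
    fun ξ η => ?_⟩
  have h1 : Filter.Tendsto (fun n => ip (B := B) (t n ξ) η) Filter.atTop
      (nhds (ip (B := B) (T ξ) η)) := by
    rw [tendsto_iff_norm_sub_tendsto_zero] at hlim ⊢
    refine squeeze_zero (fun _ => norm_nonneg _) (fun n => ?_)
      (by simpa using hlim.mul_const (‖ξ‖ * ‖η‖))
    rw [← ip_sub_left, ← mul_assoc]
    refine (norm_ip_le _ _).trans ?_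
    gcongr
    exact (t n - T).le_opNorm ξ
  have h2 : Filter.Tendsto (fun n => ip (B := B) ξ (s n η)) Filter.atTop
      (nhds (ip (B := B) ξ (S η))) := by
    rw [tendsto_iff_norm_sub_tendsto_zero] at hS ⊢
    refine squeeze_zero (fun _ => norm_nonneg _) (fun n => ?_)
      (by simpa using hS.mul_const (‖η‖ * ‖ξ‖))
    rw [← ip_sub_right, ← mul_assoc]
    refine (norm_ip_le _ _).trans ?_
    rw [mul_comm]
    gcongr
    exact (s n - S).le_opNorm η
  exact tendsto_nhds_unique h1 (by simpa only [hadj _ ξ η] using h2)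

theorem comp_mem {T : F →L[ℂ] H} {S : E →L[ℂ] F} (hT : T ∈ compactOperators B F H)
    (hS : S ∈ compactOperators B E F) : T.comp S ∈ compactOperators B E H := by
  have h1 : ∀ (ξ : H) (η : F), ∀ S ∈ compactOperators B E F,
      (rankOne B ξ η).comp S ∈ compactOperators B E H := by
    intro ξ η S hS
    obtain ⟨R, -, hR⟩ := exists_adjoint hS
    convert rankOne_mem (B := B) ξ (R η) using 1
    ext ζ
    rw [ContinuousLinearMap.comp_apply, rankOne_apply, rankOne_apply, hR.symm]
  have h2 : (Submodule.span ℂ {T : F →L[ℂ] H | ∃ (ξ : H) (η : F), T = rankOne B ξ η}) ≤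
      (compactOperators B E H).comap ((ContinuousLinearMap.compL ℂ E F H).flip S).toLinearMap := by
    rw [Submodule.span_le]
    rintro _ ⟨ξ, η, rfl⟩
    exact h1 ξ η S hS
  exact Submodule.topologicalClosure_minimal _ h2
    (isClosed_compactOperators.preimage ((ContinuousLinearMap.compL ℂ E F H).flip S).continuous) hT

/-- The composition `𝕂(F, H) × 𝕂(E, F) → 𝕂(E, H)`. -/
def compComp (T : compactOperators B F H) (S : compactOperators B E F) : compactOperators B E H :=
  ⟨(T : F →L[ℂ] H).comp (S : E →L[ℂ] F), comp_mem T.2 S.2⟩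

/-- The adjoint `𝕂(E, F) → 𝕂(F, E)`, `T ↦ T*`. -/
def compAdj (T : compactOperators B E F) : compactOperators B F E :=
  ⟨(exists_adjoint T.2).choose, (exists_adjoint T.2).choose_spec.1⟩

theorem isAdjoint_compAdj (T : compactOperators B E F) :
    IsAdjoint B (T : E →L[ℂ] F) (compAdj T : F →L[ℂ] E) :=
  (exists_adjoint T.2).choose_spec.2

/-- `𝕂(E) = 𝕂(E, E)` is a C⋆-algebra for composition, adjoints and the operator norm. -/
instance : NonUnitalCStarAlgebra (compactOperators B E E) where
  __ := (inferInstance : NormedAddCommGroup (compactOperators B E E))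
  __ := (inferInstance : NormedSpace ℂ (compactOperators B E E))
  __ := (inferInstance : CompleteSpace (compactOperators B E E))
  mul := compComp
  star := compAdj
  left_distrib T S R := Subtype.ext (ContinuousLinearMap.comp_add _ _ _)
  right_distrib T S R := Subtype.ext (ContinuousLinearMap.add_comp _ _ _)
  zero_mul T := Subtype.ext (ContinuousLinearMap.zero_comp _)
  mul_zero T := Subtype.ext (ContinuousLinearMap.comp_zero _)
  mul_assoc T S R := rfl
  norm_mul_le T S := ContinuousLinearMap.opNorm_comp_le _ _
  star_involutive T := Subtype.ext
    ((isAdjoint_compAdj (compAdj T)).unique (isAdjoint_compAdj T).symm)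
  star_mul T S := Subtype.ext ((isAdjoint_compAdj (compComp T S)).unique
    ((isAdjoint_compAdj T).comp (isAdjoint_compAdj S)))
  star_add T S := Subtype.ext ((isAdjoint_compAdj (T + S)).unique
    ((isAdjoint_compAdj T).add (isAdjoint_compAdj S)))
  star_smul c T := Subtype.ext ((isAdjoint_compAdj (c • T)).unique
    ((isAdjoint_compAdj T).smul c))
  smul_assoc c T S := rfl
  smul_comm c T S := Subtype.ext (by
    change c • (T : E →L[ℂ] E).comp (S : E →L[ℂ] E) = (T : E →L[ℂ] E).comp (c • (S : E →L[ℂ] E))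
    rw [ContinuousLinearMap.comp_smul])
  norm_mul_self_le T := by
    change ‖(T : E →L[ℂ] E)‖ * ‖(T : E →L[ℂ] E)‖ ≤
      ‖(compAdj T : E →L[ℂ] E).comp (T : E →L[ℂ] E)‖
    set R := (compAdj T : E →L[ℂ] E).comp (T : E →L[ℂ] E) with hR
    have h : ‖(T : E →L[ℂ] E)‖ ≤ √‖R‖ := by
      refine ContinuousLinearMap.opNorm_le_bound _ (by positivity) fun ξ => ?_
      refine abs_le_of_sq_le_sq' ?_ (by positivity) |>.2
      calc ‖(T : E →L[ℂ] E) ξ‖ ^ 2 = ‖ip (B := B) ξ (R ξ)‖ := by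
            rw [norm_sq (B := B), isAdjoint_compAdj T]; rfl
        _ ≤ ‖ξ‖ * (‖R‖ * ‖ξ‖) := (norm_ip_le _ _).trans (by gcongr; exact R.le_opNorm ξ)
        _ = (√‖R‖ * ‖ξ‖) ^ 2 := by rw [mul_pow, Real.sq_sqrt (norm_nonneg _)]; ring
    calc _ ≤ √‖R‖ * √‖R‖ := by gcongr
      _ = ‖R‖ := Real.mul_self_sqrt (norm_nonneg _)

end HilbertModule

/-! ## Correspondences and product systems -/

open HilbertModule

/-- A correspondence from `A` to `B`: a Hilbert `B`-module with a nondegenerate left action of `A`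
by adjointable operators. -/
class Correspondence (A : Type*) (B : Type*) (E : Type*) [NonUnitalCStarAlgebra A]
    [NonUnitalCStarAlgebra B] [NormedAddCommGroup E] [NormedSpace ℂ E] [CompleteSpace E]
    extends HilbertModule B E where
  left : A →ₗ[ℂ] (E →L[ℂ] E)
  left_mul : ∀ a b ξ, left (a * b) ξ = left a (left b ξ)
  left_star : ∀ a ξ η, ip (left a ξ) η = ip ξ (left (star a) η)
  nondegenerate : (Submodule.span ℂ {ζ | ∃ a ξ, ζ = left a ξ}).topologicalClosure = ⊤

namespace Correspondence

variable (A B : Type*) [NonUnitalCStarAlgebra A] [NonUnitalCStarAlgebra B]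
variable (E : Type*) [NormedAddCommGroup E] [NormedSpace ℂ E] [CompleteSpace E]

/-- A correspondence is proper if `A` acts by compact operators. -/
def IsProper [Correspondence A B E] : Prop :=
  ∀ a : A, left (B := B) a ∈ compactOperators B E E

variable {E}
variable (C : Type*) [NonUnitalCStarAlgebra C]
variable {F : Type*} [NormedAddCommGroup F] [NormedSpace ℂ F] [CompleteSpace F]
variable {H : Type*} [NormedAddCommGroup H] [NormedSpace ℂ H] [CompleteSpace H]

/-- `ξ ⊗ η ↦ m ξ η` defines an isomorphism of correspondences `E ⊗_B F ≅ H` from `A` to `C`.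
Recall that `E ⊗_B F` is the completion of the algebraic tensor product for the inner product
`⟨ξ₁ ⊗ η₁, ξ₂ ⊗ η₂⟩ = ⟨η₁, ⟨ξ₁, ξ₂⟩ η₂⟩`, with left action `a (ξ ⊗ η) = (a ξ) ⊗ η`.  So `m` induces
a unitary bimodule map if and only if it respects inner products and left actions on elementary
tensors and has dense range. -/
structure IsTensorIso [Correspondence A B E] [Correspondence B C F] [Correspondence A C H]
    (m : E →ₗ[ℂ] F →ₗ[ℂ] H) : Prop where
  ip_map : ∀ ξ₁ η₁ ξ₂ η₂, ip (B := C) (m ξ₁ η₁) (m ξ₂ η₂) =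
    ip η₁ (left (A := B) (B := C) (ip (B := B) ξ₁ ξ₂) η₂)
  left_map : ∀ (a : A) ξ η, m (left (B := B) a ξ) η = left (B := C) a (m ξ η)
  dense : (Submodule.span ℂ {ζ | ∃ ξ η, ζ = m ξ η}).topologicalClosure = ⊤

end Correspondence

open Correspondence

/-- A product system `(A, E_p, μ_{p,q})` over a monoid `P` (with nondegenerate left actions).
The isomorphisms `μ_{p,q} : E_p ⊗_A E_q → E_{pq}` are given by the maps `mul`, where
`mul (h : p * q = r) ξ η ∈ E_r` is `μ_{p,q}(ξ ⊗ η)`.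
The fibre `E_1` is identified with `A`, with its usual bimodule structure, through `unit`. -/
structure ProductSystem (P : Type w) [Monoid P] (A : Type u) [NonUnitalCStarAlgebra A] where
  E : P → Type u
  [normedAddCommGroup : ∀ p, NormedAddCommGroup (E p)]
  [normedSpace : ∀ p, NormedSpace ℂ (E p)]
  [completeSpace : ∀ p, CompleteSpace (E p)]
  [correspondence : ∀ p, Correspondence A A (E p)]
  mul : ∀ {p q r : P}, p * q = r → (E p →ₗ[ℂ] E q →ₗ[ℂ] E r)
  isTensorIso : ∀ {p q r : P} (h : p * q = r), IsTensorIso A A A (mul h)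
  mul_assoc : ∀ {p q t pq qt pqt : P} (h₁ : p * q = pq) (h₂ : pq * t = pqt) (h₃ : q * t = qt)
    (h₄ : p * qt = pqt) (ξ : E p) (η : E q) (ζ : E t),
    mul h₂ (mul h₁ ξ η) ζ = mul h₄ ξ (mul h₃ η ζ)
  unit : A ≃ₗ[ℂ] E 1
  ip_unit : ∀ a b : A, ip (unit a) (unit b) = star a * b
  left_unit : ∀ a b : A, left (B := A) a (unit b) = unit (a * b)
  unit_mul : ∀ (p : P) (a : A) (ξ : E p), mul (one_mul p) (unit a) ξ = left (B := A) a ξ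
  mul_unit : ∀ (p : P) (ξ : E p) (a : A), mul (mul_one p) ξ (unit a) = act ξ a

namespace ProductSystem

attribute [instance] normedAddCommGroup normedSpace completeSpace correspondence

variable {P : Type w} [Monoid P] {A : Type u} [NonUnitalCStarAlgebra A] (X : ProductSystem P A)

/-- A product system is proper if all its fibres are proper correspondences. -/
def IsProper : Prop := ∀ p, Correspondence.IsProper A A (X.E p)

/-- The Banach space `𝕂(E_{p₂}, E_{p₁})`. -/
abbrev K (p₁ p₂ : P) : Type u := compactOperators A (X.E p₂) (X.E p₁)

/-- `T' = μ_{p₁,q} (T ⊗ id) μ_{p₂,q}*`, that is, `T'` is the operator in `𝕂(E_{p₂q}, E_{p₁q})`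
with `T' (μ_{p₂,q}(ξ ⊗ η)) = μ_{p₁,q}(T ξ ⊗ η)` for all `ξ ∈ E_{p₂}`, `η ∈ E_q`. -/
def IsAmplification {p₁ p₂ : P} (q : P) (T : X.K p₁ p₂) (T' : X.K (p₁ * q) (p₂ * q)) : Prop :=
  ∀ (ξ : X.E p₂) (η : X.E q),
    (T' : X.E (p₂ * q) →L[ℂ] X.E (p₁ * q)) (X.mul rfl ξ η) =
      X.mul rfl ((T : X.E p₂ →L[ℂ] X.E p₁) ξ) η

/-! ## The Cuntz--Pimsner algebra -/

/-- A (Toeplitz) representation of a product system in a C⋆-algebra `D`. -/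
structure Representation (D : Type v) [NonUnitalCStarAlgebra D] where
  π : A →⋆ₙₐ[ℂ] D
  S : ∀ p, X.E p →ₗ[ℂ] D
  S_unit : ∀ a, S 1 (X.unit a) = π a
  S_mul : ∀ (p q : P) (ξ : X.E p) (η : X.E q), S p ξ * S q η = S (p * q) (X.mul rfl ξ η)
  star_S_mul : ∀ (p : P) (ξ η : X.E p), star (S p ξ) * S p η = π (ip ξ η)

variable {X}

theorem Representation.norm_le {D : Type v} [NonUnitalCStarAlgebra D] (ρ : X.Representation D)
    (p : P) (ξ : X.E p) : ‖ρ.S p ξ‖ ≤ ‖ξ‖ := by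
  refine abs_le_of_sq_le_sq' ?_ (norm_nonneg _) |>.2
  rw [norm_sq (B := A) ξ, pow_two, ← CStarRing.norm_star_mul_self, ρ.star_S_mul]
  exact NonUnitalStarAlgHom.norm_apply_le ρ.π _

/-- Cuntz--Pimsner covariance of a representation: for each `p`, the ⋆-homomorphism
`ϑ_p : 𝕂(E_p) → D`, `|ξ⟩⟨η| ↦ S_p(ξ) S_p(η)*`, satisfies `ϑ_p(φ_p(a)) = π(a)` for all `a ∈ A` whose
left action `φ_p(a)` on `E_p` is compact. -/
def Representation.IsCuntzPimsnerCovariant {D : Type v} [NonUnitalCStarAlgebra D]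
    (ρ : X.Representation D) : Prop :=
  ∀ p, ∃ ϑ : X.K p p →⋆ₙₐ[ℂ] D,
    (∀ ξ η : X.E p, ϑ ⟨rankOne A ξ η, rankOne_mem ξ η⟩ = ρ.S p ξ * star (ρ.S p η)) ∧
    ∀ (a : A) (h : left (B := A) a ∈ compactOperators A (X.E p) (X.E p)),
      ϑ ⟨left (B := A) a, h⟩ = ρ.π a

variable (X)

/-- The Cuntz--Pimsner covariant representations of a product system on (small) C⋆-algebras. -/
structure CovariantRep : Type (max u w + 1) where
  D : Type (max u w)
  [cstar : NonUnitalCStarAlgebra D]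
  rep : X.Representation D
  covariant : rep.IsCuntzPimsnerCovariant

attribute [instance] CovariantRep.cstar

/-- The family `(S_p(ξ))` over all Cuntz--Pimsner covariant representations. -/
def universalS (p : P) (ξ : X.E p) : lp (fun ρ : X.CovariantRep => ρ.D) ∞ :=
  ⟨fun ρ => ρ.rep.S p ξ, memℓp_infty ⟨‖ξ‖, by rintro _ ⟨ρ, rfl⟩; exact ρ.rep.norm_le p ξ⟩⟩

/-- The Cuntz--Pimsner algebra of a product system: the universal C⋆-algebra for Cuntz--Pimsner
covariant representations, that is, the C⋆-algebra generated by the universal such representation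
(the direct sum of all of them; any Cuntz--Pimsner covariant representation generates a
C⋆-algebra that is small enough to be isomorphic to one in the universe considered). -/
def cuntzPimsnerSubalgebra :
    NonUnitalStarSubalgebra ℂ (lp (fun ρ : X.CovariantRep => ρ.D) ∞) :=
  (NonUnitalStarAlgebra.adjoin ℂ {c | ∃ p ξ, c = X.universalS p ξ}).topologicalClosure

/-- The Cuntz--Pimsner algebra of a product system. -/
abbrev CuntzPimsnerAlgebra : Type (max u w + 1) := X.cuntzPimsnerSubalgebra

instance : NonUnitalCStarAlgebra X.CuntzPimsnerAlgebra :=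
  NonUnitalStarSubalgebra.nonUnitalCStarAlgebra _
    (h_closed := NonUnitalStarSubalgebra.isClosed_topologicalClosure _)

end ProductSystem

/-! ## Fell bundles -/

/-- A Fell bundle over a discrete group `G`.  The multiplication `fiber g × fiber h → fiber (gh)` is
written `mul (e : g * h = k) : fiber g → fiber h → fiber k`, and the involution
`fiber g → fiber g⁻¹` is written `adj (e : g⁻¹ = k) : fiber g → fiber k`. -/
structure FellBundle (G : Type w) [Group G] where
  fiber : G → Type f
  [normedAddCommGroup : ∀ g, NormedAddCommGroup (fiber g)]
  [normedSpace : ∀ g, NormedSpace ℂ (fiber g)]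
  [completeSpace : ∀ g, CompleteSpace (fiber g)]
  mul : ∀ {g h k : G}, g * h = k → (fiber g →ₗ[ℂ] fiber h →ₗ[ℂ] fiber k)
  adj : ∀ {g k : G}, g⁻¹ = k → (fiber g →ₗ⋆[ℂ] fiber k)
  mul_assoc : ∀ {g h k gh hk ghk : G} (e₁ : g * h = gh) (e₂ : gh * k = ghk) (e₃ : h * k = hk)
    (e₄ : g * hk = ghk) (a : fiber g) (b : fiber h) (c : fiber k),
    mul e₂ (mul e₁ a b) c = mul e₄ a (mul e₃ b c)
  adj_adj : ∀ {g k : G} (e : g⁻¹ = k) (e' : k⁻¹ = g) (a : fiber g), adj e' (adj e a) = a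
  adj_mul : ∀ {g h k g' h' k' : G} (e₁ : g * h = k) (e₂ : k⁻¹ = k') (e₃ : h⁻¹ = h')
    (e₄ : g⁻¹ = g') (e₅ : h' * g' = k') (a : fiber g) (b : fiber h),
    adj e₂ (mul e₁ a b) = mul e₅ (adj e₃ b) (adj e₄ a)
  norm_mul_le : ∀ {g h k : G} (e : g * h = k) (a : fiber g) (b : fiber h),
    ‖mul e a b‖ ≤ ‖a‖ * ‖b‖
  norm_adj : ∀ {g k : G} (e : g⁻¹ = k) (a : fiber g), ‖adj e a‖ = ‖a‖
  norm_adj_mul_self : ∀ {g k : G} (e : g⁻¹ = k) (e' : k * g = 1) (a : fiber g),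
    ‖mul e' (adj e a) a‖ = ‖a‖ ^ 2
  adj_mul_self_nonneg : ∀ {g k : G} (e : g⁻¹ = k) (e' : k * g = 1) (a : fiber g),
    ∃ b : fiber 1, mul e' (adj e a) a = mul (one_mul 1) (adj inv_one b) b

namespace FellBundle

attribute [instance] normedAddCommGroup normedSpace completeSpace

variable {G : Type w} [Group G] (O : FellBundle.{w, f} G)

/-- The unit fibre of a Fell bundle is a C⋆-algebra. -/
instance : NonUnitalCStarAlgebra (O.fiber 1) where
  __ := O.normedAddCommGroup 1
  __ := O.normedSpace 1
  __ := O.completeSpace 1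
  mul a b := O.mul (one_mul 1) a b
  star a := O.adj inv_one a
  left_distrib a b c := map_add _ b c
  right_distrib a b c := LinearMap.map_add₂ _ a b c
  zero_mul a := LinearMap.map_zero₂ _ a
  mul_zero a := map_zero _
  mul_assoc a b c := O.mul_assoc _ _ _ _ a b c
  norm_mul_le a b := O.norm_mul_le _ a b
  star_involutive a := O.adj_adj _ _ a
  star_mul a b := O.adj_mul _ _ _ _ _ a b
  star_add a b := map_add _ a b
  star_smul c a := LinearMap.map_smulₛₗ _ c a
  smul_assoc c a b := LinearMap.map_smul₂ _ c a b
  smul_comm c a b := (map_smul _ c b).symm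
  norm_mul_self_le a := by
    have := O.norm_adj_mul_self inv_one (one_mul 1) a
    rw [pow_two] at this
    exact this.ge

/-- A representation of a Fell bundle in a C⋆-algebra `D`. -/
structure Representation (D : Type v) [NonUnitalCStarAlgebra D] where
  π : ∀ g, O.fiber g →ₗ[ℂ] D
  map_mul : ∀ {g h k : G} (e : g * h = k) (a : O.fiber g) (b : O.fiber h),
    π k (O.mul e a b) = π g a * π h b
  map_adj : ∀ {g k : G} (e : g⁻¹ = k) (a : O.fiber g), π k (O.adj e a) = star (π g a)

variable {O}

theorem Representation.norm_le {D : Type v} [NonUnitalCStarAlgebra D] (ρ : O.Representation D)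
    (g : G) (a : O.fiber g) : ‖ρ.π g a‖ ≤ ‖a‖ := by
  let π₁ : O.fiber 1 →⋆ₙₐ[ℂ] D :=
    { toFun := ρ.π 1
      map_smul' := map_smul _
      map_zero' := map_zero _
      map_add' := map_add _
      map_mul' := fun a b => ρ.map_mul (one_mul 1) a b
      map_star' := fun a => ρ.map_adj inv_one a }
  refine abs_le_of_sq_le_sq' ?_ (norm_nonneg _) |>.2
  rw [pow_two, ← CStarRing.norm_star_mul_self, ← ρ.map_adj rfl,
    ← ρ.map_mul (inv_mul_cancel g), ← O.norm_adj_mul_self rfl (inv_mul_cancel g)]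
  exact NonUnitalStarAlgHom.norm_apply_le π₁ _

variable (O)

/-- The representations of a Fell bundle on (small) C⋆-algebras. -/
structure Rep : Type (max f w + 1) where
  D : Type (max f w)
  [cstar : NonUnitalCStarAlgebra D]
  rep : O.Representation D

attribute [instance] Rep.cstar

/-- The family `(π_g(a))` over all representations of the Fell bundle. -/
def universalπ (g : G) (a : O.fiber g) : lp (fun ρ : O.Rep => ρ.D) ∞ :=
  ⟨fun ρ => ρ.rep.π g a, memℓp_infty ⟨‖a‖, by rintro _ ⟨ρ, rfl⟩; exact ρ.rep.norm_le g a⟩⟩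

/-- The full sectional C⋆-algebra of a Fell bundle over a discrete group: the completion of the
⋆-algebra of finitely supported sections in the norm given by the supremum over all
representations, that is, the C⋆-algebra generated by the universal representation (the direct
sum of all of them; any representation generates a C⋆-algebra that is small enough to be
isomorphic to one in the universe considered). -/
def fullSectionalSubalgebra : NonUnitalStarSubalgebra ℂ (lp (fun ρ : O.Rep => ρ.D) ∞) :=
  (NonUnitalStarAlgebra.adjoin ℂ {c | ∃ g a, c = O.universalπ g a}).topologicalClosure

/-- The full sectional C⋆-algebra of a Fell bundle. -/
abbrev FullSectionalAlgebra : Type (max f w + 1) := O.fullSectionalSubalgebra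

instance : NonUnitalCStarAlgebra O.FullSectionalAlgebra :=
  NonUnitalStarSubalgebra.nonUnitalCStarAlgebra _
    (h_closed := NonUnitalStarSubalgebra.isClosed_topologicalClosure _)

end FellBundle

/-! ## Ore monoids and their group completion -/

/-- Right Ore monoids. -/
class RightOreMonoid (P : Type*) [Monoid P] : Prop where
  exists_common_mul : ∀ x₁ x₂ : P, ∃ y₁ y₂, x₁ * y₁ = x₂ * y₂
  exists_mul_eq : ∀ x y₁ y₂ : P, x * y₁ = x * y₂ → ∃ z, y₁ * z = y₂ * z

namespace RightOreMonoid

variable (P : Type w) [Monoid P] [RightOreMonoid P]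

/-- The relation `(p₁, q₁) ∼ (p₂, q₂)` if `(p₁ t₁, q₁ t₁) = (p₂ t₂, q₂ t₂)` for some `t₁, t₂`, on
formal quotients `p q⁻¹`. -/
def fracSetoid : Setoid (P × P) where
  r a b := ∃ t₁ t₂ : P, a.1 * t₁ = b.1 * t₂ ∧ a.2 * t₁ = b.2 * t₂
  iseqv :=
    { refl := fun _ => ⟨1, 1, rfl, rfl⟩
      symm := fun ⟨t₁, t₂, h, h'⟩ => ⟨t₂, t₁, h.symm, h'.symm⟩
      trans := by
        rintro a b c ⟨t₁, t₂, h, h'⟩ ⟨s₁, s₂, k, k'⟩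
        obtain ⟨m, n, e⟩ := exists_common_mul t₂ s₁
        refine ⟨t₁ * m, s₂ * n, ?_, ?_⟩
        · rw [← mul_assoc, h, mul_assoc, e, ← mul_assoc, k, mul_assoc]
        · rw [← mul_assoc, h', mul_assoc, e, ← mul_assoc, k', mul_assoc] }

/-- The group completion `G` of a right Ore monoid: the group of formal quotients `p q⁻¹`. -/
def GroupCompletion : Type w := Quotient (fracSetoid P)

variable {P}

/-- The element `p q⁻¹` of the group completion. -/
def frac (p q : P) : GroupCompletion P := Quotient.mk (fracSetoid P) (p, q)

theorem frac_eq {p q p' q' : P} : frac p q = frac p' q' ↔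
    ∃ t₁ t₂ : P, p * t₁ = p' * t₂ ∧ q * t₁ = q' * t₂ :=
  Quotient.eq (r := fracSetoid P)

theorem frac_mul_right (p q t : P) : frac (p * t) (q * t) = frac p q :=
  frac_eq.2 ⟨1, t, by simp, by simp⟩

theorem frac_self (p : P) : frac p p = frac 1 1 := by
  simpa using frac_mul_right (1 : P) 1 p

theorem mul_well_defined {p q r s p' q' r' s' t₁ t₂ t₁' t₂' : P} (h : frac p q = frac p' q')
    (h' : frac r s = frac r' s') (e : q * t₁ = r * t₂) (e' : q' * t₁' = r' * t₂') :
    frac (p * t₁) (s * t₂) = frac (p' * t₁') (s' * t₂') := by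
  obtain ⟨a, a', hp, hq⟩ := frac_eq.1 h
  obtain ⟨b, b', hr, hs⟩ := frac_eq.1 h'
  obtain ⟨m, n, hmn⟩ := exists_common_mul t₁ a
  obtain ⟨k, l, hkl⟩ := exists_common_mul t₁' (a' * n)
  obtain ⟨c, d, hcd⟩ := exists_common_mul (t₂ * m * l) b
  have e1 : p' * (t₁' * k) = p * (t₁ * m * l) := by
    rw [hkl, hmn, ← mul_assoc p', ← mul_assoc p', ← mul_assoc p, ← mul_assoc p, hp]
  have e2 : q' * (t₁' * k) = q * (t₁ * m * l) := by
    rw [hkl, hmn, ← mul_assoc q', ← mul_assoc q', ← mul_assoc q, ← mul_assoc q, hq]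
  have e3 : r' * (t₂' * k) = r * (t₂ * m * l) := by
    rw [← mul_assoc, ← e', mul_assoc, e2]
    simp only [← mul_assoc, e]
  have e4 : r' * (t₂' * k * c) = r' * (b' * d) := by
    rw [← mul_assoc, e3, mul_assoc, hcd, ← mul_assoc, hr, mul_assoc]
  obtain ⟨z, hz⟩ := exists_mul_eq _ _ _ e4
  refine frac_eq.2 ⟨m * l * c * z, k * c * z, ?_, ?_⟩
  · calc p * t₁ * (m * l * c * z) = p * (t₁ * m * l) * (c * z) := by simp only [mul_assoc]
      _ = p' * (t₁' * k) * (c * z) := by rw [e1]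
      _ = _ := by simp only [mul_assoc]
  · calc s * t₂ * (m * l * c * z) = s * ((t₂ * m * l) * c) * z := by simp only [mul_assoc]
      _ = s * b * d * z := by rw [hcd]; simp only [mul_assoc]
      _ = s' * (b' * d * z) := by rw [hs]; simp only [mul_assoc]
      _ = s' * (t₂' * k * c * z) := by rw [hz]
      _ = _ := by simp only [mul_assoc]

/-- `p₁ q₁⁻¹ · p₂ q₂⁻¹ = (p₁ t₁) (q₂ t₂)⁻¹` where `q₁ t₁ = p₂ t₂`. -/
instance : Mul (GroupCompletion P) where
  mul := Quotient.lift₂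
    (fun a b => frac (a.1 * (exists_common_mul a.2 b.1).choose)
      (b.2 * (exists_common_mul a.2 b.1).choose_spec.choose))
    (fun a b a' b' h h' => mul_well_defined (Quotient.sound h) (Quotient.sound h')
      (exists_common_mul a.2 b.1).choose_spec.choose_spec
      (exists_common_mul a'.2 b'.1).choose_spec.choose_spec)

theorem frac_mul_frac {p q r s t₁ t₂ : P} (e : q * t₁ = r * t₂) :
    frac p q * frac r s = frac (p * t₁) (s * t₂) :=
  mul_well_defined rfl rfl (exists_common_mul q r).choose_spec.choose_spec e

instance : Group (GroupCompletion P) where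
  mul_assoc := by
    rintro ⟨p₁, q₁⟩ ⟨p₂, q₂⟩ ⟨p₃, q₃⟩
    change frac p₁ q₁ * frac p₂ q₂ * frac p₃ q₃ = frac p₁ q₁ * (frac p₂ q₂ * frac p₃ q₃)
    obtain ⟨t₁, t₂, ht⟩ := exists_common_mul q₁ p₂
    obtain ⟨s₁, s₂, hs⟩ := exists_common_mul q₂ p₃
    obtain ⟨m, n, hmn⟩ := exists_common_mul t₂ s₁
    rw [frac_mul_frac ht, frac_mul_frac hs,
      frac_mul_frac (t₁ := m) (t₂ := s₂ * n)
        (by rw [mul_assoc, hmn, ← mul_assoc, hs, mul_assoc]),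
      frac_mul_frac (t₁ := t₁ * m) (t₂ := n)
        (by rw [← mul_assoc, ht, mul_assoc, hmn, mul_assoc]), mul_assoc, mul_assoc]
  one := frac 1 1
  one_mul := by
    rintro ⟨p, q⟩
    change frac 1 1 * frac p q = frac p q
    rw [frac_mul_frac (t₁ := p) (t₂ := 1) (by simp), one_mul, mul_one]
  mul_one := by
    rintro ⟨p, q⟩
    change frac p q * frac 1 1 = frac p q
    rw [frac_mul_frac (t₁ := 1) (t₂ := q) (by simp), one_mul, mul_one]
  inv := Quotient.lift (fun a => frac a.2 a.1)
    (fun _ _ ⟨t₁, t₂, h, h'⟩ => frac_eq.2 ⟨t₁, t₂, h', h⟩)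
  inv_mul_cancel := by
    rintro ⟨p, q⟩
    change frac q p * frac p q = frac 1 1
    rw [frac_mul_frac (t₁ := 1) (t₂ := 1) rfl, frac_mul_right, frac_self]

theorem one_def : (1 : GroupCompletion P) = frac 1 1 := rfl

theorem frac_self_eq_one (p : P) : frac p p = 1 := frac_self p

theorem inv_frac (p q : P) : (frac p q)⁻¹ = frac q p := rfl

theorem frac_mul_frac_cancel (p₁ p₂ p₃ : P) : frac p₁ p₂ * frac p₂ p₃ = frac p₁ p₃ := by
  rw [frac_mul_frac (t₁ := 1) (t₂ := 1) rfl, frac_mul_right]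

end RightOreMonoid

/-! ## The colimits -/

namespace ProductSystem

open RightOreMonoid

variable {P : Type w} [Monoid P] [RightOreMonoid P] {A : Type u} [NonUnitalCStarAlgebra A]
  (X : ProductSystem P A)

/-- A cocone, with target the Banach space `Y`, of linear contractions under the diagram of the
spaces `𝕂(E_{p₂}, E_{p₁})` with `p₁ p₂⁻¹ = g` and the maps
`𝕂(E_{p₂}, E_{p₁}) → 𝕂(E_{p₂q}, E_{p₁q})`, `T ↦ μ_{p₁,q} (T ⊗ id) μ_{p₂,q}*`. -/
structure IsBanachCocone (g : GroupCompletion P) {Y : Type*} [NormedAddCommGroup Y]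
    [NormedSpace ℂ Y] (ψ : ∀ {p₁ p₂ : P}, frac p₁ p₂ = g → (X.K p₁ p₂ →L[ℂ] Y)) : Prop where
  norm_le : ∀ {p₁ p₂ : P} (e : frac p₁ p₂ = g) (T : X.K p₁ p₂), ‖ψ e T‖ ≤ ‖T‖
  compat : ∀ {p₁ p₂ : P} (e : frac p₁ p₂ = g) (q : P) (T : X.K p₁ p₂)
    (T' : X.K (p₁ * q) (p₂ * q)), X.IsAmplification q T T' →
      ψ ((frac_mul_right p₁ p₂ q).trans e) T' = ψ e T

/-- The cocone `ι` exhibits `Y` as the colimit of this diagram in the category of Banach spaces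
with linear contractions. -/
structure IsBanachColimit (g : GroupCompletion P) {Y : Type*} [NormedAddCommGroup Y]
    [NormedSpace ℂ Y] (ι : ∀ {p₁ p₂ : P}, frac p₁ p₂ = g → X.K p₁ p₂ →L[ℂ] Y) : Prop where
  isCocone : X.IsBanachCocone g ι
  existsUnique_desc : ∀ (Z : Type (max u w)) [NormedAddCommGroup Z] [NormedSpace ℂ Z]
    [CompleteSpace Z] (ψ : ∀ {p₁ p₂ : P}, frac p₁ p₂ = g → X.K p₁ p₂ →L[ℂ] Z),
    X.IsBanachCocone g ψ →
      ∃! Ψ : Y →L[ℂ] Z, (∀ y, ‖Ψ y‖ ≤ ‖y‖) ∧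
        ∀ {p₁ p₂ : P} (e : frac p₁ p₂ = g) (T : X.K p₁ p₂), Ψ (ι e T) = ψ e T

/-- A cocone of ⋆-homomorphisms, with target the C⋆-algebra `D`, under the diagram of the
C⋆-algebras `𝕂(E_p)` and the ⋆-homomorphisms `φ_{p,q} : 𝕂(E_p) → 𝕂(E_{pq})`,
`T ↦ μ_{p,q} (T ⊗ id) μ_{p,q}*`. -/
def IsCStarCocone {D : Type*} [NonUnitalCStarAlgebra D] (ψ : ∀ p : P, X.K p p →⋆ₙₐ[ℂ] D) : Prop :=
  ∀ (p q : P) (T : X.K p p) (T' : X.K (p * q) (p * q)), X.IsAmplification q T T' →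
    ψ (p * q) T' = ψ p T

/-- The cocone `ϑ` exhibits `C` as the colimit (inductive limit) of the C⋆-algebras `𝕂(E_p)`. -/
structure IsCStarColimit {C : Type*} [NonUnitalCStarAlgebra C]
    (ϑ : ∀ p : P, X.K p p →⋆ₙₐ[ℂ] C) : Prop where
  isCocone : X.IsCStarCocone ϑ
  existsUnique_desc : ∀ (D : Type (max u w)) [NonUnitalCStarAlgebra D]
    (ψ : ∀ p : P, X.K p p →⋆ₙₐ[ℂ] D), X.IsCStarCocone ψ →
      ∃! Ψ : C →⋆ₙₐ[ℂ] D, ∀ (p : P) (T : X.K p p), Ψ (ϑ p T) = ψ p T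

/-- A Fell bundle `O` over the group completion, together with maps
`𝕂(E_{p₂}, E_{p₁}) → O_{p₁ p₂⁻¹}`, is the Fell bundle of the product system: each fibre `O_g` is the
Banach space colimit of the spaces `𝕂(E_{p₂}, E_{p₁})` with `p₁ p₂⁻¹ = g`, and the multiplication and
the involution are induced by the composition and the adjoints of compact operators. -/
structure IsColimitFellBundle (O : FellBundle.{w, max u w} (GroupCompletion P))
    (ι : ∀ {g : GroupCompletion P} {p₁ p₂ : P}, frac p₁ p₂ = g → X.K p₁ p₂ →L[ℂ] O.fiber g) :
    Prop where
  isColimit : ∀ g, X.IsBanachColimit g (fun e => ι (g := g) e)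
  mul_ι : ∀ (p₁ p₂ p₃ : P) (T : X.K p₁ p₂) (S : X.K p₂ p₃),
    O.mul (frac_mul_frac_cancel p₁ p₂ p₃) (ι rfl T) (ι rfl S) = ι rfl (compComp T S)
  adj_ι : ∀ (p₁ p₂ : P) (T : X.K p₁ p₂), O.adj (inv_frac p₁ p₂) (ι rfl T) = ι rfl (compAdj T)

end ProductSystem

end

/-!
Amplification `T ↦ T ⊗ id` is defined on the algebraic tensor product, whose image is dense in
`E_{pq}`. It is contractive there (`norm_tmul_rTensor_le`): for `R = T* T` the Cauchy--Schwarz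
inequality gives `‖(Rⁿ ⊗ id) y‖² ≤ ‖y‖ ‖(R²ⁿ ⊗ id) y‖`, and iterating this removes the constant from
any crude bound of the form `‖(Rⁿ ⊗ id) y‖ ≤ C ‖R‖ⁿ`. With creation operators `L_ξ η = ξ ⊗ η`, which
are adjointable, the amplification of `|ξ a⟩⟨η|` is `L_ξ φ_q(a) L_η*`. This is compact because `φ_q(a)`
is, and operators `|ξ a⟩⟨η|` span a dense subspace of all compact operators (`ampL_mem`).

By the two Ore conditions, the presentations `g = p₁ p₂⁻¹` form a filtered category. So the colimit
`O_g` is the completion of the algebraic direct sum of the spaces `𝕂(E_{p₂}, E_{p₁})` for the seminorm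
that adds up all components in one space far enough along the diagram and takes the infimum of the
norms of all amplifications of the result (`stableNorm`). Maps out of `O_g` come from compatible
families of bounded maps (`exists_extension`), and closed properties of elements of `O_g` need to be
checked only on the image of a single space of compact operators (`Fiber.induction`). Any two elements
of `O_g` and `O_h` that come from compact operators come from composable ones, so composition and
adjoints of compact operators induce the Fell bundle structure. Its axioms, including the C⋆-identity
and positivity, are inherited from compact operators. In the unit fibre, `p₁ p₂⁻¹ = 1` means
`p₁ t = p₂ t` for some `t`, so the C⋆-algebras `𝕂(E_p)` already suffice to generate it.

For the last part, representations of the Fell bundle and Cuntz--Pimsner covariant representations are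
both identified with families of maps on the spaces `𝕂(E_q, E_p)` that are compatible with composition,
adjoints and amplification (`CompactRep`). A covariant representation `S` gives
`|ξ⟩⟨η| ↦ S(ξ) S(η)*`; covariance is equivalent to compatibility with amplification, because
`S(ξ) π(a) S(η)* = S(ξ) θ(φ_q(a)) S(η)*` (`Representation.θ_amp`). Conversely, `S` is recovered by
restriction to `E_p ≅ 𝕂(A, E_p)`. Corresponding representations act on the same C⋆-algebra, so the
universal ones correspond to each other, and so do the C⋆-algebras that they generate.
-/

noncomputable section

/-! ### Hilbert modules and proper correspondences -/

/-- A self-adjoint element `S` of a C⋆-algebra comes with a self-adjoint `N` (its negative part)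
and a square root `d` of `N³`, such that `S` is positive as soon as `d` vanishes. -/
theorem exists_negPart_witness {C : Type*} [NonUnitalCStarAlgebra C] {S : C}
    (hS : IsSelfAdjoint S) :
    ∃ N d : C, star N = N ∧ star d * d = N * N * N ∧ S * N = -(N * N) ∧
      (d = 0 → ∃ R, S = star R * R) := by
  let _ := CStarAlgebra.spectralOrder C
  have _ := CStarAlgebra.spectralOrderedRing C
  have hN : 0 ≤ S⁻ := CFC.negPart_nonneg S
  have hNs : star (S⁻) = S⁻ := hN.isSelfAdjoint
  obtain ⟨r, hr⟩ := CStarAlgebra.nonneg_iff_eq_star_mul_self.1 hN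
  have hdd : star (r * S⁻) * (r * S⁻) = S⁻ * S⁻ * S⁻ := by
    rw [star_mul, hNs, mul_assoc, ← mul_assoc (star r), ← hr, mul_assoc]
  refine ⟨S⁻, r * S⁻, hNs, hdd, ?_, fun hd => ?_⟩
  · conv_lhs => enter [1]; rw [← CFC.posPart_sub_negPart S hS]
    rw [sub_mul, CFC.posPart_mul_negPart, zero_sub]
  · rw [← CStarAlgebra.nonneg_iff_eq_star_mul_self]
    have h3 : S⁻ * S⁻ * S⁻ = 0 := by rw [← hdd, hd, mul_zero]
    have h4 : S⁻ * S⁻ = 0 := by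
      rw [← CStarRing.star_mul_self_eq_zero_iff, star_mul, hNs, ← mul_assoc, h3, zero_mul]
    rw [← CFC.negPart_eq_zero_iff S hS, ← CStarRing.star_mul_self_eq_zero_iff, hNs, h4]

namespace HilbertModule

variable {B : Type*} [NonUnitalCStarAlgebra B]
variable {E : Type*} [NormedAddCommGroup E] [NormedSpace ℂ E] [CompleteSpace E]
variable {F : Type*} [NormedAddCommGroup F] [NormedSpace ℂ F] [CompleteSpace F]
variable {H : Type*} [NormedAddCommGroup H] [NormedSpace ℂ H] [CompleteSpace H]
variable [HilbertModule B E] [HilbertModule B F] [HilbertModule B H]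

theorem ip_zero_right (ξ : E) : ip (B := B) ξ (0 : E) = 0 := by
  have h := ip_smul_right (B := B) 0 ξ (0 : E)
  simpa using h

theorem ip_zero_left (ξ : E) : ip (B := B) (0 : E) ξ = 0 := by
  have h := ip_smul_left (B := B) 0 (0 : E) ξ
  simpa using h

variable (B) in
theorem continuous_ip_right (ξ : E) : Continuous fun η : E => ip (B := B) ξ η :=
  (LinearMap.mkContinuous (σ := RingHom.id ℂ)
    { toFun := fun η : E => ip (B := B) ξ η
      map_add' := ip_add_right ξ
      map_smul' := fun c η => ip_smul_right c ξ η } ‖ξ‖ (norm_ip_le ξ)).continuous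

theorem add_act (ξ η : E) (b : B) : act (ξ + η) b = act ξ b + act η b := by
  apply ext_ip B; intro ζ
  simp only [ip_act_right, ip_add_right, add_mul]

theorem smul_act (c : ℂ) (ξ : E) (b : B) : act (c • ξ) b = c • act ξ b := by
  apply ext_ip B; intro ζ
  simp only [ip_act_right, ip_smul_right, smul_mul_assoc]

theorem IsAdjoint.map_act {T : E →L[ℂ] F} {S : F →L[ℂ] E} (h : IsAdjoint B T S) (ξ : E) (b : B) :
    T (act ξ b) = act (T ξ) b := by
  apply ext_ip B; intro ζ
  rw [← h.symm, ip_act_right, ip_act_right, h.symm]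

variable (B) in
/-- Approximate units of the coefficient algebra act as approximate units on Hilbert modules. -/
theorem mem_closure_act (ξ : E) : ξ ∈ closure (Set.range fun b : B => act ξ b) := by
  let _ := CStarAlgebra.spectralOrder B
  have _ := CStarAlgebra.spectralOrderedRing B
  have hl := CStarAlgebra.increasingApproximateUnit B
  refine mem_closure_of_tendsto (b := CStarAlgebra.approximateUnit B) (f := fun b => act ξ b) ?_
    (Filter.Eventually.of_forall fun b => ⟨b, rfl⟩)
  rw [tendsto_iff_norm_sub_tendsto_zero]
  set a := ip (B := B) ξ ξ with ha
  have h1 : Filter.Tendsto (fun b => a * b) (CStarAlgebra.approximateUnit B) (nhds a) :=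
    hl.tendsto_mul_left a
  have h2 : Filter.Tendsto (fun b => ‖a * b - a‖ * 2) (CStarAlgebra.approximateUnit B)
      (nhds 0) := by
    simpa using (tendsto_iff_norm_sub_tendsto_zero.1 h1).mul_const 2
  have h3 : ∀ᶠ b in CStarAlgebra.approximateUnit B, ‖act ξ b - ξ‖ ≤ √(‖a * b - a‖ * 2) := by
    filter_upwards [hl.eventually_norm] with b hb
    apply Real.le_sqrt_of_sq_le
    have e : ip (B := B) (act ξ b - ξ) (act ξ b - ξ) = star b * (a * b - a) - (a * b - a) := by
      simp only [ip_sub_left, ip_sub_right, ip_act_left, ip_act_right, ← ha, mul_sub,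
        sub_mul, mul_assoc]
      abel
    rw [norm_sq (B := B), e]
    calc _ ≤ ‖star b * (a * b - a)‖ + ‖a * b - a‖ := norm_sub_le _ _
      _ ≤ 1 * ‖a * b - a‖ + ‖a * b - a‖ := by
        gcongr
        refine (norm_mul_le _ _).trans ?_
        rw [norm_star]
        gcongr
      _ = _ := by ring
  refine squeeze_zero' (Filter.Eventually.of_forall fun _ => norm_nonneg _) h3 ?_
  simpa using h2.sqrt

theorem norm_rankOne_le (ξ : F) (η : E) : ‖rankOne B ξ η‖ ≤ ‖ξ‖ * ‖η‖ :=
  LinearMap.mkContinuous_norm_le _ (by positivity) _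

theorem rankOne_add_left (ξ ξ' : F) (η : E) :
    rankOne B (ξ + ξ') η = rankOne B ξ η + rankOne B ξ' η := by
  ext ζ; simp [add_act]

theorem rankOne_smul_left (c : ℂ) (ξ : F) (η : E) :
    rankOne B (c • ξ) η = c • rankOne B ξ η := by
  ext ζ; simp [smul_act]

theorem IsAdjoint.comp_rankOne {T : F →L[ℂ] H} {S : H →L[ℂ] F} (h : IsAdjoint B T S)
    (ξ : F) (η : E) : T.comp (rankOne B ξ η) = rankOne B (T ξ) η := by
  ext ζ; simp [h.map_act]

theorem IsAdjoint.rankOne_comp {T : E →L[ℂ] F} {S : F →L[ℂ] E} (h : IsAdjoint B T S)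
    (ξ : H) (η : F) : (rankOne B ξ η).comp T = rankOne B ξ (S η) := by
  ext ζ; simp [h.symm η ζ]

instance : NormSMulClass ℂ (compactOperators B E F) :=
  ⟨fun c T => norm_smul c (T : E →L[ℂ] F)⟩

instance : IsBoundedSMul ℂ (compactOperators B E F) :=
  IsBoundedSMul.of_norm_smul_le fun c T => norm_smul_le c (T : E →L[ℂ] F)

/-- The rank one operator `|ξ⟩⟨η|` as an element of `𝕂(E, F)`. -/
def ketBra (B : Type*) [NonUnitalCStarAlgebra B] [HilbertModule B E] [HilbertModule B F]
    (ξ : F) (η : E) : compactOperators B E F :=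
  ⟨rankOne B ξ η, rankOne_mem ξ η⟩

@[simp] theorem coe_ketBra (ξ : F) (η : E) : (ketBra B ξ η : E →L[ℂ] F) = rankOne B ξ η := rfl

variable (B) in
/-- The left slot of rank one operators as a continuous linear map. -/
def ketBraL (η : E) : F →L[ℂ] compactOperators B E F :=
  LinearMap.mkContinuous
    { toFun := fun ξ => ketBra B ξ η
      map_add' := fun _ _ => Subtype.ext (rankOne_add_left _ _ _)
      map_smul' := fun _ _ => Subtype.ext (rankOne_smul_left _ _ _) }
    ‖η‖ fun ξ => by
      rw [mul_comm]
      exact norm_rankOne_le ξ η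

/-- A closed subspace of `𝕂(E, F)` containing the operators `|ξ⟩⟨η|` is everything. -/
theorem compact_induction {p : compactOperators B E F → Prop}
    (rank : ∀ ξ η, p (ketBra B ξ η))
    (add : ∀ T S, p T → p S → p (T + S)) (smul : ∀ (c : ℂ) T, p T → p (c • T))
    (closed : IsClosed {T | p T}) (T : compactOperators B E F) : p T := by
  let M : Submodule ℂ (compactOperators B E F) :=
    { carrier := {T | p T}
      add_mem' := fun {a b} ha hb => add a b ha hb
      zero_mem' := by
        have := smul 0 _ (rank 0 0)
        rwa [zero_smul] at this
      smul_mem' := fun c T hT => smul c T hT }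
  have hM : IsClosed (M.map (compactOperators B E F).subtype : Set (E →L[ℂ] F)) := by
    have := (isClosed_compactOperators (B := B) (E := E) (F := F)).isClosedEmbedding_subtypeVal
    exact this.isClosedMap _ closed
  have hle : compactOperators B E F ≤ M.map (compactOperators B E F).subtype := by
    refine Submodule.topologicalClosure_minimal _ (Submodule.span_le.2 ?_) hM
    rintro _ ⟨ξ, η, rfl⟩
    exact ⟨ketBra B ξ η, rank ξ η, rfl⟩
  obtain ⟨S, hS, h⟩ := hle T.2
  obtain rfl : S = T := Subtype.ext h
  exact hS

/-- Rank one operators of the form `|ξ b⟩⟨η|` already span a dense subspace of `𝕂(E, F)`. -/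
theorem compact_induction_act {p : compactOperators B E F → Prop}
    (rank : ∀ (ξ : F) (b : B) (η : E), p (ketBra B (act ξ b) η))
    (add : ∀ T S, p T → p S → p (T + S)) (smul : ∀ (c : ℂ) T, p T → p (c • T))
    (closed : IsClosed {T | p T}) (T : compactOperators B E F) : p T := by
  refine compact_induction (fun ξ η => ?_) add smul closed T
  have h := map_mem_closure (ketBraL B η).continuous (mem_closure_act B ξ)
    (t := {T | p T}) (by rintro _ ⟨b, rfl⟩; exact rank ξ b η)
  rwa [closed.closure_eq] at h

theorem IsAdjoint.comp_compact_mem {T : F →L[ℂ] H} {S : H →L[ℂ] F} (h : IsAdjoint B T S)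
    (R : compactOperators B E F) :
    T.comp (R : E →L[ℂ] F) ∈ compactOperators B E H := by
  induction R using compact_induction with
  | rank ξ η => rw [coe_ketBra, h.comp_rankOne]; exact rankOne_mem _ _
  | add R R' hR hR' =>
    rw [Submodule.coe_add, ContinuousLinearMap.comp_add]; exact add_mem hR hR'
  | smul c R hR =>
    rw [Submodule.coe_smul, ContinuousLinearMap.comp_smul]; exact Submodule.smul_mem _ _ hR
  | closed =>
    exact isClosed_compactOperators.preimage
      ((ContinuousLinearMap.compL ℂ E F H T).continuous.comp continuous_subtype_val)

theorem IsAdjoint.compact_comp_mem {T : E →L[ℂ] F} {S : F →L[ℂ] E} (h : IsAdjoint B T S)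
    (R : compactOperators B F H) :
    (R : F →L[ℂ] H).comp T ∈ compactOperators B E H := by
  induction R using compact_induction with
  | rank ξ η => rw [coe_ketBra, h.rankOne_comp]; exact rankOne_mem _ _
  | add R R' hR hR' =>
    rw [Submodule.coe_add, ContinuousLinearMap.add_comp]; exact add_mem hR hR'
  | smul c R hR =>
    rw [Submodule.coe_smul, ContinuousLinearMap.smul_comp]; exact Submodule.smul_mem _ _ hR
  | closed =>
    exact isClosed_compactOperators.preimage
      (((ContinuousLinearMap.compL ℂ E F H).flip T).continuous.comp continuous_subtype_val)

theorem compAdj_eq {T : compactOperators B E F} {S : compactOperators B F E}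
    (h : IsAdjoint B (T : E →L[ℂ] F) (S : F →L[ℂ] E)) : compAdj T = S :=
  Subtype.ext ((isAdjoint_compAdj T).unique h)

theorem compAdj_ketBra (ξ : F) (η : E) : compAdj (ketBra B ξ η) = ketBra B η ξ :=
  compAdj_eq (isAdjoint_rankOne ξ η)

theorem compAdj_add (T S : compactOperators B E F) :
    compAdj (T + S) = compAdj T + compAdj S :=
  compAdj_eq ((isAdjoint_compAdj T).add (isAdjoint_compAdj S))

theorem compAdj_smul (c : ℂ) (T : compactOperators B E F) :
    compAdj (c • T) = star c • compAdj T :=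
  compAdj_eq ((isAdjoint_compAdj T).smul c)

theorem compAdj_compAdj (T : compactOperators B E F) : compAdj (compAdj T) = T :=
  compAdj_eq (isAdjoint_compAdj T).symm

theorem compAdj_compComp (T : compactOperators B F H) (S : compactOperators B E F) :
    compAdj (compComp T S) = compComp (compAdj S) (compAdj T) :=
  compAdj_eq ((isAdjoint_compAdj T).comp (isAdjoint_compAdj S))

theorem norm_compAdj (T : compactOperators B E F) : ‖compAdj T‖ = ‖T‖ :=
  (isAdjoint_compAdj T).norm_eq

theorem norm_compComp_le (T : compactOperators B F H) (S : compactOperators B E F) :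
    ‖compComp T S‖ ≤ ‖T‖ * ‖S‖ := ContinuousLinearMap.opNorm_comp_le _ _

theorem compComp_add_left (T T' : compactOperators B F H) (S : compactOperators B E F) :
    compComp (T + T') S = compComp T S + compComp T' S :=
  Subtype.ext (ContinuousLinearMap.add_comp _ _ _)

theorem compComp_add_right (T : compactOperators B F H) (S S' : compactOperators B E F) :
    compComp T (S + S') = compComp T S + compComp T S' :=
  Subtype.ext (ContinuousLinearMap.comp_add _ _ _)

theorem compComp_smul_left (c : ℂ) (T : compactOperators B F H) (S : compactOperators B E F) :
    compComp (c • T) S = c • compComp T S :=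
  Subtype.ext (ContinuousLinearMap.smul_comp _ _ _)

theorem compComp_smul_right (c : ℂ) (T : compactOperators B F H) (S : compactOperators B E F) :
    compComp T (c • S) = c • compComp T S :=
  Subtype.ext (ContinuousLinearMap.comp_smul _ _ _)

theorem compComp_ketBra_ketBra (ξ : H) (η ξ' : F) (η' : E) :
    compComp (ketBra B ξ η) (ketBra B ξ' η') = ketBra B (act ξ (ip (B := B) η ξ')) η' :=
  Subtype.ext (by
    change (rankOne B ξ η).comp (rankOne B ξ' η') = _
    exact (isAdjoint_rankOne (B := B) ξ η).comp_rankOne ξ' η')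

/-- The C⋆-identity `‖T* T‖ = ‖T‖²` for compact operators between different Hilbert modules. -/
theorem norm_compComp_compAdj_self (T : compactOperators B E F) :
    ‖compComp (compAdj T) T‖ = ‖T‖ ^ 2 := by
  apply le_antisymm
  · rw [pow_two]
    refine (norm_compComp_le _ _).trans ?_
    rw [norm_compAdj]
  · set R := (compAdj T : F →L[ℂ] E).comp (T : E →L[ℂ] F) with hR
    have h : ‖(T : E →L[ℂ] F)‖ ≤ √‖R‖ := by
      refine ContinuousLinearMap.opNorm_le_bound _ (by positivity) fun ξ => ?_
      refine abs_le_of_sq_le_sq' ?_ (by positivity) |>.2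
      calc ‖(T : E →L[ℂ] F) ξ‖ ^ 2 = ‖ip (B := B) ξ (R ξ)‖ := by
            rw [norm_sq (B := B), isAdjoint_compAdj T]; rfl
        _ ≤ ‖ξ‖ * (‖R‖ * ‖ξ‖) := (norm_ip_le _ _).trans (by gcongr; exact R.le_opNorm ξ)
        _ = (√‖R‖ * ‖ξ‖) ^ 2 := by rw [mul_pow, Real.sq_sqrt (norm_nonneg _)]; ring
    exact (Real.le_sqrt (norm_nonneg _) (norm_nonneg _)).1 h

/-- The operator `T* T` is positive in the C⋆-algebra `𝕂(E)`: otherwise its negative part `N` would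
give `⟨T N ξ, T N ξ⟩ = -⟨ξ, N³ ξ⟩ ≤ 0`. -/
theorem exists_star_mul_self_eq (T : compactOperators B E F) :
    ∃ R : compactOperators B E E, compComp (compAdj T) T = star R * R := by
  have hsa : IsSelfAdjoint (compComp (compAdj T) T : compactOperators B E E) := by
    change compAdj _ = _
    rw [compAdj_compComp, compAdj_compAdj]
  obtain ⟨N, d, hNs, hd, hSN, hpos⟩ := exists_negPart_witness hsa
  refine hpos ?_
  set c := compComp T N with hc
  have hcc : star d * d = -compComp (compAdj c) c := by
    rw [hd, mul_assoc, ← neg_eq_iff_eq_neg, ← mul_neg, ← hSN, hc, compAdj_compComp]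
    change _ = compComp (compComp (star N) (compAdj T)) (compComp T N)
    rw [hNs]
    rfl
  have hip : ∀ ξ : E, ip (B := B) ((d : E →L[ℂ] E) ξ) ((d : E →L[ℂ] E) ξ) =
      -ip (B := B) ((c : E →L[ℂ] F) ξ) ((c : E →L[ℂ] F) ξ) := by
    intro ξ
    rw [isAdjoint_compAdj d, isAdjoint_compAdj c, ← zero_sub, ← ip_zero_right ξ, ← ip_sub_right,
      zero_sub]
    congr 1
    exact DFunLike.congr_fun (congrArg Subtype.val hcc) ξ
  ext ξ
  apply eq_zero_of_ip_self (B := B)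
  obtain ⟨b, hb⟩ := ip_self_nonneg (B := B) ((d : E →L[ℂ] E) ξ)
  obtain ⟨b', hb'⟩ := ip_self_nonneg (B := B) ((c : E →L[ℂ] F) ξ)
  let _ := CStarAlgebra.spectralOrder B
  have _ := CStarAlgebra.spectralOrderedRing B
  apply le_antisymm
  · rw [hip, hb', neg_nonpos]
    exact star_mul_self_nonneg b'
  · rw [hb]
    exact star_mul_self_nonneg b

end HilbertModule

namespace Correspondence

open HilbertModule

variable {A B E : Type*} [NonUnitalCStarAlgebra A] [NonUnitalCStarAlgebra B]
  [NormedAddCommGroup E] [NormedSpace ℂ E] [CompleteSpace E] [Correspondence A B E]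

theorem isAdjoint_left (a : A) :
    IsAdjoint B (left (B := B) a : E →L[ℂ] E) (left (B := B) (star a)) := fun ξ η =>
  left_star a ξ η

/-- The left action on a proper correspondence as a ⋆-homomorphism to the compact operators. -/
def leftHom (h : IsProper A B E) : A →⋆ₙₐ[ℂ] compactOperators B E E where
  toFun a := ⟨left (B := B) a, h a⟩
  map_smul' c a := Subtype.ext (map_smul _ c a)
  map_zero' := Subtype.ext (map_zero _)
  map_add' a b := Subtype.ext (map_add _ a b)
  map_mul' a b := Subtype.ext (ContinuousLinearMap.ext fun ξ => left_mul a b ξ)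
  map_star' a := (compAdj_eq (isAdjoint_left a)).symm

/-- The left action is contractive because it is a ⋆-homomorphism between C⋆-algebras; for this
properness is convenient, as `𝕂(E)` is one. -/
theorem IsProper.norm_left_le (h : IsProper A B E) (a : A) (ξ : E) :
    ‖left (B := B) a ξ‖ ≤ ‖a‖ * ‖ξ‖ := by
  refine (ContinuousLinearMap.le_opNorm _ _).trans ?_
  gcongr
  exact NonUnitalStarAlgHom.norm_apply_le (leftHom h) a

end Correspondence

/-! ### Amplification of compact operators -/

/-- A nonnegative sequence with `aₙ² ≤ a₀ a₂ₙ` that grows at most like `rⁿ` satisfies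
`a₁ ≤ a₀ r`. -/
theorem le_mul_of_sq_le_mul_double {a : ℕ → ℝ} {C r : ℝ} (hr : 0 ≤ r) (ha : ∀ n, 0 ≤ a n)
    (h : ∀ n, a n ^ 2 ≤ a 0 * a (2 * n)) (hC : ∀ n, a n ≤ C * r ^ n) : a 1 ≤ a 0 * r := by
  -- iterate the hypothesis along `n = 1, 2, 4, …`
  have key : ∀ k, a 0 * a 1 ^ 2 ^ k ≤ a 0 ^ 2 ^ k * a (2 ^ k) := by
    intro k
    induction k with
    | zero => simp
    | succ k ih =>
      rcases (ha 0).eq_or_lt with h0 | h0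
      · simp [← h0]
      have h1 : (a 0 * a 1 ^ 2 ^ k) ^ 2 ≤ (a 0 ^ 2 ^ k * a (2 ^ k)) ^ 2 :=
        pow_le_pow_left₀ (mul_nonneg (ha 0) (pow_nonneg (ha 1) _)) ih 2
      have h2 : a 0 * (a 0 * a 1 ^ 2 ^ (k + 1)) ≤
          a 0 * (a 0 ^ 2 ^ (k + 1) * a (2 ^ (k + 1))) :=
        calc a 0 * (a 0 * a 1 ^ 2 ^ (k + 1)) = (a 0 * a 1 ^ 2 ^ k) ^ 2 := by ring
          _ ≤ (a 0 ^ 2 ^ k * a (2 ^ k)) ^ 2 := h1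
          _ = a 0 ^ 2 ^ (k + 1) * a (2 ^ k) ^ 2 := by ring
          _ ≤ a 0 ^ 2 ^ (k + 1) * (a 0 * a (2 * 2 ^ k)) := by
            gcongr
            exact h _
          _ = _ := by rw [← pow_succ']; ring
      exact le_of_mul_le_mul_left h2 h0
  by_contra! hlt
  have ha1 : 0 < a 1 := (mul_nonneg (ha 0) hr).trans_lt hlt
  have h0 : 0 < a 0 := by
    refine (ha 0).lt_of_ne fun h0 => ?_
    have := h 1
    rw [← h0, zero_mul] at this
    nlinarith
  set s := a 0 * r / a 1 with hs
  have hs0 : 0 ≤ s := by positivity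
  have hs1 : s < 1 := (div_lt_one ha1).2 hlt
  have hle : ∀ k, a 0 ≤ C * s ^ 2 ^ k := by
    intro k
    have h1 : a 0 * a 1 ^ 2 ^ k ≤ C * (a 0 * r) ^ 2 ^ k := by
      refine (key k).trans ?_
      calc a 0 ^ 2 ^ k * a (2 ^ k) ≤ a 0 ^ 2 ^ k * (C * r ^ 2 ^ k) := by
            gcongr
            exact hC _
        _ = _ := by ring
    rw [hs, div_pow, ← mul_div_assoc, le_div_iff₀ (by positivity)]
    exact h1
  have hlim : Filter.Tendsto (fun k : ℕ => C * s ^ 2 ^ k) Filter.atTop (nhds (C * 0)) :=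
    ((tendsto_pow_atTop_nhds_zero_of_lt_one hs0 hs1).comp
      (tendsto_pow_atTop_atTop_of_one_lt one_lt_two)).const_mul C
  rw [mul_zero] at hlim
  exact absurd (ge_of_tendsto' hlim hle) (not_le.2 h0)

namespace ProductSystem

open HilbertModule Correspondence TensorProduct

variable {P : Type w} [Monoid P] {A : Type u} [NonUnitalCStarAlgebra A] (X : ProductSystem P A)

/-- The multiplication `E_p ⊗ E_q → E_{pq}` on the algebraic tensor product over `ℂ`. -/
def tmul {p q r : P} (h : p * q = r) : X.E p ⊗[ℂ] X.E q →ₗ[ℂ] X.E r :=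
  TensorProduct.lift (X.mul h)

@[simp] theorem tmul_tmul {p q r : P} (h : p * q = r) (ξ : X.E p) (η : X.E q) :
    X.tmul h (ξ ⊗ₜ η) = X.mul h ξ η := rfl

theorem denseRange_tmul {p q r : P} (h : p * q = r) : DenseRange (X.tmul h) := by
  have hd := (X.isTensorIso h).dense
  rw [← Submodule.dense_iff_topologicalClosure_eq_top] at hd
  refine hd.mono ?_
  change _ ≤ (LinearMap.range (X.tmul h) : Set (X.E r))
  refine Submodule.span_le.2 ?_
  rintro _ ⟨ξ, η, rfl⟩
  exact ⟨ξ ⊗ₜ η, rfl⟩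

variable {X} in
theorem clm_ext {p q r : P} (h : p * q = r) {H : Type*} [NormedAddCommGroup H] [NormedSpace ℂ H]
    {T S : X.E r →L[ℂ] H} (hTS : ∀ ξ η, T (X.mul h ξ η) = S (X.mul h ξ η)) : T = S := by
  have h1 : T.toLinearMap ∘ₗ X.tmul h = S.toLinearMap ∘ₗ X.tmul h :=
    TensorProduct.ext' fun ξ η => hTS ξ η
  exact ContinuousLinearMap.ext fun x =>
    congrFun ((X.denseRange_tmul h).equalizer T.continuous S.continuous
      (funext fun y => LinearMap.congr_fun h1 y)) x

variable {X}

theorem ip_tmul_rTensor {p₁ p₂ q r₁ r₂ : P} (h₁ : p₁ * q = r₁) (h₂ : p₂ * q = r₂)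
    {T : X.E p₂ →L[ℂ] X.E p₁} {S : X.E p₁ →L[ℂ] X.E p₂} (hTS : IsAdjoint A T S)
    (y : X.E p₂ ⊗[ℂ] X.E q) (z : X.E p₁ ⊗[ℂ] X.E q) :
    ip (B := A) (X.tmul h₁ (T.toLinearMap.rTensor _ y)) (X.tmul h₁ z) =
      ip (B := A) (X.tmul h₂ y) (X.tmul h₂ (S.toLinearMap.rTensor _ z)) := by
  induction y using TensorProduct.induction_on with
  | zero => simp only [map_zero, ip_zero_left]
  | add y y' hy hy' => simp only [map_add, ip_add_left, hy, hy']
  | tmul ξ η =>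
    induction z using TensorProduct.induction_on with
    | zero => simp only [map_zero, ip_zero_right]
    | add z z' hz hz' => simp only [map_add, ip_add_right, hz, hz']
    | tmul ξ' η' =>
      simp only [LinearMap.rTensor_tmul, tmul_tmul, (X.isTensorIso _).ip_map]
      simp only [ContinuousLinearMap.coe_coe, hTS ξ ξ']

theorem IsProper.norm_mul_le (hX : X.IsProper) {p q r : P} (h : p * q = r) (ξ : X.E p)
    (η : X.E q) : ‖X.mul h ξ η‖ ≤ ‖ξ‖ * ‖η‖ := by
  refine abs_le_of_sq_le_sq' ?_ (by positivity) |>.2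
  rw [norm_sq (B := A), (X.isTensorIso h).ip_map]
  calc _ ≤ ‖η‖ * (‖ip (B := A) ξ ξ‖ * ‖η‖) :=
        (norm_ip_le _ _).trans (by gcongr; exact (hX q).norm_left_le _ _)
    _ = (‖ξ‖ * ‖η‖) ^ 2 := by rw [← norm_sq (B := A)]; ring

/-- A bound for `T ⊗ id` on a fixed tensor that is linear in `‖T‖`, with a constant depending on the
tensor.  This crude bound supplies the growth condition of `le_mul_of_sq_le_mul_double`. -/
theorem exists_norm_tmul_rTensor_le (hX : X.IsProper) {p q r : P} (h : p * q = r)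
    (y : X.E p ⊗[ℂ] X.E q) :
    ∃ C : ℝ, ∀ T : X.E p →L[ℂ] X.E p, ‖X.tmul h (T.toLinearMap.rTensor _ y)‖ ≤ C * ‖T‖ := by
  induction y using TensorProduct.induction_on with
  | zero => exact ⟨0, fun T => by simp⟩
  | add y y' hy hy' =>
    obtain ⟨C, hC⟩ := hy
    obtain ⟨C', hC'⟩ := hy'
    refine ⟨C + C', fun T => ?_⟩
    rw [map_add, map_add, add_mul]
    exact (norm_add_le _ _).trans (add_le_add (hC T) (hC' T))
  | tmul ξ η =>
    refine ⟨‖ξ‖ * ‖η‖, fun T => ?_⟩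
    simp only [LinearMap.rTensor_tmul, tmul_tmul, ContinuousLinearMap.coe_coe]
    calc _ ≤ ‖T ξ‖ * ‖η‖ := hX.norm_mul_le h _ _
      _ ≤ (‖T‖ * ‖ξ‖) * ‖η‖ := by gcongr; exact T.le_opNorm ξ
      _ = _ := by ring

/-- The operator `T ⊗ id` is bounded by `‖T‖` on the algebraic tensor product.  With `R = T* T`, the
Cauchy--Schwarz inequality gives `‖(Rⁿ ⊗ id) y‖² ≤ ‖y‖ ‖(R²ⁿ ⊗ id) y‖`, and iterating this yields
`‖(R ⊗ id) y‖ ≤ ‖R‖ ‖y‖`. -/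
theorem norm_tmul_rTensor_le (hX : X.IsProper) {p₁ p₂ q r₁ r₂ : P} (h₁ : p₁ * q = r₁)
    (h₂ : p₂ * q = r₂) {T : X.E p₂ →L[ℂ] X.E p₁} {S : X.E p₁ →L[ℂ] X.E p₂}
    (hTS : IsAdjoint A T S) (y : X.E p₂ ⊗[ℂ] X.E q) :
    ‖X.tmul h₁ (T.toLinearMap.rTensor _ y)‖ ≤ ‖T‖ * ‖X.tmul h₂ y‖ := by
  set R : X.E p₂ →L[ℂ] X.E p₂ := S.comp T with hR
  have hRR : ∀ n, IsAdjoint A (R ^ n) (R ^ n) := by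
    intro n
    induction n with
    | zero => exact fun ξ η => rfl
    | succ n ih =>
      have h := ih.comp (hTS.symm.comp hTS)
      change IsAdjoint A (R ^ n * R) (R * R ^ n) at h
      rwa [← pow_succ, ← pow_succ'] at h
  set a : ℕ → ℝ := fun n => ‖X.tmul h₂ ((R ^ n).toLinearMap.rTensor _ y)‖ with ha
  have ha0 : a 0 = ‖X.tmul h₂ y‖ := by
    simp only [ha, pow_zero]
    congr 2
    exact LinearMap.congr_fun (LinearMap.rTensor_id _ _) y
  obtain ⟨C, hC⟩ := exists_norm_tmul_rTensor_le hX h₂ y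
  have h1 : a 1 ≤ a 0 * ‖R‖ := by
    refine le_mul_of_sq_le_mul_double (C := max C 0) (norm_nonneg _) (fun _ => norm_nonneg _) ?_ ?_
    · intro n
      change ‖X.tmul h₂ ((R ^ n).toLinearMap.rTensor _ y)‖ ^ 2 ≤ _
      rw [norm_sq (B := A), ip_tmul_rTensor h₂ h₂ (hRR n), ha0]
      refine (norm_ip_le _ _).trans (le_of_eq ?_)
      congr 3
      rw [← LinearMap.rTensor_comp_apply, two_mul, pow_add]
      rfl
    · intro n
      refine (hC _).trans ?_
      rcases n with - | n
      · refine mul_le_mul (le_max_left _ _) ?_ (norm_nonneg _) (le_max_right _ _)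
        rw [pow_zero, pow_zero]
        exact ContinuousLinearMap.norm_id_le
      · exact mul_le_mul (le_max_left _ _) (norm_pow_le' _ (Nat.succ_pos _)) (norm_nonneg _)
          (le_max_right _ _)
  have hRn : ‖R‖ ≤ ‖T‖ * ‖T‖ := by
    refine (ContinuousLinearMap.opNorm_comp_le _ _).trans ?_
    rw [hTS.norm_eq]
  refine abs_le_of_sq_le_sq' ?_ (by positivity) |>.2
  calc ‖X.tmul h₁ (T.toLinearMap.rTensor _ y)‖ ^ 2
      ≤ ‖X.tmul h₂ y‖ * ‖X.tmul h₂ (S.toLinearMap.rTensor _ (T.toLinearMap.rTensor _ y))‖ := by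
        rw [norm_sq (B := A), ip_tmul_rTensor h₁ h₂ hTS]
        exact norm_ip_le _ _
    _ = a 0 * a 1 := by
        rw [ha0, ← LinearMap.rTensor_comp_apply]
        simp only [ha, pow_one]
        rfl
    _ ≤ a 0 * (a 0 * (‖T‖ * ‖T‖)) := by
        have : 0 ≤ a 0 := norm_nonneg _
        gcongr
        refine h1.trans ?_
        gcongr
    _ = (‖T‖ * ‖X.tmul h₂ y‖) ^ 2 := by rw [ha0]; ring

/-- The creation operator `E_q → E_{pq}`, `η ↦ μ_{p,q}(ξ ⊗ η)`. -/
def creation (hX : X.IsProper) {p q r : P} (h : p * q = r) (ξ : X.E p) : X.E q →L[ℂ] X.E r :=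
  (X.mul h ξ).mkContinuous ‖ξ‖ fun η => hX.norm_mul_le h ξ η

@[simp] theorem creation_apply (hX : X.IsProper) {p q r : P} (h : p * q = r) (ξ : X.E p)
    (η : X.E q) : creation hX h ξ η = X.mul h ξ η := rfl

/-- Creation operators are adjointable; the adjoint maps `μ_{p,q}(ξ' ⊗ η)` to `⟨ξ, ξ'⟩ η`. -/
theorem exists_isAdjoint_creation (hX : X.IsProper) {p q r : P} (h : p * q = r) (ξ : X.E p) :
    ∃ L : X.E r →L[ℂ] X.E q, IsAdjoint A (creation hX h ξ) L ∧
      ∀ ξ' η, L (X.mul h ξ' η) = left (B := A) (ip (B := A) ξ ξ') η := by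
  let f : X.E p ⊗[ℂ] X.E q →ₗ[ℂ] X.E q := TensorProduct.lift
    (LinearMap.mk₂ ℂ (fun ξ' η => left (B := A) (ip (B := A) ξ ξ') η)
      (fun _ _ _ => by rw [ip_add_right, map_add, _root_.add_apply])
      (fun _ _ _ => by rw [ip_smul_right, map_smul, _root_.smul_apply])
      (fun _ _ _ => map_add _ _ _) (fun _ _ _ => map_smul _ _ _))
  have hf : ∀ ξ' η, f (ξ' ⊗ₜ η) = left (B := A) (ip (B := A) ξ ξ') η := fun _ _ => rfl
  have hadj : ∀ η y, ip (B := A) (creation hX h ξ η) (X.tmul h y) = ip (B := A) η (f y) := by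
    intro η y
    induction y using TensorProduct.induction_on with
    | zero => simp only [map_zero, ip_zero_right]
    | add y y' hy hy' => simp only [map_add, ip_add_right, hy, hy']
    | tmul ξ' η' => rw [hf, tmul_tmul, creation_apply, (X.isTensorIso h).ip_map]
  have hb : ∀ y, ‖f y‖ ≤ ‖creation hX h ξ‖ * ‖X.tmul h y‖ := by
    intro y
    rcases (norm_nonneg (f y)).eq_or_lt with h0 | h0
    · rw [← h0]; positivity
    refine le_of_mul_le_mul_left ?_ h0
    calc ‖f y‖ * ‖f y‖ = ‖ip (B := A) (creation hX h ξ (f y)) (X.tmul h y)‖ := by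
          rw [hadj, ← norm_sq]; ring
      _ ≤ (‖creation hX h ξ‖ * ‖f y‖) * ‖X.tmul h y‖ :=
          (norm_ip_le _ _).trans (by gcongr; exact ContinuousLinearMap.le_opNorm _ _)
      _ = _ := by ring
  have hL : ∀ y, f.extendOfNorm (X.tmul h) (X.tmul h y) = f y :=
    LinearMap.extendOfNorm_eq (X.denseRange_tmul h) ⟨_, hb⟩
  refine ⟨f.extendOfNorm (X.tmul h), fun η ζ => ?_, fun ξ' η => hL (ξ' ⊗ₜ η)⟩
  refine congrFun ((X.denseRange_tmul h).equalizer
    (g := fun ζ => ip (B := A) (creation hX h ξ η) ζ)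
    (h := fun ζ => ip (B := A) η (f.extendOfNorm (X.tmul h) ζ)) (continuous_ip_right A _)
    ((continuous_ip_right A _).comp (ContinuousLinearMap.continuous _)) (funext fun y => ?_)) ζ
  simp only [Function.comp_apply, hL, hadj]

/-- The adjoint of a creation operator. -/
def annihilation (hX : X.IsProper) {p q r : P} (h : p * q = r) (ξ : X.E p) : X.E r →L[ℂ] X.E q :=
  (exists_isAdjoint_creation hX h ξ).choose

theorem isAdjoint_creation (hX : X.IsProper) {p q r : P} (h : p * q = r) (ξ : X.E p) :
    IsAdjoint A (creation hX h ξ) (annihilation hX h ξ) :=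
  (exists_isAdjoint_creation hX h ξ).choose_spec.1

@[simp] theorem annihilation_mul (hX : X.IsProper) {p q r : P} (h : p * q = r) (ξ ξ' : X.E p)
    (η : X.E q) :
    annihilation hX h ξ (X.mul h ξ' η) = left (B := A) (ip (B := A) ξ ξ') η :=
  (exists_isAdjoint_creation hX h ξ).choose_spec.2 ξ' η

theorem mul_act_left {p q r : P} (h : p * q = r) (ξ : X.E p) (a : A) (η : X.E q) :
    X.mul h (act ξ a) η = X.mul h ξ (left (B := A) a η) := by
  rw [← X.mul_unit, X.mul_assoc (mul_one p) h (one_mul q) h, X.unit_mul]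

/-- The operator `T ⊗ id`, transported to `E_{p₂q} → E_{p₁q}`. -/
def ampL (hX : X.IsProper) {p₁ p₂ q r₁ r₂ : P} (h₁ : p₁ * q = r₁) (h₂ : p₂ * q = r₂) :
    X.K p₁ p₂ →L[ℂ] X.E r₂ →L[ℂ] X.E r₁ :=
  have hb (T : X.K p₁ p₂) (y) := norm_tmul_rTensor_le hX h₁ h₂ (isAdjoint_compAdj T) y
  have hval (T : X.K p₁ p₂) (ξ : X.E p₂) (η : X.E q) :
      ((X.tmul h₁ ∘ₗ (T : X.E p₂ →L[ℂ] X.E p₁).toLinearMap.rTensor _).extendOfNorm (X.tmul h₂))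
        (X.mul h₂ ξ η) = X.mul h₁ ((T : X.E p₂ →L[ℂ] X.E p₁) ξ) η :=
    LinearMap.extendOfNorm_eq (X.denseRange_tmul h₂) ⟨_, hb T⟩ (ξ ⊗ₜ η)
  LinearMap.mkContinuous
    { toFun := fun T =>
        (X.tmul h₁ ∘ₗ (T : X.E p₂ →L[ℂ] X.E p₁).toLinearMap.rTensor _).extendOfNorm (X.tmul h₂)
      map_add' := fun T S => clm_ext h₂ fun ξ η => by
        rw [hval, _root_.add_apply, hval, hval, Submodule.coe_add, _root_.add_apply,
          map_add, LinearMap.add_apply]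
      map_smul' := fun c T => clm_ext h₂ fun ξ η => by
        rw [hval, _root_.smul_apply, hval, Submodule.coe_smul, _root_.smul_apply,
          map_smul, LinearMap.smul_apply, RingHom.id_apply] }
    1 fun T => by
      rw [one_mul]
      exact LinearMap.opNorm_extendOfNorm_le (X.denseRange_tmul h₂) (norm_nonneg _) (hb T)

theorem ampL_apply (hX : X.IsProper) {p₁ p₂ q r₁ r₂ : P} (h₁ : p₁ * q = r₁) (h₂ : p₂ * q = r₂)
    (T : X.K p₁ p₂) (ξ : X.E p₂) (η : X.E q) :
    ampL hX h₁ h₂ T (X.mul h₂ ξ η) = X.mul h₁ ((T : X.E p₂ →L[ℂ] X.E p₁) ξ) η :=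
  LinearMap.extendOfNorm_eq (X.denseRange_tmul h₂)
    ⟨_, norm_tmul_rTensor_le hX h₁ h₂ (isAdjoint_compAdj T)⟩ (ξ ⊗ₜ η)

/-- On `|ξ a⟩⟨η|`, amplification is `L_ξ φ_q(a) L_η*` for the creation operators `L_ξ`, `L_η`. -/
theorem ampL_ketBra (hX : X.IsProper) {p₁ p₂ q r₁ r₂ : P} (h₁ : p₁ * q = r₁) (h₂ : p₂ * q = r₂)
    (ξ : X.E p₁) (a : A) (η : X.E p₂) :
    ampL hX h₁ h₂ (ketBra A (act ξ a) η) =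
      ((creation hX h₁ ξ).comp (left (B := A) a)).comp (annihilation hX h₂ η) := by
  refine clm_ext h₂ fun ξ' η' => ?_
  simp only [ampL_apply, ContinuousLinearMap.comp_apply, annihilation_mul, creation_apply,
    coe_ketBra, rankOne_apply, act_act, mul_act_left, left_mul]

/-- Amplifications are compact: the operators `L_ξ φ_q(a) L_η*` are, because `φ_q(a)` is compact by
properness. -/
theorem ampL_mem (hX : X.IsProper) {p₁ p₂ q r₁ r₂ : P} (h₁ : p₁ * q = r₁) (h₂ : p₂ * q = r₂)
    (T : X.K p₁ p₂) : ampL hX h₁ h₂ T ∈ compactOperators A (X.E r₂) (X.E r₁) := by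
  induction T using compact_induction_act with
  | rank ξ a η =>
    rw [ampL_ketBra]
    exact (isAdjoint_creation hX h₂ η).symm.compact_comp_mem
      ⟨_, (isAdjoint_creation hX h₁ ξ).comp_compact_mem ⟨_, hX q a⟩⟩
  | add T S hT hS => rw [map_add]; exact add_mem hT hS
  | smul c T hT => rw [map_smul]; exact Submodule.smul_mem _ _ hT
  | closed => exact isClosed_compactOperators.preimage (ampL hX h₁ h₂).continuous

/-- The amplification `𝕂(E_{p₂}, E_{p₁}) → 𝕂(E_{p₂q}, E_{p₁q})`, `T ↦ μ (T ⊗ id) μ*`.  The products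
`p₁ q = r₁` and `p₂ q = r₂` are kept as hypotheses, so that no transport along equalities in `P`
is needed. -/
def amp (hX : X.IsProper) {p₁ p₂ q r₁ r₂ : P} (h₁ : p₁ * q = r₁) (h₂ : p₂ * q = r₂) :
    X.K p₁ p₂ →L[ℂ] X.K r₁ r₂ :=
  (ampL hX h₁ h₂).codRestrict _ (ampL_mem hX h₁ h₂)

section amp

variable (hX : X.IsProper) {p₁ p₂ p₃ q r₁ r₂ r₃ : P} (h₁ : p₁ * q = r₁) (h₂ : p₂ * q = r₂)
  (h₃ : p₃ * q = r₃)

theorem amp_apply (T : X.K p₁ p₂) (ξ : X.E p₂) (η : X.E q) :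
    (amp hX h₁ h₂ T : X.E r₂ →L[ℂ] X.E r₁) (X.mul h₂ ξ η) =
      X.mul h₁ ((T : X.E p₂ →L[ℂ] X.E p₁) ξ) η :=
  ampL_apply hX h₁ h₂ T ξ η

theorem norm_amp_le (T : X.K p₁ p₂) : ‖amp hX h₁ h₂ T‖ ≤ ‖T‖ :=
  LinearMap.opNorm_extendOfNorm_le (X.denseRange_tmul h₂) (norm_nonneg _)
    (norm_tmul_rTensor_le hX h₁ h₂ (isAdjoint_compAdj T))

theorem eq_amp {T : X.K p₁ p₂} {T' : X.K r₁ r₂}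
    (h : ∀ ξ η, (T' : X.E r₂ →L[ℂ] X.E r₁) (X.mul h₂ ξ η) =
      X.mul h₁ ((T : X.E p₂ →L[ℂ] X.E p₁) ξ) η) : T' = amp hX h₁ h₂ T :=
  Subtype.ext (clm_ext h₂ fun ξ η => by rw [h, amp_apply])

theorem isAmplification_iff {T : X.K p₁ p₂} {T' : X.K (p₁ * q) (p₂ * q)} :
    X.IsAmplification q T T' ↔ T' = amp hX rfl rfl T :=
  ⟨fun h => eq_amp hX rfl rfl h, fun h ξ η => by rw [h, amp_apply]⟩

theorem compComp_amp (T : X.K p₁ p₂) (S : X.K p₂ p₃) :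
    compComp (amp hX h₁ h₂ T) (amp hX h₂ h₃ S) = amp hX h₁ h₃ (compComp T S) :=
  eq_amp hX h₁ h₃ fun ξ η => by
    change (amp hX h₁ h₂ T : X.E r₂ →L[ℂ] X.E r₁)
      ((amp hX h₂ h₃ S : X.E r₃ →L[ℂ] X.E r₂) (X.mul h₃ ξ η)) = _
    rw [amp_apply, amp_apply]
    rfl

theorem compAdj_amp (T : X.K p₁ p₂) :
    compAdj (amp hX h₁ h₂ T) = amp hX h₂ h₁ (compAdj T) := by
  refine eq_amp hX h₂ h₁ fun ξ η => ?_
  -- the adjoint of `L_ξ* (T ⊗ id) = L_{T* ξ}*`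
  have h : ((annihilation hX h₁ ξ).comp (amp hX h₁ h₂ T : X.E r₂ →L[ℂ] X.E r₁)) =
      annihilation hX h₂ ((compAdj T : X.E p₁ →L[ℂ] X.E p₂) ξ) :=
    clm_ext h₂ fun ξ' η' => by
      rw [ContinuousLinearMap.comp_apply, amp_apply, annihilation_mul, annihilation_mul,
        (isAdjoint_compAdj T).symm]
  have h' := (isAdjoint_creation hX h₁ ξ).symm.comp (isAdjoint_compAdj (amp hX h₁ h₂ T))
  rw [h] at h'
  exact DFunLike.congr_fun (h'.unique (isAdjoint_creation hX h₂ _).symm) η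

variable {t u s₁ s₂ : P}

theorem amp_amp (h₁' : r₁ * t = s₁) (h₂' : r₂ * t = s₂) (hu : q * t = u) (k₁ : p₁ * u = s₁)
    (k₂ : p₂ * u = s₂) (T : X.K p₁ p₂) :
    amp hX h₁' h₂' (amp hX h₁ h₂ T) = amp hX k₁ k₂ T := by
  refine eq_amp hX k₁ k₂ fun ξ ζ => ?_
  have h : (amp hX h₁' h₂' (amp hX h₁ h₂ T) : X.E s₂ →L[ℂ] X.E s₁).comp (creation hX k₂ ξ) =
      creation hX k₁ ((T : X.E p₂ →L[ℂ] X.E p₁) ξ) := by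
    refine clm_ext hu fun η ω => ?_
    rw [ContinuousLinearMap.comp_apply, creation_apply, creation_apply,
      ← X.mul_assoc h₂ h₂' hu k₂, ← X.mul_assoc h₁ h₁' hu k₁, amp_apply, amp_apply]
  exact DFunLike.congr_fun h ζ

end amp

end ProductSystem

/-! ### The fibres as completed direct limits -/

namespace ProductSystem

open HilbertModule Correspondence RightOreMonoid

variable {P : Type w} [Monoid P] [RightOreMonoid P] {A : Type u} [NonUnitalCStarAlgebra A]
  {X : ProductSystem P A} (hX : X.IsProper)

/-- The norm of `T` in the direct limit: the infimum of the norms of all amplifications of `T`. -/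
def stableNorm {p₁ p₂ : P} (T : X.K p₁ p₂) : ℝ :=
  ⨅ q : P, ‖amp hX (rfl : p₁ * q = _) (rfl : p₂ * q = _) T‖

section stableNorm

variable {p₁ p₂ q q' r₁ r₂ : P}

omit [RightOreMonoid P] in
theorem stableNorm_nonneg (T : X.K p₁ p₂) : 0 ≤ stableNorm hX T :=
  Real.iInf_nonneg fun _ => norm_nonneg _

omit [RightOreMonoid P] in
theorem stableNorm_le_norm_amp (h₁ : p₁ * q = r₁) (h₂ : p₂ * q = r₂) (T : X.K p₁ p₂) :
    stableNorm hX T ≤ ‖amp hX h₁ h₂ T‖ := by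
  subst h₁ h₂
  exact ciInf_le ⟨0, by rintro _ ⟨q, rfl⟩; exact norm_nonneg _⟩ q

omit [RightOreMonoid P] in
theorem stableNorm_le_norm (T : X.K p₁ p₂) : stableNorm hX T ≤ ‖T‖ :=
  (stableNorm_le_norm_amp hX (mul_one _) (mul_one _) T).trans (norm_amp_le ..)

omit [RightOreMonoid P] in
theorem le_stableNorm {T : X.K p₁ p₂} {c : ℝ}
    (h : ∀ q, c ≤ ‖amp hX (rfl : p₁ * q = _) (rfl : p₂ * q = _) T‖) : c ≤ stableNorm hX T :=
  have : Nonempty P := ⟨1⟩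
  le_ciInf h

theorem stableNorm_amp (h₁ : p₁ * q = r₁) (h₂ : p₂ * q = r₂) (T : X.K p₁ p₂) :
    stableNorm hX (amp hX h₁ h₂ T) = stableNorm hX T := by
  subst h₁ h₂
  refine le_antisymm (le_stableNorm hX fun t => ?_) (le_stableNorm hX fun t => ?_)
  · obtain ⟨s, s', e⟩ := exists_common_mul q t
    have e₁ : p₁ * q * s = p₁ * t * s' := by rw [_root_.mul_assoc, e, _root_.mul_assoc]
    have e₂ : p₂ * q * s = p₂ * t * s' := by rw [_root_.mul_assoc, e, _root_.mul_assoc]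
    refine (stableNorm_le_norm_amp hX e₁ e₂ _).trans ?_
    rw [amp_amp hX rfl rfl e₁ e₂ e (_root_.mul_assoc _ _ _).symm (_root_.mul_assoc _ _ _).symm,
      ← amp_amp hX rfl rfl rfl rfl rfl (_root_.mul_assoc _ _ _).symm (_root_.mul_assoc _ _ _).symm]
    exact norm_amp_le ..
  · rw [amp_amp hX rfl rfl rfl rfl rfl (_root_.mul_assoc _ _ _).symm (_root_.mul_assoc _ _ _).symm]
    exact stableNorm_le_norm_amp ..

theorem stableNorm_add_le (T S : X.K p₁ p₂) :
    stableNorm hX (T + S) ≤ stableNorm hX T + stableNorm hX S := by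
  have : Nonempty P := ⟨1⟩
  refine le_ciInf_add_ciInf fun q t => ?_
  obtain ⟨s, s', e⟩ := exists_common_mul q t
  refine (stableNorm_le_norm_amp hX (q := q * s) rfl rfl _).trans ?_
  rw [map_add]
  refine (norm_add_le _ _).trans (add_le_add ?_ ?_)
  · rw [← amp_amp hX rfl rfl (_root_.mul_assoc _ _ _) (_root_.mul_assoc _ _ _) rfl]
    exact norm_amp_le ..
  · have e₁ : p₁ * t * s' = p₁ * (q * s) := by rw [_root_.mul_assoc, e]
    have e₂ : p₂ * t * s' = p₂ * (q * s) := by rw [_root_.mul_assoc, e]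
    rw [← amp_amp hX rfl rfl e₁ e₂ e.symm]
    exact norm_amp_le ..

omit [RightOreMonoid P] in
theorem stableNorm_smul (c : ℂ) (T : X.K p₁ p₂) :
    stableNorm hX (c • T) = ‖c‖ * stableNorm hX T := by
  simp only [stableNorm, map_smul, norm_smul, Real.mul_iInf_of_nonneg (norm_nonneg c)]

omit [RightOreMonoid P] in
theorem stableNorm_compAdj_le (T : X.K p₁ p₂) : stableNorm hX (compAdj T) ≤ stableNorm hX T :=
  le_stableNorm hX fun q => by
    rw [← norm_compAdj, compAdj_amp]
    exact stableNorm_le_norm_amp ..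

omit [RightOreMonoid P] in
theorem stableNorm_compAdj (T : X.K p₁ p₂) : stableNorm hX (compAdj T) = stableNorm hX T :=
  le_antisymm (stableNorm_compAdj_le hX T) (by
    conv_lhs => rw [← compAdj_compAdj T]
    exact stableNorm_compAdj_le hX _)

omit [RightOreMonoid P] in
theorem stableNorm_compAdj_self (T : X.K p₁ p₂) :
    stableNorm hX (compComp (compAdj T) T) = stableNorm hX T ^ 2 := by
  have h (q : P) : ‖amp hX (rfl : p₂ * q = _) (rfl : p₂ * q = _) (compComp (compAdj T) T)‖ =
      ‖amp hX (rfl : p₁ * q = _) (rfl : p₂ * q = _) T‖ ^ 2 := by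
    rw [← compComp_amp hX rfl rfl rfl, ← compAdj_amp, norm_compComp_compAdj_self]
  apply le_antisymm
  · refine (Real.sqrt_le_left (stableNorm_nonneg hX T)).1 ?_
    refine le_stableNorm hX fun q => ?_
    refine (Real.sqrt_le_left (norm_nonneg _)).2 ?_
    exact (stableNorm_le_norm_amp hX rfl rfl _).trans_eq (h q)
  · refine le_stableNorm hX fun q => ?_
    rw [h]
    exact pow_le_pow_left₀ (stableNorm_nonneg hX T) (stableNorm_le_norm_amp ..) 2

variable (p₁ p₂) in
/-- `stableNorm` as a seminorm. -/
def stableSeminorm : Seminorm ℂ (X.K p₁ p₂) :=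
  Seminorm.of (stableNorm hX) (stableNorm_add_le hX) (stableNorm_smul hX)

theorem stableSeminorm_apply (T : X.K p₁ p₂) : stableSeminorm hX p₁ p₂ T = stableNorm hX T := rfl

/-- Two amplifications of the same operator to the same space agree in the direct limit: by the
second Ore condition they become equal after a further amplification. -/
theorem stableSeminorm_amp_sub_amp (h₁ : p₁ * q = r₁) (h₂ : p₂ * q = r₂) (h₁' : p₁ * q' = r₁)
    (h₂' : p₂ * q' = r₂) (T : X.K p₁ p₂) :
    stableSeminorm hX r₁ r₂ (amp hX h₁ h₂ T - amp hX h₁' h₂' T) = 0 := by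
  obtain ⟨z, hz⟩ := exists_mul_eq p₁ q q' (h₁.trans h₁'.symm)
  refine le_antisymm ?_ (stableNorm_nonneg hX _)
  refine (stableNorm_le_norm_amp hX (q := z) rfl rfl _).trans ?_
  rw [map_sub, amp_amp hX h₁ h₂ rfl rfl hz (by rw [← hz, ← _root_.mul_assoc, h₁])
    (by rw [← hz, ← _root_.mul_assoc, h₂]),
    amp_amp hX h₁' h₂' rfl rfl rfl (by rw [← _root_.mul_assoc, h₁'])
      (by rw [← _root_.mul_assoc, h₂']),
    sub_self]
  exact norm_zero.le

end stableNorm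

/-- The objects of the diagram with colimit `O_g`: presentations `g = p q⁻¹`. -/
structure FracIndex (g : GroupCompletion P) where
  /-- the numerator `p` -/
  num : P
  /-- the denominator `q` -/
  den : P
  frac_eq : frac num den = g

namespace FracIndex

variable {g : GroupCompletion P}

instance : Preorder (FracIndex g) where
  le i j := ∃ q, i.num * q = j.num ∧ i.den * q = j.den
  le_refl _ := ⟨1, mul_one _, mul_one _⟩
  le_trans _ _ _ := fun ⟨q, h₁, h₂⟩ ⟨t, k₁, k₂⟩ =>
    ⟨q * t, by rw [← _root_.mul_assoc, h₁, k₁], by rw [← _root_.mul_assoc, h₂, k₂]⟩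

instance : Nonempty (FracIndex g) := by
  obtain ⟨⟨p, q⟩, h⟩ := Quotient.exists_rep g
  exact ⟨⟨p, q, h⟩⟩

instance : IsDirectedOrder (FracIndex g) where
  directed i j := by
    obtain ⟨t, s, h₁, h₂⟩ := RightOreMonoid.frac_eq.1 (i.frac_eq.trans j.frac_eq.symm)
    exact ⟨⟨i.num * t, i.den * t, (frac_mul_right _ _ _).trans i.frac_eq⟩, ⟨t, rfl, rfl⟩,
      ⟨s, h₁.symm, h₂.symm⟩⟩

end FracIndex

variable {g : GroupCompletion P}

open Classical in
/-- The map between the spaces at two indices `i ≤ j` given by some arrow `i → j`, and `0` if there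
is no arrow.  Its choice does not matter, as any two arrows `i → j` induce maps that agree up to
elements of `stableNorm` zero. -/
def transition (i j : FracIndex g) : X.K i.num i.den →ₗ[ℂ] X.K j.num j.den :=
  if h : i ≤ j then (amp hX h.choose_spec.1 h.choose_spec.2).toLinearMap else 0

theorem stableSeminorm_transition_sub {i j : FracIndex g} {q : P} (h₁ : i.num * q = j.num)
    (h₂ : i.den * q = j.den) (T : X.K i.num i.den) :
    stableSeminorm hX _ _ (transition hX i j T - amp hX h₁ h₂ T) = 0 := by
  have h : i ≤ j := ⟨q, h₁, h₂⟩
  rw [transition, dif_pos h]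
  exact stableSeminorm_amp_sub_amp ..

/-- The algebraic direct sum of the spaces `𝕂(E_q, E_p)` with `p q⁻¹ = g`.  The relations of the
diagram are not divided out; they are built into the null space of its seminorm. -/
def PreFiber (_ : X.IsProper) (g : GroupCompletion P) : Type (max u w) :=
  Π₀ i : FracIndex g, X.K i.num i.den

instance : AddCommGroup (PreFiber hX g) :=
  inferInstanceAs (AddCommGroup (Π₀ i : FracIndex g, X.K i.num i.den))

instance : Module ℂ (PreFiber hX g) :=
  inferInstanceAs (Module ℂ (Π₀ i : FracIndex g, X.K i.num i.den))

instance : DFunLike (PreFiber hX g) (FracIndex g) (fun i => X.K i.num i.den) :=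
  inferInstanceAs (DFunLike (Π₀ i : FracIndex g, X.K i.num i.den) _ _)

namespace PreFiber

open Classical in
/-- The inclusion of a summand. -/
def single (i : FracIndex g) : X.K i.num i.den →ₗ[ℂ] PreFiber hX g :=
  DFinsupp.lsingle (R := ℂ) (M := fun i : FracIndex g => X.K i.num i.den) i

open Classical in
/-- The sum of all components of an element, taken in the space at the index `j`. -/
def collect (j : FracIndex g) : PreFiber hX g →ₗ[ℂ] X.K j.num j.den :=
  DFinsupp.lsum (M := fun i : FracIndex g => X.K i.num i.den) ℂ fun i => transition hX i j

variable {hX}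

open Classical in
/-- The finite support of an element. -/
def supp (f : PreFiber hX g) : Finset (FracIndex g) :=
  DFinsupp.support (f : Π₀ i : FracIndex g, X.K i.num i.den)

theorem mem_supp {f : PreFiber hX g} {i : FracIndex g} : i ∈ supp f ↔ f i ≠ 0 := by
  classical
  exact DFinsupp.mem_support_iff

theorem collect_eq_sum (j : FracIndex g) (f : PreFiber hX g) :
    collect hX j f = ∑ i ∈ supp f, transition hX i j (f i) := by
  classical
  exact DFinsupp.sumAddHom_apply _ _

@[elab_as_elim]
theorem induction {p : PreFiber hX g → Prop} (f : PreFiber hX g) (zero : p 0)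
    (single : ∀ i T, p (single hX i T)) (add : ∀ f f', p f → p f' → p (f + f')) : p f := by
  classical
  exact DFinsupp.induction (p := p) f zero fun i b f _ _ hf =>
    add (PreFiber.single hX i b) f (single i b) hf

/-- The index `j` dominates the support of `f`. -/
def Bounds (j : FracIndex g) (f : PreFiber hX g) : Prop :=
  ∀ i, f i ≠ 0 → i ≤ j

theorem exists_bounds (f : PreFiber hX g) : ∃ j, Bounds j f := by
  obtain ⟨j, hj⟩ := Finset.exists_le (supp f)
  exact ⟨j, fun i hi => hj i (mem_supp.2 hi)⟩

theorem Bounds.mono {j k : FracIndex g} {f : PreFiber hX g} (h : Bounds j f) (hjk : j ≤ k) :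
    Bounds k f := fun i hi => (h i hi).trans hjk

theorem Bounds.add {j : FracIndex g} {f f' : PreFiber hX g} (h : Bounds j f) (h' : Bounds j f') :
    Bounds j (f + f') := by
  intro i hi
  by_cases h0 : f i = 0
  · refine h' i fun h1 => hi ?_
    exact (congrArg₂ (· + ·) h0 h1).trans (add_zero 0)
  · exact h i h0

theorem Bounds.smul {j : FracIndex g} {f : PreFiber hX g} (h : Bounds j f) (c : ℂ) :
    Bounds j (c • f) := by
  intro i hi
  refine h i fun h0 => hi ?_
  exact (congrArg (fun T : X.K i.num i.den => c • T) h0).trans (smul_zero c)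

variable (hX) in
theorem bounds_single (i : FracIndex g) (T : X.K i.num i.den) : Bounds i (single hX i T) := by
  classical
  intro k hk
  by_cases h : k = i
  · exact h.le
  · exact absurd (DFinsupp.single_eq_of_ne
      (β := fun i : FracIndex g => X.K i.num i.den) (b := T) h) hk

variable (hX) in
theorem collect_single (i j : FracIndex g) (T : X.K i.num i.den) :
    collect hX j (single hX i T) = transition hX i j T := by
  classical
  exact DFinsupp.lsum_single (M := fun i : FracIndex g => X.K i.num i.den) ℂ
    (fun i => transition hX i j) i T

/-- Collecting components further up agrees, up to elements of `stableNorm` zero, with amplifying the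
collected components.  So the seminorm on the direct sum can be computed at any bounding index. -/
theorem stableSeminorm_collect_sub {j k : FracIndex g} {q : P} (h₁ : j.num * q = k.num)
    (h₂ : j.den * q = k.den) {f : PreFiber hX g} (hf : Bounds j f) :
    stableSeminorm hX _ _ (collect hX k f - amp hX h₁ h₂ (collect hX j f)) = 0 := by
  rw [collect_eq_sum, collect_eq_sum, map_sum, ← Finset.sum_sub_distrib]
  refine le_antisymm ((Finset.le_sum_of_subadditive (stableSeminorm hX k.num k.den)
    (map_zero _).le (map_add_le_add _) _ _).trans (Finset.sum_nonpos fun i hi => ?_))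
    (apply_nonneg _ _)
  obtain ⟨t, k₁, k₂⟩ := hf i (mem_supp.1 hi)
  have l₁ : i.num * (t * q) = k.num := by rw [← _root_.mul_assoc, k₁, h₁]
  have l₂ : i.den * (t * q) = k.den := by rw [← _root_.mul_assoc, k₂, h₂]
  have e : transition hX i k (f i) - amp hX h₁ h₂ (transition hX i j (f i)) =
      (transition hX i k (f i) - amp hX l₁ l₂ (f i)) -
        amp hX h₁ h₂ (transition hX i j (f i) - amp hX k₁ k₂ (f i)) := by
    rw [map_sub, amp_amp hX k₁ k₂ h₁ h₂ rfl l₁ l₂, sub_sub_sub_cancel_right]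
  rw [e]
  refine (map_sub_le_add _ _ _).trans ?_
  rw [stableSeminorm_transition_sub hX l₁ l₂, stableSeminorm_apply, stableNorm_amp,
    ← stableSeminorm_apply, stableSeminorm_transition_sub hX k₁ k₂, add_zero]

theorem stableNorm_collect_eq {j k : FracIndex g} (hjk : j ≤ k) {f : PreFiber hX g}
    (hf : Bounds j f) : stableNorm hX (collect hX k f) = stableNorm hX (collect hX j f) := by
  obtain ⟨q, h₁, h₂⟩ := hjk
  have h := abs_sub_map_le_sub (stableSeminorm hX _ _) (collect hX k f)
    (amp hX h₁ h₂ (collect hX j f))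
  rw [stableSeminorm_collect_sub h₁ h₂ hf] at h
  rw [← stableNorm_amp hX h₁ h₂]
  exact sub_eq_zero.1 (abs_nonpos_iff.1 h)

/-- The seminorm of the direct limit: collect all components in one space `𝕂(E_q, E_p)` and take the
norm of the result in the direct limit. -/
instance : Norm (PreFiber hX g) where
  norm f := stableNorm hX (collect hX (exists_bounds f).choose f)

theorem norm_eq {j : FracIndex g} {f : PreFiber hX g} (hf : Bounds j f) :
    ‖f‖ = stableNorm hX (collect hX j f) := by
  obtain ⟨k, hk, hk'⟩ := exists_ge_ge (exists_bounds f).choose j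
  rw [← stableNorm_collect_eq hk' hf]
  exact (stableNorm_collect_eq hk (exists_bounds f).choose_spec).symm

theorem core : SeminormedSpace.Core ℂ (PreFiber hX g) where
  norm_nonneg f := stableNorm_nonneg hX _
  norm_smul c f := by
    obtain ⟨j, hj⟩ := exists_bounds f
    rw [norm_eq hj, norm_eq (hj.smul c), map_smul, stableNorm_smul]
  norm_triangle f f' := by
    obtain ⟨j, hj⟩ := exists_bounds f
    obtain ⟨k, hk⟩ := exists_bounds f'
    obtain ⟨l, hl, hl'⟩ := exists_ge_ge j k
    rw [norm_eq (hj.mono hl), norm_eq (hk.mono hl'), norm_eq ((hj.mono hl).add (hk.mono hl')),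
      map_add]
    exact stableNorm_add_le hX _ _

instance : SeminormedAddCommGroup (PreFiber hX g) := .ofCore core

instance : NormedSpace ℂ (PreFiber hX g) where
  norm_smul_le c f := (core.norm_smul c f).le

theorem norm_single (i : FracIndex g) (T : X.K i.num i.den) :
    ‖single hX i T‖ = stableNorm hX T := by
  rw [norm_eq (bounds_single hX i T), collect_single]
  have h := abs_sub_map_le_sub (stableSeminorm hX _ _) (transition hX i i T)
    (amp hX (mul_one _) (mul_one _) T)
  rw [stableSeminorm_transition_sub] at h
  rw [← stableNorm_amp hX (mul_one _) (mul_one _) T]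
  exact sub_eq_zero.1 (abs_nonpos_iff.1 h)

theorem norm_single_amp_sub_single {i j : FracIndex g} {q : P} (h₁ : i.num * q = j.num)
    (h₂ : i.den * q = j.den) (T : X.K i.num i.den) :
    ‖single hX j (amp hX h₁ h₂ T) - single hX i T‖ = 0 := by
  have hb : Bounds j (single hX j (amp hX h₁ h₂ T) + (-1 : ℂ) • single hX i T) :=
    (bounds_single hX j _).add (((bounds_single hX i T).mono ⟨q, h₁, h₂⟩).smul _)
  rw [neg_one_smul, ← sub_eq_add_neg] at hb
  rw [norm_eq hb, map_sub, collect_single, collect_single]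
  have l₁ : i.num * (q * 1) = j.num := by rw [mul_one, h₁]
  have l₂ : i.den * (q * 1) = j.den := by rw [mul_one, h₂]
  have e : transition hX j j (amp hX h₁ h₂ T) - transition hX i j T =
      (transition hX j j (amp hX h₁ h₂ T) - amp hX (mul_one _) (mul_one _) (amp hX h₁ h₂ T)) -
        (transition hX i j T - amp hX l₁ l₂ T) := by
    rw [amp_amp hX h₁ h₂ (mul_one _) (mul_one _) rfl l₁ l₂, sub_sub_sub_cancel_right]
  rw [e]
  refine le_antisymm ((map_sub_le_add (stableSeminorm hX _ _) _ _).trans ?_)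
    (stableNorm_nonneg hX _)
  rw [stableSeminorm_transition_sub, stableSeminorm_transition_sub, add_zero]

theorem norm_sub_single_collect {j : FracIndex g} {f : PreFiber hX g} (hf : Bounds j f) :
    ‖f - single hX j (collect hX j f)‖ = 0 := by
  have hb : Bounds j (f + (-1 : ℂ) • single hX j (collect hX j f)) :=
    hf.add ((bounds_single hX j _).smul _)
  rw [neg_one_smul, ← sub_eq_add_neg] at hb
  rw [norm_eq hb, map_sub, collect_single]
  have e : collect hX j f - transition hX j j (collect hX j f) =
      (collect hX j f - amp hX (mul_one _) (mul_one _) (collect hX j f)) -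
        (transition hX j j (collect hX j f) -
          amp hX (mul_one _) (mul_one _) (collect hX j f)) := by
    rw [sub_sub_sub_cancel_right]
  rw [e]
  refine le_antisymm ((map_sub_le_add (stableSeminorm hX _ _) _ _).trans ?_)
    (stableNorm_nonneg hX _)
  rw [stableSeminorm_transition_sub, stableSeminorm_collect_sub _ _ hf, add_zero]

end PreFiber

/-- The fibre `O_g`: the colimit of the spaces `𝕂(E_q, E_p)` with `p q⁻¹ = g` in the category of
Banach spaces and linear contractions. -/
def Fiber (hX : X.IsProper) (g : GroupCompletion P) : Type (max u w) :=
  UniformSpace.Completion (PreFiber hX g)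

instance : NormedAddCommGroup (Fiber hX g) :=
  inferInstanceAs (NormedAddCommGroup (UniformSpace.Completion (PreFiber hX g)))

instance : NormedSpace ℂ (Fiber hX g) :=
  inferInstanceAs (NormedSpace ℂ (UniformSpace.Completion (PreFiber hX g)))

instance : CompleteSpace (Fiber hX g) :=
  inferInstanceAs (CompleteSpace (UniformSpace.Completion (PreFiber hX g)))

/-- The canonical map from the algebraic direct sum to the fibre. -/
def PreFiber.toCompletion (hX : X.IsProper) (g : GroupCompletion P) :
    PreFiber hX g →ₗᵢ[ℂ] Fiber hX g :=
  UniformSpace.Completion.toComplₗᵢ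

theorem PreFiber.denseRange_toCompletion : DenseRange (PreFiber.toCompletion hX g) :=
  UniformSpace.Completion.denseRange_coe

theorem PreFiber.norm_toCompletion_single (i : FracIndex g) (T : X.K i.num i.den) :
    ‖PreFiber.toCompletion hX g (PreFiber.single hX i T)‖ = stableNorm hX T := by
  rw [LinearIsometry.norm_map, PreFiber.norm_single]

/-- The canonical map `𝕂(E_{p₂}, E_{p₁}) → O_g` for `p₁ p₂⁻¹ = g`. -/
def toFiber {p₁ p₂ : P} (e : frac p₁ p₂ = g) : X.K p₁ p₂ →L[ℂ] Fiber hX g :=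
  LinearMap.mkContinuous
    ((PreFiber.toCompletion hX g).toLinearMap ∘ₗ PreFiber.single hX (FracIndex.mk p₁ p₂ e)) 1
    fun T => (PreFiber.norm_toCompletion_single hX (FracIndex.mk p₁ p₂ e) T).trans_le
      ((stableNorm_le_norm hX T).trans_eq (one_mul _).symm)

variable {hX}
variable {p₁ p₂ q r₁ r₂ : P}

theorem norm_toFiber (e : frac p₁ p₂ = g) (T : X.K p₁ p₂) :
    ‖toFiber hX e T‖ = stableNorm hX T :=
  PreFiber.norm_toCompletion_single hX (FracIndex.mk p₁ p₂ e) T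

theorem norm_toFiber_le (e : frac p₁ p₂ = g) (T : X.K p₁ p₂) : ‖toFiber hX e T‖ ≤ ‖T‖ :=
  (norm_toFiber e T).trans_le (stableNorm_le_norm hX T)

theorem toFiber_amp (e : frac p₁ p₂ = g) (e' : frac r₁ r₂ = g) (h₁ : p₁ * q = r₁)
    (h₂ : p₂ * q = r₂) (T : X.K p₁ p₂) :
    toFiber hX e' (amp hX h₁ h₂ T) = toFiber hX e T := by
  rw [← sub_eq_zero, ← norm_eq_zero]
  change ‖PreFiber.toCompletion hX g _ - PreFiber.toCompletion hX g _‖ = 0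
  rw [← map_sub, LinearIsometry.norm_map]
  exact PreFiber.norm_single_amp_sub_single (i := ⟨p₁, p₂, e⟩) (j := ⟨r₁, r₂, e'⟩) h₁ h₂ T

theorem PreFiber.toCompletion_eq {j : FracIndex g} {f : PreFiber hX g} (hf : PreFiber.Bounds j f) :
    PreFiber.toCompletion hX g f = toFiber hX j.frac_eq (PreFiber.collect hX j f) := by
  rw [← sub_eq_zero, ← norm_eq_zero]
  change ‖PreFiber.toCompletion hX g _ - PreFiber.toCompletion hX g _‖ = 0
  rw [← map_sub, LinearIsometry.norm_map]
  exact PreFiber.norm_sub_single_collect hf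

/-- A closed property of elements of the fibre only needs to be checked on the images of compact
operators. -/
theorem Fiber.induction {p : Fiber hX g → Prop} (closed : IsClosed {y | p y})
    (base : ∀ {p₁ p₂ : P} (e : frac p₁ p₂ = g) (T : X.K p₁ p₂), p (toFiber hX e T))
    (y : Fiber hX g) : p y := by
  refine (PreFiber.denseRange_toCompletion hX).induction_on y closed fun f => ?_
  obtain ⟨j, hj⟩ := PreFiber.exists_bounds f
  rw [PreFiber.toCompletion_eq hj]
  exact base _ _

/-- The universal property of the fibre, for semilinear maps with a common bound. -/
theorem exists_extension {σ : ℂ →+* ℂ} {Z : Type*} [NormedAddCommGroup Z] [NormedSpace ℂ Z]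
    [CompleteSpace Z] (ψ : ∀ {p₁ p₂ : P}, frac p₁ p₂ = g → X.K p₁ p₂ →ₛₗ[σ] Z) {C : ℝ} (hC : 0 ≤ C)
    (hψ : ∀ {p₁ p₂ : P} (e : frac p₁ p₂ = g) (T : X.K p₁ p₂), ‖ψ e T‖ ≤ C * ‖T‖)
    (hamp : ∀ {p₁ p₂ q r₁ r₂ : P} (e : frac p₁ p₂ = g) (e' : frac r₁ r₂ = g) (h₁ : p₁ * q = r₁)
      (h₂ : p₂ * q = r₂) (T : X.K p₁ p₂), ψ e' (amp hX h₁ h₂ T) = ψ e T) :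
    ∃ Ψ : Fiber hX g →SL[σ] Z, (∀ y, ‖Ψ y‖ ≤ C * ‖y‖) ∧
      ∀ {p₁ p₂ : P} (e : frac p₁ p₂ = g) (T : X.K p₁ p₂), Ψ (toFiber hX e T) = ψ e T := by
  classical
  let F₀ : PreFiber hX g →+ Z := DFinsupp.sumAddHom fun i : FracIndex g =>
    (ψ i.frac_eq).toAddMonoidHom
  have hF₀ (i : FracIndex g) (T : X.K i.num i.den) :
      F₀ (PreFiber.single hX i T) = ψ i.frac_eq T :=
    DFinsupp.sumAddHom_single _ _ _
  let F : PreFiber hX g →ₛₗ[σ] Z :=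
    { F₀ with
      map_smul' := fun c f => by
        change F₀ (c • f) = σ c • F₀ f
        induction f using PreFiber.induction with
        | zero => rw [smul_zero, map_zero, smul_zero]
        | single i T => rw [← map_smul, hF₀, hF₀, LinearMap.map_smulₛₗ]
        | add f f' hf hf' => rw [smul_add, map_add, map_add, hf, hf', smul_add] }
  have hF (i : FracIndex g) (T : X.K i.num i.den) : F (PreFiber.single hX i T) = ψ i.frac_eq T :=
    hF₀ i T
  have hstable {p₁ p₂ : P} (e : frac p₁ p₂ = g) (T : X.K p₁ p₂) :
      ‖ψ e T‖ ≤ C * stableNorm hX T := by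
    rw [stableNorm, Real.mul_iInf_of_nonneg hC]
    have : Nonempty P := ⟨1⟩
    refine le_ciInf fun q => ?_
    rw [← hamp e ((frac_mul_right p₁ p₂ q).trans e) rfl rfl]
    exact hψ _ _
  have htrans {i j : FracIndex g} (hij : i ≤ j) (T : X.K i.num i.den) :
      ψ j.frac_eq (transition hX i j T) = ψ i.frac_eq T := by
    rw [transition, dif_pos hij]
    exact hamp _ _ _ _ T
  have hcollect {j : FracIndex g} {f : PreFiber hX g} (hf : PreFiber.Bounds j f) :
      F f = ψ j.frac_eq (PreFiber.collect hX j f) := by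
    rw [PreFiber.collect_eq_sum, map_sum]
    refine (DFinsupp.sumAddHom_apply _ _).trans (Finset.sum_congr rfl fun i hi => ?_)
    exact (htrans (hf i (PreFiber.mem_supp.1 hi)) _).symm
  have hb (f : PreFiber hX g) : ‖F f‖ ≤ C * ‖PreFiber.toCompletion hX g f‖ := by
    obtain ⟨j, hj⟩ := PreFiber.exists_bounds f
    rw [hcollect hj, PreFiber.toCompletion_eq hj, norm_toFiber]
    exact hstable _ _
  have hd := PreFiber.denseRange_toCompletion hX (g := g)
  refine ⟨F.extendOfNorm (PreFiber.toCompletion hX g).toLinearMap,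
    LinearMap.norm_extendOfNorm_apply_le hd C hb, fun {p₁ p₂} e T => ?_⟩
  exact (LinearMap.extendOfNorm_eq hd ⟨C, hb⟩ (PreFiber.single hX ⟨p₁, p₂, e⟩ T)).trans (hF _ _)

end ProductSystem

/-! ### The Fell bundle structure -/

namespace ProductSystem

open HilbertModule Correspondence RightOreMonoid

variable {P : Type w} [Monoid P] [RightOreMonoid P] {A : Type u} [NonUnitalCStarAlgebra A]
  {X : ProductSystem P A} {hX : X.IsProper}

section

variable {g h k l : GroupCompletion P}

theorem Fiber.ext_toFiber {σ : ℂ →+* ℂ} {Z : Type*} [NormedAddCommGroup Z] [NormedSpace ℂ Z]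
    {Φ Ψ : Fiber hX g →SL[σ] Z}
    (H : ∀ {p₁ p₂ : P} (e : frac p₁ p₂ = g) (T : X.K p₁ p₂),
      Φ (toFiber hX e T) = Ψ (toFiber hX e T)) : Φ = Ψ :=
  ContinuousLinearMap.ext fun y =>
    Fiber.induction (p := fun y => Φ y = Ψ y) (isClosed_eq Φ.continuous Ψ.continuous) H y

/-- Two elements of fibres that come from compact operators come from composable ones. -/
theorem exists_composable {p₁ p₂ q₁ q₂ : P} (e : frac p₁ p₂ = g) (e' : frac q₁ q₂ = h)
    (T : X.K p₁ p₂) (S : X.K q₁ q₂) :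
    ∃ (t s m : P) (_ : p₂ * t = m) (_ : q₁ * s = m) (e₁ : frac (p₁ * t) m = g)
      (e₂ : frac m (q₂ * s) = h) (T' : X.K (p₁ * t) m) (S' : X.K m (q₂ * s)),
      toFiber hX e T = toFiber hX e₁ T' ∧ toFiber hX e' S = toFiber hX e₂ S' := by
  obtain ⟨t, s, hts⟩ := exists_common_mul p₂ q₁
  exact ⟨t, s, p₂ * t, rfl, hts.symm, (frac_mul_right _ _ _).trans e,
    by rw [hts]; exact (frac_mul_right _ _ _).trans e', amp hX rfl rfl T, amp hX hts.symm rfl S,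
    (toFiber_amp ..).symm, (toFiber_amp ..).symm⟩

theorem Fiber.induction₂ {p : Fiber hX g → Fiber hX h → Prop}
    (closed : IsClosed {y : Fiber hX g × Fiber hX h | p y.1 y.2})
    (base : ∀ {p₁ p₂ p₃ : P} (e₁ : frac p₁ p₂ = g) (e₂ : frac p₂ p₃ = h) (T : X.K p₁ p₂)
      (S : X.K p₂ p₃), p (toFiber hX e₁ T) (toFiber hX e₂ S))
    (a : Fiber hX g) (b : Fiber hX h) : p a b := by
  induction a using Fiber.induction with
  | closed => exact closed.preimage (f := fun a => (a, b)) (by fun_prop)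
  | base e T =>
    induction b using Fiber.induction with
    | closed => exact closed.preimage (f := fun b => (toFiber hX e T, b)) (by fun_prop)
    | base e' S =>
      obtain ⟨t, s, m, -, -, e₁, e₂, T', S', h, h'⟩ := exists_composable (hX := hX) e e' T S
      rw [h, h']
      exact base e₁ e₂ T' S'

theorem Fiber.induction₃ {p : Fiber hX g → Fiber hX h → Fiber hX k → Prop}
    (closed : IsClosed {y : Fiber hX g × Fiber hX h × Fiber hX k | p y.1 y.2.1 y.2.2})
    (base : ∀ {p₁ p₂ p₃ p₄ : P} (e₁ : frac p₁ p₂ = g) (e₂ : frac p₂ p₃ = h) (e₃ : frac p₃ p₄ = k)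
      (T : X.K p₁ p₂) (S : X.K p₂ p₃) (R : X.K p₃ p₄),
      p (toFiber hX e₁ T) (toFiber hX e₂ S) (toFiber hX e₃ R))
    (a : Fiber hX g) (b : Fiber hX h) (c : Fiber hX k) : p a b c := by
  induction b, c using Fiber.induction₂ with
  | closed => exact closed.preimage (f := fun y => (a, y)) (by fun_prop)
  | base e₂ e₃ S R =>
    induction a using Fiber.induction with
    | closed =>
      exact closed.preimage (f := fun a => (a, toFiber hX e₂ S, toFiber hX e₃ R)) (by fun_prop)
    | base e T =>
      obtain ⟨t, s, m, ht, hs, e₁, e₂', T', S', h, h'⟩ := exists_composable (hX := hX) e e₂ T S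
      rw [h, h', ← toFiber_amp e₃ ((frac_mul_right _ _ s).trans e₃) rfl rfl]
      exact base e₁ e₂' _ T' S' _

theorem frac_mul_frac_eq (ek : g * h = k) {p₁ p₂ q₁ q₂ t s m r₁ r₃ : P} (e : frac p₁ p₂ = g)
    (e' : frac q₁ q₂ = h) (h₁ : p₁ * t = r₁) (h₂ : p₂ * t = m) (h₃ : q₁ * s = m)
    (h₄ : q₂ * s = r₃) : frac r₁ r₃ = k := by
  rw [← ek, ← e, ← e', frac_mul_frac (h₂.trans h₃.symm), h₁, h₄]

/-- The product of two amplifications to composable operators does not depend on the chosen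
amplifications, as an element of the direct limit. -/
theorem toFiber_compComp_amp_eq {p₁ p₂ q₁ q₂ t s m r₁ r₃ t' s' m' r₁' r₃' : P}
    (ek : frac r₁ r₃ = k) (ek' : frac r₁' r₃' = k)
    (h₁ : p₁ * t = r₁) (h₂ : p₂ * t = m) (h₃ : q₁ * s = m) (h₄ : q₂ * s = r₃)
    (h₁' : p₁ * t' = r₁') (h₂' : p₂ * t' = m') (h₃' : q₁ * s' = m') (h₄' : q₂ * s' = r₃')
    (T : X.K p₁ p₂) (S : X.K q₁ q₂) :
    toFiber hX ek (compComp (amp hX h₁ h₂ T) (amp hX h₃ h₄ S)) =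
      toFiber hX ek' (compComp (amp hX h₁' h₂' T) (amp hX h₃' h₄' S)) := by
  -- the first Ore condition makes the middle objects equal, and the second one, used for `p₂` and
  -- for `q₁`, makes the amplifications of both factors equal
  obtain ⟨a, a', ha⟩ := exists_common_mul m m'
  obtain ⟨z, hz⟩ := exists_mul_eq p₂ (t * a) (t' * a') (by
    rw [← _root_.mul_assoc, ← _root_.mul_assoc, h₂, h₂', ha])
  obtain ⟨y, hy⟩ := exists_mul_eq q₁ (s * a * z) (s' * a' * z) (by
    simp only [← _root_.mul_assoc]
    rw [h₃, h₃', ha])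
  have ht : t' * (a' * z * y) = t * (a * z * y) := by
    simp only [← _root_.mul_assoc] at hz ⊢
    rw [hz]
  have hs : s' * (a' * z * y) = s * (a * z * y) := by
    simp only [← _root_.mul_assoc] at hy ⊢
    rw [hy]
  set b := a * z * y
  set b' := a' * z * y
  have k₁ : r₁' * b' = r₁ * b := by rw [← h₁', ← h₁, _root_.mul_assoc, ht, _root_.mul_assoc]
  have k₂ : m' * b' = m * b := by rw [← h₂', ← h₂, _root_.mul_assoc, ht, _root_.mul_assoc]
  have k₃ : r₃' * b' = r₃ * b := by rw [← h₄', ← h₄, _root_.mul_assoc, hs, _root_.mul_assoc]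
  have e₀ : frac (r₁ * b) (r₃ * b) = k := (frac_mul_right _ _ _).trans ek
  have l₁ : p₁ * (t * b) = r₁ * b := by rw [← _root_.mul_assoc, h₁]
  have l₂ : p₂ * (t * b) = m * b := by rw [← _root_.mul_assoc, h₂]
  have l₃ : q₁ * (s * b) = m * b := by rw [← _root_.mul_assoc, h₃]
  have l₄ : q₂ * (s * b) = r₃ * b := by rw [← _root_.mul_assoc, h₄]
  rw [← toFiber_amp ek e₀ (q := b) rfl rfl, ← toFiber_amp ek' e₀ k₁ k₃,
    ← compComp_amp hX rfl rfl rfl, ← compComp_amp hX k₁ k₂ k₃,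
    amp_amp hX h₁ h₂ rfl rfl rfl l₁ l₂, amp_amp hX h₃ h₄ rfl rfl rfl l₃ l₄,
    amp_amp hX h₁' h₂' k₁ k₂ ht l₁ l₂, amp_amp hX h₃' h₄' k₂ k₃ hs l₃ l₄]

/-- Multiplication from the left by a compact operator, on the space `𝕂(E_{q₂}, E_{q₁})`. -/
def preMul (hX : X.IsProper) (ek : g * h = k) {p₁ p₂ q₁ q₂ : P} (e : frac p₁ p₂ = g)
    (e' : frac q₁ q₂ = h) (T : X.K p₁ p₂) : X.K q₁ q₂ →ₗ[ℂ] Fiber hX k :=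
  have hts := (exists_common_mul p₂ q₁).choose_spec.choose_spec
  { toFun := fun S => toFiber hX (frac_mul_frac_eq ek e e' rfl rfl hts.symm rfl)
      (compComp (amp hX rfl rfl T) (amp hX hts.symm rfl S))
    map_add' := fun S S' => by rw [map_add, compComp_add_right, map_add]
    map_smul' := fun c S => by rw [map_smul, compComp_smul_right, map_smul, RingHom.id_apply] }

theorem preMul_eq (ek : g * h = k) {p₁ p₂ q₁ q₂ t s m r₁ r₃ : P} (e : frac p₁ p₂ = g)
    (e' : frac q₁ q₂ = h) (h₁ : p₁ * t = r₁) (h₂ : p₂ * t = m) (h₃ : q₁ * s = m)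
    (h₄ : q₂ * s = r₃) (T : X.K p₁ p₂) (S : X.K q₁ q₂) :
    preMul hX ek e e' T S = toFiber hX (frac_mul_frac_eq ek e e' h₁ h₂ h₃ h₄)
      (compComp (amp hX h₁ h₂ T) (amp hX h₃ h₄ S)) :=
  toFiber_compComp_amp_eq _ _ _ _ _ _ h₁ h₂ h₃ h₄ T S

theorem norm_preMul_le (ek : g * h = k) {p₁ p₂ q₁ q₂ : P} (e : frac p₁ p₂ = g)
    (e' : frac q₁ q₂ = h) (T : X.K p₁ p₂) (S : X.K q₁ q₂) :
    ‖preMul hX ek e e' T S‖ ≤ ‖T‖ * ‖S‖ := by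
  refine (norm_toFiber_le _ _).trans ((norm_compComp_le _ _).trans ?_)
  gcongr <;> exact norm_amp_le ..

theorem exists_leftMul (hX : X.IsProper) (ek : g * h = k) {p₁ p₂ : P} (e : frac p₁ p₂ = g)
    (T : X.K p₁ p₂) :
    ∃ Ψ : Fiber hX h →L[ℂ] Fiber hX k, (∀ y, ‖Ψ y‖ ≤ ‖T‖ * ‖y‖) ∧
      ∀ {q₁ q₂ : P} (e' : frac q₁ q₂ = h) (S : X.K q₁ q₂),
        Ψ (toFiber hX e' S) = preMul hX ek e e' T S := by
  refine exists_extension (fun e' => preMul hX ek e e' T) (norm_nonneg T)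
    (fun e' S => norm_preMul_le ek e e' T S) fun {q₁ q₂ q r₁ r₂} e' e'' h₁ h₂ S => ?_
  obtain ⟨t, s, hts⟩ := exists_common_mul p₂ r₁
  have l₁ : q₁ * (q * s) = p₂ * t := by rw [← _root_.mul_assoc, h₁, hts]
  have l₂ : q₂ * (q * s) = r₂ * s := by rw [← _root_.mul_assoc, h₂]
  rw [preMul_eq ek e e'' rfl rfl hts.symm rfl, preMul_eq ek e e' rfl rfl l₁ l₂,
    amp_amp hX h₁ h₂ hts.symm rfl rfl l₁ l₂]

/-- Multiplication from the left by a compact operator, on the fibre. -/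
def leftMul (hX : X.IsProper) (ek : g * h = k) {p₁ p₂ : P} (e : frac p₁ p₂ = g)
    (T : X.K p₁ p₂) : Fiber hX h →L[ℂ] Fiber hX k :=
  (exists_leftMul hX ek e T).choose

theorem leftMul_toFiber (ek : g * h = k) {p₁ p₂ q₁ q₂ : P} (e : frac p₁ p₂ = g)
    (e' : frac q₁ q₂ = h) (T : X.K p₁ p₂) (S : X.K q₁ q₂) :
    leftMul hX ek e T (toFiber hX e' S) = preMul hX ek e e' T S :=
  (exists_leftMul hX ek e T).choose_spec.2 e' S

/-- `leftMul` as a linear map in the operator. -/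
def leftMulₗ (hX : X.IsProper) (ek : g * h = k) {p₁ p₂ : P} (e : frac p₁ p₂ = g) :
    X.K p₁ p₂ →ₗ[ℂ] Fiber hX h →L[ℂ] Fiber hX k where
  toFun T := leftMul hX ek e T
  map_add' T T' := Fiber.ext_toFiber fun {q₁ q₂} e' S => by
    obtain ⟨t, s, hts⟩ := exists_common_mul p₂ q₁
    rw [_root_.add_apply]
    simp only [leftMul_toFiber, preMul_eq ek e e' rfl rfl hts.symm rfl, map_add, compComp_add_left]
  map_smul' c T := Fiber.ext_toFiber fun {q₁ q₂} e' S => by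
    obtain ⟨t, s, hts⟩ := exists_common_mul p₂ q₁
    rw [_root_.smul_apply, RingHom.id_apply]
    simp only [leftMul_toFiber, preMul_eq ek e e' rfl rfl hts.symm rfl, map_smul,
      compComp_smul_left]

theorem exists_fiberMul (hX : X.IsProper) (ek : g * h = k) :
    ∃ Ψ : Fiber hX g →L[ℂ] Fiber hX h →L[ℂ] Fiber hX k, (∀ y, ‖Ψ y‖ ≤ 1 * ‖y‖) ∧
      ∀ {p₁ p₂ : P} (e : frac p₁ p₂ = g) (T : X.K p₁ p₂),
        Ψ (toFiber hX e T) = leftMulₗ hX ek e T := by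
  refine exists_extension (fun e => leftMulₗ hX ek e) zero_le_one (fun e T => ?_)
    fun {p₁ p₂ q r₁ r₂} e e'' h₁ h₂ T => ?_
  · rw [one_mul]
    exact ContinuousLinearMap.opNorm_le_bound _ (norm_nonneg _)
      (exists_leftMul hX ek e T).choose_spec.1
  · refine Fiber.ext_toFiber fun {q₁ q₂} e' S => ?_
    obtain ⟨t, s, hts⟩ := exists_common_mul r₂ q₁
    have l₁ : p₁ * (q * t) = r₁ * t := by rw [← _root_.mul_assoc, h₁]
    have l₂ : p₂ * (q * t) = r₂ * t := by rw [← _root_.mul_assoc, h₂]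
    change leftMul hX ek e'' _ _ = leftMul hX ek e _ _
    rw [leftMul_toFiber, leftMul_toFiber, preMul_eq ek e'' e' rfl rfl hts.symm rfl,
      preMul_eq ek e e' l₁ l₂ hts.symm rfl, amp_amp hX h₁ h₂ rfl rfl rfl l₁ l₂]

/-- The multiplication `O_g × O_h → O_{gh}`, induced by the composition of compact operators. -/
def fiberMul (hX : X.IsProper) (ek : g * h = k) : Fiber hX g →L[ℂ] Fiber hX h →L[ℂ] Fiber hX k :=
  (exists_fiberMul hX ek).choose

theorem fiberMul_toFiber (ek : g * h = k) {p₁ p₂ p₃ : P} (e₁ : frac p₁ p₂ = g)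
    (e₂ : frac p₂ p₃ = h) (e₃ : frac p₁ p₃ = k) (T : X.K p₁ p₂) (S : X.K p₂ p₃) :
    fiberMul hX ek (toFiber hX e₁ T) (toFiber hX e₂ S) = toFiber hX e₃ (compComp T S) := by
  have h1 : fiberMul hX ek (toFiber hX e₁ T) = leftMul hX ek e₁ T :=
    (exists_fiberMul hX ek).choose_spec.2 e₁ T
  rw [h1, leftMul_toFiber,
    preMul_eq ek e₁ e₂ (mul_one _) (mul_one _) (mul_one _) (mul_one _), compComp_amp, toFiber_amp]

theorem norm_fiberMul_le (ek : g * h = k) (a : Fiber hX g) (b : Fiber hX h) :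
    ‖fiberMul hX ek a b‖ ≤ ‖a‖ * ‖b‖ := by
  refine (ContinuousLinearMap.le_opNorm _ _).trans ?_
  gcongr
  exact ((exists_fiberMul hX ek).choose_spec.1 a).trans_eq (one_mul _)

theorem exists_fiberAdj (hX : X.IsProper) (ek : g⁻¹ = k) :
    ∃ Ψ : Fiber hX g →L⋆[ℂ] Fiber hX k, (∀ y, ‖Ψ y‖ ≤ 1 * ‖y‖) ∧
      ∀ {p₁ p₂ : P} (e : frac p₁ p₂ = g) (T : X.K p₁ p₂),
        Ψ (toFiber hX e T) = toFiber hX (by rw [← ek, ← e, inv_frac]) (compAdj T) := by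
  have he {p₁ p₂ : P} (e : frac p₁ p₂ = g) : frac p₂ p₁ = k := by rw [← ek, ← e, inv_frac]
  refine exists_extension (σ := starRingEnd ℂ)
    (fun {p₁ p₂} e =>
      { toFun := fun T => toFiber hX (he e) (compAdj T)
        map_add' := fun T T' => by rw [compAdj_add, map_add]
        map_smul' := fun c T => by rw [compAdj_smul, map_smul]; rfl }) zero_le_one
    (fun {p₁ p₂} e T => ?_) fun {p₁ p₂ q r₁ r₂} e e'' h₁ h₂ T => ?_
  · rw [one_mul]
    exact (norm_toFiber_le _ _).trans_eq (norm_compAdj T)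
  · change toFiber hX _ _ = toFiber hX _ _
    rw [compAdj_amp, toFiber_amp]

/-- The involution `O_g → O_{g⁻¹}`, induced by the adjoints of compact operators. -/
def fiberAdj (hX : X.IsProper) (ek : g⁻¹ = k) : Fiber hX g →L⋆[ℂ] Fiber hX k :=
  (exists_fiberAdj hX ek).choose

theorem fiberAdj_toFiber (ek : g⁻¹ = k) {p₁ p₂ : P} (e : frac p₁ p₂ = g) (e' : frac p₂ p₁ = k)
    (T : X.K p₁ p₂) : fiberAdj hX ek (toFiber hX e T) = toFiber hX e' (compAdj T) :=
  (exists_fiberAdj hX ek).choose_spec.2 e T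

theorem fiberMul_assoc {gh hk ghk : GroupCompletion P} (e₁ : g * h = gh) (e₂ : gh * k = ghk)
    (e₃ : h * k = hk) (e₄ : g * hk = ghk) (a : Fiber hX g) (b : Fiber hX h) (c : Fiber hX k) :
    fiberMul hX e₂ (fiberMul hX e₁ a b) c = fiberMul hX e₄ a (fiberMul hX e₃ b c) := by
  induction a, b, c using Fiber.induction₃ with
  | closed => exact isClosed_eq (by fun_prop) (by fun_prop)
  | base f₁ f₂ f₃ T S R =>
    have f₁₂ := frac_mul_frac_eq e₁ f₁ f₂ (mul_one _) (mul_one _) (mul_one _) (mul_one _)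
    have f₂₃ := frac_mul_frac_eq e₃ f₂ f₃ (mul_one _) (mul_one _) (mul_one _) (mul_one _)
    have f₁₂₃ := frac_mul_frac_eq e₂ f₁₂ f₃ (mul_one _) (mul_one _) (mul_one _) (mul_one _)
    rw [fiberMul_toFiber e₁ f₁ f₂ f₁₂, fiberMul_toFiber e₂ f₁₂ f₃ f₁₂₃,
      fiberMul_toFiber e₃ f₂ f₃ f₂₃, fiberMul_toFiber e₄ f₁ f₂₃ f₁₂₃]
    rfl

theorem frac_swap_eq (ek : g⁻¹ = k) {p₁ p₂ : P} (e : frac p₁ p₂ = g) : frac p₂ p₁ = k := by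
  rw [← ek, ← e, inv_frac]

theorem fiberAdj_fiberAdj (e : g⁻¹ = k) (e' : k⁻¹ = g) (a : Fiber hX g) :
    fiberAdj hX e' (fiberAdj hX e a) = a := by
  induction a using Fiber.induction with
  | closed => exact isClosed_eq (by fun_prop) (by fun_prop)
  | base f T =>
    rw [fiberAdj_toFiber e f (frac_swap_eq e f), fiberAdj_toFiber e' _ f, compAdj_compAdj]

theorem fiberAdj_fiberMul {g' h' k' : GroupCompletion P} (e₁ : g * h = k) (e₂ : k⁻¹ = k')
    (e₃ : h⁻¹ = h') (e₄ : g⁻¹ = g') (e₅ : h' * g' = k') (a : Fiber hX g) (b : Fiber hX h) :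
    fiberAdj hX e₂ (fiberMul hX e₁ a b) = fiberMul hX e₅ (fiberAdj hX e₃ b) (fiberAdj hX e₄ a) := by
  induction a, b using Fiber.induction₂ with
  | closed => exact isClosed_eq (by fun_prop) (by fun_prop)
  | base f₁ f₂ T S =>
    have f₁₂ := frac_mul_frac_eq e₁ f₁ f₂ (mul_one _) (mul_one _) (mul_one _) (mul_one _)
    rw [fiberMul_toFiber e₁ f₁ f₂ f₁₂, fiberAdj_toFiber e₂ f₁₂ (frac_swap_eq e₂ f₁₂),
      fiberAdj_toFiber e₃ f₂ (frac_swap_eq e₃ f₂), fiberAdj_toFiber e₄ f₁ (frac_swap_eq e₄ f₁),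
      fiberMul_toFiber e₅ _ _ (frac_swap_eq e₂ f₁₂), compAdj_compComp]

theorem norm_fiberAdj (e : g⁻¹ = k) (a : Fiber hX g) : ‖fiberAdj hX e a‖ = ‖a‖ := by
  induction a using Fiber.induction with
  | closed => exact isClosed_eq (by fun_prop) (by fun_prop)
  | base f T =>
    rw [fiberAdj_toFiber e f (frac_swap_eq e f), norm_toFiber, norm_toFiber, stableNorm_compAdj]

theorem norm_fiberMul_fiberAdj_self (e : g⁻¹ = k) (e' : k * g = 1) (a : Fiber hX g) :
    ‖fiberMul hX e' (fiberAdj hX e a) a‖ = ‖a‖ ^ 2 := by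
  induction a using Fiber.induction with
  | closed => exact isClosed_eq (by fun_prop) (by fun_prop)
  | base f T =>
    rw [fiberAdj_toFiber e f (frac_swap_eq e f),
      fiberMul_toFiber e' _ f (frac_self_eq_one _), norm_toFiber, norm_toFiber,
      stableNorm_compAdj_self]

end

/-- The unit fibre as a C⋆-algebra.  This is needed to prove positivity of `a* a` in the unit fibre,
which is one of the axioms of a Fell bundle. -/
@[reducible] def fiberOneCStarAlgebra (hX : X.IsProper) :
    NonUnitalCStarAlgebra (Fiber hX (1 : GroupCompletion P)) where
  __ := (inferInstance : NormedAddCommGroup (Fiber hX (1 : GroupCompletion P)))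
  __ := (inferInstance : NormedSpace ℂ (Fiber hX (1 : GroupCompletion P)))
  __ := (inferInstance : CompleteSpace (Fiber hX (1 : GroupCompletion P)))
  mul a b := fiberMul hX (one_mul 1) a b
  star a := fiberAdj hX inv_one a
  left_distrib a b c := map_add _ b c
  right_distrib a b c := ContinuousLinearMap.map_add₂ _ a b c
  zero_mul a := ContinuousLinearMap.map_zero₂ _ a
  mul_zero _ := map_zero _
  mul_assoc a b c := fiberMul_assoc _ _ _ _ a b c
  norm_mul_le a b := norm_fiberMul_le _ a b
  star_involutive a := fiberAdj_fiberAdj _ _ a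
  star_mul a b := fiberAdj_fiberMul _ _ _ _ _ a b
  star_add a b := map_add _ a b
  star_smul c a := ContinuousLinearMap.map_smulₛₗ _ c a
  smul_assoc c a b := ContinuousLinearMap.map_smul₂ _ c a b
  smul_comm c a b := (map_smul _ c b).symm
  norm_mul_self_le a := by
    have := norm_fiberMul_fiberAdj_self inv_one (one_mul 1) a
    rw [pow_two] at this
    exact this.ge

theorem _root_.CStarAlgebra.isClosed_setOf_star_mul_self (C : Type*) [NonUnitalCStarAlgebra C] :
    IsClosed {c : C | ∃ b, c = star b * b} := by
  let _ := CStarAlgebra.spectralOrder C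
  have _ := CStarAlgebra.spectralOrderedRing C
  simp only [← CStarAlgebra.nonneg_iff_eq_star_mul_self]
  exact CStarAlgebra.isClosed_nonneg

/-- Elements of the form `a* a` in the unit fibre are positive: this holds for compact operators, and
the positive cone is closed. -/
theorem exists_fiberMul_fiberAdj_self_eq {g k : GroupCompletion P} (e : g⁻¹ = k) (e' : k * g = 1)
    (a : Fiber hX g) : ∃ b : Fiber hX (1 : GroupCompletion P),
      fiberMul hX e' (fiberAdj hX e a) a =
        fiberMul hX (one_mul 1) (fiberAdj hX inv_one b) b := by
  induction a using Fiber.induction with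
  | closed =>
    have := @CStarAlgebra.isClosed_setOf_star_mul_self _ (fiberOneCStarAlgebra hX)
    exact this.preimage (f := fun a => fiberMul hX e' (fiberAdj hX e a) a) (by fun_prop)
  | base f T =>
    obtain ⟨R, hR⟩ := exists_star_mul_self_eq T
    refine ⟨toFiber hX (frac_self_eq_one _) R, ?_⟩
    rw [fiberAdj_toFiber e f (frac_swap_eq e f),
      fiberMul_toFiber e' _ f (frac_self_eq_one _), hR,
      fiberAdj_toFiber inv_one _ (frac_self_eq_one _),
      fiberMul_toFiber (one_mul 1) _ _ (frac_self_eq_one _)]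
    rfl

/-- The Fell bundle of a proper product system over a right Ore monoid. -/
def fellBundle (hX : X.IsProper) : FellBundle.{w, max u w} (GroupCompletion P) where
  fiber := Fiber hX
  mul e := LinearMap.mk₂ ℂ (fun a b => fiberMul hX e a b)
    (fun a a' b => ContinuousLinearMap.map_add₂ _ a a' b)
    (fun c a b => ContinuousLinearMap.map_smul₂ _ c a b)
    (fun _ b b' => map_add _ b b') (fun c _ b => map_smul _ c b)
  adj e := (fiberAdj hX e).toLinearMap
  mul_assoc := fiberMul_assoc
  adj_adj := fiberAdj_fiberAdj
  adj_mul := fiberAdj_fiberMul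
  norm_mul_le := norm_fiberMul_le
  norm_adj := norm_fiberAdj
  norm_adj_mul_self := norm_fiberMul_fiberAdj_self
  adj_mul_self_nonneg := exists_fiberMul_fiberAdj_self_eq

end ProductSystem

/-! ### The colimit properties -/

namespace ProductSystem

open HilbertModule Correspondence RightOreMonoid

variable {P : Type w} [Monoid P] [RightOreMonoid P] {A : Type u} [NonUnitalCStarAlgebra A]
  {X : ProductSystem P A} (hX : X.IsProper)

theorem isBanachColimit_toFiber (g : GroupCompletion P) :
    X.IsBanachColimit g (fun e => toFiber hX (g := g) e) where
  isCocone :=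
    { norm_le := norm_toFiber_le
      compat := fun e q T T' hT => by
        rw [(isAmplification_iff hX).1 hT, toFiber_amp] }
  existsUnique_desc Z _ _ _ ψ hψ := by
    obtain ⟨Ψ, hΨ, h⟩ := exists_extension (hX := hX) (fun e => (ψ e).toLinearMap) zero_le_one
      (fun e T => (hψ.norm_le e T).trans_eq (one_mul _).symm)
      fun {p₁ p₂ q r₁ r₂} e e' h₁ h₂ T => by
        subst h₁ h₂
        exact hψ.compat e q T _ ((isAmplification_iff hX).2 rfl)
    refine ⟨Ψ, ⟨fun y => (hΨ y).trans_eq (one_mul _), h⟩, fun Φ hΦ => ?_⟩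
    exact Fiber.ext_toFiber fun e T => (hΦ.2 e T).trans (h e T).symm

theorem isColimitFellBundle_fellBundle :
    X.IsColimitFellBundle (fellBundle hX) (fun {g _ _} e => toFiber hX (g := g) e) where
  isColimit := isBanachColimit_toFiber hX
  mul_ι _ _ _ T S := fiberMul_toFiber _ _ _ _ T S
  adj_ι _ _ T := fiberAdj_toFiber _ _ _ T

/-- The canonical ⋆-homomorphism `𝕂(E_p) → O_1`. -/
def toUnitFiber (p : P) : X.K p p →⋆ₙₐ[ℂ] (fellBundle hX).fiber 1 where
  toFun := toFiber hX (frac_self_eq_one p)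
  map_smul' c T := map_smul (toFiber hX (frac_self_eq_one p)) c T
  map_zero' := map_zero (toFiber hX (frac_self_eq_one p))
  map_add' T S := map_add (toFiber hX (frac_self_eq_one p)) T S
  map_mul' T S := (fiberMul_toFiber (one_mul 1) _ _ (frac_self_eq_one p) T S).symm
  map_star' T := (fiberAdj_toFiber inv_one _ (frac_self_eq_one p) T).symm

theorem exists_mul_eq_mul_of_frac_eq_one {p₁ p₂ : P} (e : frac p₁ p₂ = 1) :
    ∃ t, p₁ * t = p₂ * t := by
  obtain ⟨t, s, h₁, h₂⟩ := RightOreMonoid.frac_eq.1 (e.trans one_def)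
  exact ⟨t, h₁.trans h₂.symm⟩

/-- The unit fibre is the closure of the images of the C⋆-algebras `𝕂(E_p)`. -/
theorem Fiber.induction_one {p : Fiber hX (1 : GroupCompletion P) → Prop}
    (closed : IsClosed {y | p y})
    (base : ∀ (q : P) (T : X.K q q), p (toFiber hX (frac_self_eq_one q) T))
    (y : Fiber hX (1 : GroupCompletion P)) : p y := by
  induction y using Fiber.induction with
  | closed => exact closed
  | base e T =>
    obtain ⟨t, ht⟩ := exists_mul_eq_mul_of_frac_eq_one e
    rw [← toFiber_amp e (frac_self_eq_one _) rfl ht.symm]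
    exact base _ _

section CStarColimit

variable {hX} {D : Type*} [NonUnitalCStarAlgebra D] {ψ : ∀ p : P, X.K p p →⋆ₙₐ[ℂ] D}

omit [RightOreMonoid P] in
theorem IsCStarCocone.map_amp (hψ : X.IsCStarCocone ψ) {p q r : P} (h : p * q = r) (T : X.K p p) :
    ψ r (amp hX h h T) = ψ p T := by
  subst h
  exact hψ p q T _ ((isAmplification_iff hX).2 rfl)

/-- A cocone under the C⋆-algebras `𝕂(E_p)` is also defined on `𝕂(E_{p₂}, E_{p₁})` if `p₁ p₂⁻¹ = 1`, by
amplification to some `𝕂(E_r)`, where `r = p₁ t = p₂ t`.  This does not depend on `t`. -/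
theorem IsCStarCocone.map_amp_eq (hψ : X.IsCStarCocone ψ) {p₁ p₂ t t' r r' : P}
    (h₁ : p₁ * t = r) (h₂ : p₂ * t = r) (h₁' : p₁ * t' = r') (h₂' : p₂ * t' = r')
    (T : X.K p₁ p₂) : ψ r (amp hX h₁ h₂ T) = ψ r' (amp hX h₁' h₂' T) := by
  obtain ⟨s, s', hs⟩ := exists_common_mul t t'
  have k : r' * s' = r * s := by
    rw [← h₁, ← h₁', _root_.mul_assoc, ← hs, _root_.mul_assoc]
  have k₁ : p₁ * (t * s) = r * s := by rw [← _root_.mul_assoc, h₁]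
  have k₂ : p₂ * (t * s) = r * s := by rw [← _root_.mul_assoc, h₂]
  rw [← hψ.map_amp (hX := hX) (q := s) rfl, ← hψ.map_amp (hX := hX) k,
    amp_amp hX h₁ h₂ rfl rfl rfl k₁ k₂, amp_amp hX h₁' h₂' k k hs.symm k₁ k₂]

/-- The induced map on the unit fibre; the Banach space colimit already provides it. -/
theorem IsCStarCocone.exists_desc (hψ : X.IsCStarCocone ψ) :
    ∃ Ψ : Fiber hX (1 : GroupCompletion P) →L[ℂ] D,
      ∀ {p₁ p₂ t r : P} (e : frac p₁ p₂ = 1) (h₁ : p₁ * t = r) (h₂ : p₂ * t = r) (T : X.K p₁ p₂),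
        Ψ (toFiber hX e T) = ψ r (amp hX h₁ h₂ T) := by
  have ht {p₁ p₂ : P} (e : frac p₁ p₂ = 1) := (exists_mul_eq_mul_of_frac_eq_one e).choose_spec
  obtain ⟨Ψ, -, h⟩ := exists_extension (hX := hX) (g := 1) (σ := RingHom.id ℂ) (Z := D)
    (fun {p₁ p₂} e =>
      { toFun := fun T => ψ _ (amp hX rfl (ht e).symm T)
        map_add' := fun T S =>
          (congrArg (ψ _) (map_add (amp hX rfl (ht e).symm) T S)).trans (map_add (ψ _) _ _)
        map_smul' := fun c T =>
          (congrArg (ψ _) (map_smul (amp hX rfl (ht e).symm) c T)).trans (map_smul (ψ _) c _) })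
    zero_le_one
    (fun {p₁ p₂} e T => by
      rw [one_mul]
      exact (NonUnitalStarAlgHom.norm_apply_le (ψ _) (amp hX rfl (ht e).symm T)).trans
        (norm_amp_le ..))
    fun {p₁ p₂ q r₁ r₂} e e' h₁ h₂ T => by
      have l₁ := congrArg (· * (exists_mul_eq_mul_of_frac_eq_one e').choose) h₁
      have l₂ := congrArg (· * (exists_mul_eq_mul_of_frac_eq_one e').choose) h₂
      simp only [_root_.mul_assoc] at l₁ l₂
      change ψ _ (amp hX rfl (ht e').symm (amp hX h₁ h₂ T)) = ψ _ (amp hX rfl (ht e).symm T)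
      rw [amp_amp hX h₁ h₂ rfl (ht e').symm rfl l₁ (l₂.trans (ht e').symm)]
      exact hψ.map_amp_eq _ _ _ _ T
  refine ⟨Ψ, fun e h₁ h₂ T => ?_⟩
  rw [h]
  exact hψ.map_amp_eq _ _ _ _ T

theorem isCStarColimit_toUnitFiber : X.IsCStarColimit (toUnitFiber hX) where
  isCocone p q T T' hT := by
    rw [(isAmplification_iff hX).1 hT]
    exact toFiber_amp ..
  existsUnique_desc D _ ψ hψ := by
    obtain ⟨Ψ, hΨ⟩ := hψ.exists_desc (hX := hX)
    have hΨ' (p : P) (T : X.K p p) : Ψ (toFiber hX (frac_self_eq_one p) T) = ψ p T := by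
      rw [hΨ _ (mul_one p) (mul_one p), hψ.map_amp]
    have hmul (a b : Fiber hX (1 : GroupCompletion P)) :
        Ψ (fiberMul hX (one_mul 1) a b) = Ψ a * Ψ b := by
      induction a, b using Fiber.induction₂ with
      | closed => exact isClosed_eq (by fun_prop) (by fun_prop)
      | @base p₁ p₂ p₃ e₁ e₂ T S =>
        obtain ⟨t, ht⟩ := exists_mul_eq_mul_of_frac_eq_one e₁
        obtain ⟨s, hs⟩ := exists_mul_eq_mul_of_frac_eq_one
          (show frac (p₂ * t) (p₃ * t) = 1 from (frac_mul_right _ _ _).trans e₂)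
        have e₃ := frac_mul_frac_eq (one_mul 1) e₁ e₂ (mul_one _) (mul_one _) (mul_one _)
          (mul_one _)
        have k₁ : p₁ * (t * s) = p₃ * (t * s) := by
          rw [← _root_.mul_assoc, ht, hs, _root_.mul_assoc]
        have k₂ : p₂ * (t * s) = p₃ * (t * s) := by
          rw [← _root_.mul_assoc, hs, _root_.mul_assoc]
        rw [fiberMul_toFiber (one_mul 1) e₁ e₂ e₃, hΨ e₁ k₁ k₂, hΨ e₂ k₂ rfl, hΨ e₃ k₁ rfl,
          ← compComp_amp hX k₁ k₂ rfl]
        exact map_mul (ψ _) _ _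
    have hstar (a : Fiber hX (1 : GroupCompletion P)) :
        Ψ (fiberAdj hX inv_one a) = star (Ψ a) := by
      induction a using Fiber.induction_one with
      | closed => exact isClosed_eq (by fun_prop) (by fun_prop)
      | base p T =>
        rw [fiberAdj_toFiber inv_one _ (frac_self_eq_one p), hΨ', hΨ']
        exact map_star (ψ p) T
    refine ⟨{ toFun := Ψ
              map_smul' := fun c a => map_smul Ψ c a
              map_zero' := map_zero Ψ
              map_add' := map_add Ψ
              map_mul' := hmul
              map_star' := hstar }, hΨ', fun Φ hΦ => ?_⟩
    have hc : Continuous fun a : Fiber hX (1 : GroupCompletion P) => Φ a :=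
      AddMonoidHomClass.continuous_of_bound
        (AddMonoidHom.mk' (fun a : Fiber hX (1 : GroupCompletion P) => Φ a) fun a b => map_add Φ a b)
        1 fun a => (NonUnitalStarAlgHom.norm_apply_le (A := (fellBundle hX).fiber 1) Φ
          a).trans_eq (one_mul _).symm
    refine NonUnitalStarAlgHom.ext fun a => ?_
    refine Fiber.induction_one hX (p := fun a => Φ a = Ψ a) (isClosed_eq hc Ψ.continuous)
      (fun p T => ?_) a
    exact (hΦ p T).trans (hΨ' p T).symm

end CStarColimit

end ProductSystem

/-! ### Vectors as compact operators `A → E_p` -/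

namespace HilbertModule

variable {B : Type*} [NonUnitalCStarAlgebra B]
variable {E : Type*} [NormedAddCommGroup E] [NormedSpace ℂ E] [CompleteSpace E]
variable {F : Type*} [NormedAddCommGroup F] [NormedSpace ℂ F] [CompleteSpace F]
variable {H : Type*} [NormedAddCommGroup H] [NormedSpace ℂ H] [CompleteSpace H]
variable [HilbertModule B E] [HilbertModule B F] [HilbertModule B H]

@[fun_prop]
theorem continuous_compAdj :
    Continuous (compAdj : compactOperators B E F → compactOperators B F E) := by
  refine LipschitzWith.continuous (K := 1) (LipschitzWith.mk_one fun T S => ?_)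
  rw [Subtype.dist_eq, Subtype.dist_eq, dist_eq_norm, dist_eq_norm]
  exact ((isAdjoint_compAdj T).sub (isAdjoint_compAdj S)).norm_le

theorem compAdj_zero : compAdj (0 : compactOperators B E F) = 0 :=
  compAdj_eq fun ξ η => (ip_zero_left η).trans (ip_zero_right ξ).symm

theorem zero_compComp (S : compactOperators B E F) :
    compComp (0 : compactOperators B F H) S = 0 :=
  Subtype.ext (ContinuousLinearMap.zero_comp _)

theorem compComp_zero (T : compactOperators B F H) :
    compComp T (0 : compactOperators B E F) = 0 :=
  Subtype.ext (ContinuousLinearMap.comp_zero _)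

theorem continuous_compComp_left (S : compactOperators B E F) :
    Continuous fun T : compactOperators B F H => compComp T S :=
  (continuous_subtype_val.clm_comp continuous_const).subtype_mk _

theorem continuous_compComp_right (T : compactOperators B F H) :
    Continuous fun S : compactOperators B E F => compComp T S :=
  (continuous_const.clm_comp continuous_subtype_val).subtype_mk _

variable (B E F) in
/-- Formal linear combinations of rank one operators, sent to the operators they represent. -/
def ketBraSum : (F × E →₀ ℂ) →ₗ[ℂ] compactOperators B E F :=
  Finsupp.linearCombination ℂ fun x => ketBra B x.1 x.2

theorem denseRange_ketBraSum : DenseRange (ketBraSum B E F) := by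
  intro T
  change T ∈ (LinearMap.range (ketBraSum B E F)).topologicalClosure
  induction T using compact_induction with
  | rank ξ η =>
    refine Submodule.le_topologicalClosure _ ⟨Finsupp.single (ξ, η) 1, ?_⟩
    rw [ketBraSum, Finsupp.linearCombination_single, one_smul]
  | add T S hT hS => exact add_mem hT hS
  | smul c T hT => exact Submodule.smul_mem _ c hT
  | closed => exact Submodule.isClosed_topologicalClosure _

/-- `LinearMap.extendOfNorm` for maps to a subspace, with the norm taken in the ambient space. -/
theorem exists_clm_extension {V W Z : Type*} [AddCommGroup V] [Module ℂ V]
    [NormedAddCommGroup W] [NormedSpace ℂ W] [NormedAddCommGroup Z] [NormedSpace ℂ Z]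
    [CompleteSpace Z] {M : Submodule ℂ W} {e : V →ₗ[ℂ] M} {f : V →ₗ[ℂ] Z} (he : DenseRange e)
    (hb : ∀ x, ‖f x‖ ≤ ‖(e x : W)‖) : ∃ Φ : M →L[ℂ] Z, ∀ x, Φ (e x) = f x :=
  ⟨f.extendOfNorm e, LinearMap.extendOfNorm_eq he ⟨1, fun x => (hb x).trans_eq (one_mul _).symm⟩⟩

theorem exists_extension_ketBra {Z : Type*} [NormedAddCommGroup Z] [NormedSpace ℂ Z]
    [CompleteSpace Z] (f : (F × E →₀ ℂ) →ₗ[ℂ] Z)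
    (hb : ∀ x, ‖f x‖ ≤ ‖(ketBraSum B E F x : E →L[ℂ] F)‖) :
    ∃ θ : compactOperators B E F →L[ℂ] Z, ∀ x, θ (ketBraSum B E F x) = f x :=
  exists_clm_extension (W := E →L[ℂ] F) denseRange_ketBraSum hb

end HilbertModule

namespace ProductSystem

open HilbertModule Correspondence RightOreMonoid

variable {P : Type w} [Monoid P] {A : Type u} [NonUnitalCStarAlgebra A] {X : ProductSystem P A}

section ket

variable (hX : X.IsProper)

/-- The creation operators as a continuous linear map. -/
def creationL {p q r : P} (h : p * q = r) : X.E p →L[ℂ] X.E q →L[ℂ] X.E r :=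
  LinearMap.mkContinuous
    { toFun := creation hX h
      map_add' := fun ξ ξ' => ContinuousLinearMap.ext fun η => LinearMap.map_add₂ _ ξ ξ' η
      map_smul' := fun c ξ => ContinuousLinearMap.ext fun η => LinearMap.map_smul₂ _ c ξ η }
    1 fun ξ => by
      rw [one_mul]
      exact LinearMap.mkContinuous_norm_le _ (norm_nonneg ξ) fun η => hX.norm_mul_le h ξ η

theorem creation_act_eq {p : P} (ξ : X.E p) (b : A) :
    creation hX (mul_one p) (act ξ b) = rankOne A ξ (X.unit (star b)) := by
  ext x
  obtain ⟨a, rfl⟩ := X.unit.surjective x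
  rw [creation_apply, X.mul_unit, rankOne_apply, X.ip_unit, star_star, act_act]

/-- The operators `A → E_p`, `a ↦ ξ a`, are compact: for `ξ` replaced by `ξ b` they are `|ξ⟩⟨b*|`. -/
theorem creation_mem {p : P} (ξ : X.E p) :
    creation hX (mul_one p) ξ ∈ compactOperators A (X.E 1) (X.E p) := by
  have h := map_mem_closure (creationL hX (mul_one p)).continuous (mem_closure_act A ξ)
    (t := compactOperators A (X.E 1) (X.E p)) (by
      rintro _ ⟨b, rfl⟩
      change creation hX (mul_one p) (act ξ b) ∈ compactOperators A (X.E 1) (X.E p)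
      rw [creation_act_eq]
      exact rankOne_mem _ _)
  rwa [isClosed_compactOperators.closure_eq] at h

/-- The isomorphism `E_p ≅ 𝕂(A, E_p)`, with `A` identified with `E_1`. -/
def ket (p : P) : X.E p →L[ℂ] X.K p 1 :=
  (creationL hX (mul_one p)).codRestrict _ (creation_mem hX)

theorem coe_ket {p : P} (ξ : X.E p) :
    (ket hX p ξ : X.E 1 →L[ℂ] X.E p) = creation hX (mul_one p) ξ := rfl

theorem ket_act {p : P} (ξ : X.E p) (b : A) :
    ket hX p (act ξ b) = ketBra A ξ (X.unit (star b)) :=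
  Subtype.ext (creation_act_eq hX ξ b)

/-- Creation operators are amplifications of kets. -/
theorem amp_ket {p q r : P} (h : p * q = r) (ξ : X.E p) :
    (amp hX h (one_mul q) (ket hX p ξ) : X.E q →L[ℂ] X.E r) = creation hX h ξ :=
  clm_ext (one_mul q) fun x η => by
    rw [amp_apply, coe_ket, creation_apply, creation_apply,
      X.mul_assoc (mul_one p) h (one_mul q) h]

theorem compComp_amp_ket_ket {p q r : P} (h : p * q = r) (ξ : X.E p) (η : X.E q) :
    compComp (amp hX h (one_mul q) (ket hX p ξ)) (ket hX q η) = ket hX r (X.mul h ξ η) := by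
  refine Subtype.ext (ContinuousLinearMap.ext fun x => ?_)
  change (amp hX h (one_mul q) (ket hX p ξ) : X.E q →L[ℂ] X.E r) (X.mul (mul_one q) η x) =
    X.mul (mul_one r) (X.mul h ξ η) x
  rw [amp_ket, creation_apply, X.mul_assoc h (mul_one r) (mul_one q) h]

theorem coe_compAdj_ket {p : P} (ξ : X.E p) :
    (compAdj (ket hX p ξ) : X.E p →L[ℂ] X.E 1) = annihilation hX (mul_one p) ξ :=
  (isAdjoint_compAdj (ket hX p ξ)).unique (isAdjoint_creation hX (mul_one p) ξ)

theorem annihilation_eq_unit {p : P} (η ζ : X.E p) :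
    annihilation hX (mul_one p) η ζ = X.unit (ip (B := A) η ζ) := by
  apply ext_ip A
  intro x
  obtain ⟨a, rfl⟩ := X.unit.surjective x
  rw [← isAdjoint_creation hX (mul_one p) η, creation_apply, X.mul_unit, ip_act_left, X.ip_unit]

theorem compComp_compAdj_ket_ket {p : P} (ξ η : X.E p) :
    compComp (compAdj (ket hX p ξ)) (ket hX p η) = ket hX 1 (X.unit (ip (B := A) ξ η)) := by
  refine Subtype.ext (ContinuousLinearMap.ext fun x => ?_)
  change (compAdj (ket hX p ξ) : X.E p →L[ℂ] X.E 1) (X.mul (mul_one p) η x) =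
    X.mul (mul_one 1) (X.unit (ip (B := A) ξ η)) x
  rw [coe_compAdj_ket, annihilation_mul]
  exact (X.unit_mul 1 _ x).symm

theorem compComp_ket_compAdj_ket {p q : P} (ξ : X.E p) (η : X.E q) :
    compComp (ket hX p ξ) (compAdj (ket hX q η)) = ketBra A ξ η := by
  refine Subtype.ext (ContinuousLinearMap.ext fun ζ => ?_)
  change X.mul (mul_one p) ξ ((compAdj (ket hX q η) : X.E q →L[ℂ] X.E 1) ζ) = _
  rw [coe_compAdj_ket, annihilation_eq_unit, X.mul_unit]
  rfl

theorem coe_ket_unit (a : A) :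
    (ket hX 1 (X.unit a) : X.E 1 →L[ℂ] X.E 1) = left (B := A) a :=
  ContinuousLinearMap.ext fun x => X.unit_mul 1 a x

theorem compAdj_ket_unit (a : A) :
    compAdj (ket hX 1 (X.unit a)) = ket hX 1 (X.unit (star a)) :=
  compAdj_eq (by rw [coe_ket_unit, coe_ket_unit]; exact isAdjoint_left a)

theorem amp_ket_unit (p : P) (a : A) :
    amp hX (one_mul p) (one_mul p) (ket hX 1 (X.unit a)) = leftHom (hX p) a :=
  Subtype.ext (by
    rw [amp_ket]
    exact ContinuousLinearMap.ext fun ξ => X.unit_mul p a ξ)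

end ket

/-! ### Representations of compact operators -/

/-- A representation in `D` of the system of all spaces `𝕂(E_q, E_p)` with their composition,
adjoints and amplifications.  Both the representations of the Fell bundle and the Cuntz--Pimsner
covariant representations of the product system are equivalent to these. -/
structure CompactRep (hX : X.IsProper) (D : Type*) [NonUnitalCStarAlgebra D] where
  /-- the linear map on `𝕂(E_q, E_p)` -/
  θ : ∀ p q, X.K p q →ₗ[ℂ] D
  θ_comp : ∀ {p q r} (T : X.K p q) (S : X.K q r), θ p r (compComp T S) = θ p q T * θ q r S
  θ_adj : ∀ {p q} (T : X.K p q), θ q p (compAdj T) = star (θ p q T)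
  θ_amp : ∀ {p q t p' q'} (h : p * t = p') (h' : q * t = q') (T : X.K p q),
    θ p' q' (amp hX h h' T) = θ p q T

namespace CompactRep

variable {hX : X.IsProper} {D : Type*} [NonUnitalCStarAlgebra D] (Θ : CompactRep hX D)

/-- The restriction of a representation to the C⋆-algebra `𝕂(E_p)`. -/
def diag (p : P) : X.K p p →⋆ₙₐ[ℂ] D where
  toFun := Θ.θ p p
  map_smul' c T := map_smul (Θ.θ p p) c T
  map_zero' := map_zero (Θ.θ p p)
  map_add' T S := map_add (Θ.θ p p) T S
  map_mul' T S := Θ.θ_comp T S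
  map_star' T := Θ.θ_adj T

theorem norm_le {p q : P} (T : X.K p q) : ‖Θ.θ p q T‖ ≤ ‖T‖ := by
  refine abs_le_of_sq_le_sq' ?_ (norm_nonneg _) |>.2
  rw [pow_two, ← CStarRing.norm_star_mul_self, ← Θ.θ_adj, ← Θ.θ_comp]
  exact (NonUnitalStarAlgHom.norm_apply_le (Θ.diag q) _).trans_eq (norm_compComp_compAdj_self T)

theorem continuous_θ (p q : P) : Continuous (Θ.θ p q) :=
  AddMonoidHomClass.continuous_of_bound (Θ.θ p q) 1 fun T =>
    (Θ.norm_le T).trans_eq (one_mul _).symm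

theorem θ_ket_mul_θ_ket {p q r : P} (h : p * q = r) (ξ : X.E p) (η : X.E q) :
    Θ.θ p 1 (ket hX p ξ) * Θ.θ q 1 (ket hX q η) = Θ.θ r 1 (ket hX r (X.mul h ξ η)) := by
  rw [← compComp_amp_ket_ket, Θ.θ_comp, Θ.θ_amp]

theorem θ_ketBra {p q : P} (ξ : X.E p) (η : X.E q) :
    Θ.θ p q (ketBra A ξ η) = Θ.θ p 1 (ket hX p ξ) * star (Θ.θ q 1 (ket hX q η)) := by
  rw [← compComp_ket_compAdj_ket hX, Θ.θ_comp, Θ.θ_adj]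

/-- The representation of the product system given by restriction to `E_p ≅ 𝕂(A, E_p)`. -/
def toRepresentation : X.Representation D where
  π :=
    { toFun := fun a => Θ.θ 1 1 (ket hX 1 (X.unit a))
      map_smul' := fun c a => by rw [map_smul, map_smul, map_smul]; rfl
      map_zero' := by rw [map_zero, map_zero, map_zero]
      map_add' := fun a b => by rw [map_add, map_add, map_add]
      map_mul' := fun a b => by
        rw [Θ.θ_ket_mul_θ_ket (one_mul 1), X.unit_mul, X.left_unit]
      map_star' := fun a => by rw [← compAdj_ket_unit, Θ.θ_adj] }
  S p := Θ.θ p 1 ∘ₗ (ket hX p).toLinearMap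
  S_unit _ := rfl
  S_mul _ _ ξ η := Θ.θ_ket_mul_θ_ket rfl ξ η
  star_S_mul p ξ η := by
    change star (Θ.θ p 1 (ket hX p ξ)) * Θ.θ p 1 (ket hX p η) =
      Θ.θ 1 1 (ket hX 1 (X.unit (ip (B := A) ξ η)))
    rw [← Θ.θ_adj, ← Θ.θ_comp, compComp_compAdj_ket_ket]

theorem toRepresentation_covariant : Θ.toRepresentation.IsCuntzPimsnerCovariant := fun p =>
  ⟨Θ.diag p, fun ξ η => Θ.θ_ketBra ξ η, fun a _ =>
    (congrArg (Θ.θ p p) (amp_ket_unit hX p a).symm).trans (Θ.θ_amp _ _ _)⟩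

end CompactRep

namespace Representation

variable {D : Type*} [NonUnitalCStarAlgebra D] (ρ : X.Representation D)

theorem S_mul_eq {p q r : P} (h : p * q = r) (ξ : X.E p) (η : X.E q) :
    ρ.S p ξ * ρ.S q η = ρ.S r (X.mul h ξ η) := by
  subst h
  exact ρ.S_mul p q ξ η

theorem S_mul_π {p : P} (ξ : X.E p) (a : A) : ρ.S p ξ * ρ.π a = ρ.S p (act ξ a) := by
  rw [← ρ.S_unit, ρ.S_mul_eq (mul_one p), X.mul_unit]

theorem continuous_S (p : P) : Continuous (ρ.S p) :=
  AddMonoidHomClass.continuous_of_bound (ρ.S p) 1 fun T =>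
    (ρ.norm_le p T).trans_eq (one_mul _).symm

/-- Formal linear combinations of rank one operators `|ξ⟩⟨η|`, sent to the combinations of
`S(ξ) S(η)*`. -/
def repSum (p q : P) : (X.E p × X.E q →₀ ℂ) →ₗ[ℂ] D :=
  Finsupp.linearCombination ℂ fun x => ρ.S p x.1 * star (ρ.S q x.2)

theorem star_repSum_mul_repSum {p q : P} {ϑ : X.K q q →⋆ₙₐ[ℂ] D}
    (hϑ : ∀ ξ η : X.E q, ϑ (ketBra A ξ η) = ρ.S q ξ * star (ρ.S q η))
    (f f' : X.E p × X.E q →₀ ℂ) :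
    star (ρ.repSum p q f) * ρ.repSum p q f' =
      ϑ (compComp (compAdj (ketBraSum A (X.E q) (X.E p) f)) (ketBraSum A (X.E q) (X.E p) f')) := by
  induction f using Finsupp.induction_linear with
  | zero =>
    rw [map_zero, map_zero, star_zero, zero_mul, compAdj_zero, zero_compComp]
    exact (map_zero ϑ).symm
  | add f g hf hg =>
    rw [map_add, map_add, star_add, add_mul, hf, hg, compAdj_add, compComp_add_left, map_add]
  | single x c =>
    induction f' using Finsupp.induction_linear with
    | zero =>
      rw [map_zero, map_zero, mul_zero, compComp_zero]
      exact (map_zero ϑ).symm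
    | add f g hf hg => rw [map_add, map_add, mul_add, hf, hg, compComp_add_right, map_add]
    | single y d =>
      simp only [repSum, ketBraSum, Finsupp.linearCombination_single, compAdj_smul,
        compComp_smul_left, compComp_smul_right, map_smul, star_smul, compAdj_ketBra,
        compComp_ketBra_ketBra, hϑ, smul_mul_assoc, mul_smul_comm, star_mul, star_star]
      rw [← ρ.S_mul_π, ← ρ.star_S_mul]
      simp only [_root_.mul_assoc]

/-- By the C⋆-identity it is enough to bound `(∑ S(ξ) S(η)*)* (∑ S(ξ) S(η)*)`, which lies in the range
of the ⋆-homomorphism `ϑ` on `𝕂(E_q)`. -/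
theorem norm_repSum_le (hρ : ρ.IsCuntzPimsnerCovariant) (p q : P) (f : X.E p × X.E q →₀ ℂ) :
    ‖ρ.repSum p q f‖ ≤ ‖(ketBraSum A (X.E q) (X.E p) f : X.E q →L[ℂ] X.E p)‖ := by
  obtain ⟨ϑ, hϑ, -⟩ := hρ q
  refine abs_le_of_sq_le_sq' ?_ (norm_nonneg _) |>.2
  rw [pow_two, ← CStarRing.norm_star_mul_self, ρ.star_repSum_mul_repSum hϑ]
  exact (NonUnitalStarAlgHom.norm_apply_le ϑ _).trans_eq (norm_compComp_compAdj_self _)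

theorem exists_θ (hρ : ρ.IsCuntzPimsnerCovariant) (p q : P) :
    ∃ θ : X.K p q →L[ℂ] D, ∀ ξ η, θ (ketBra A ξ η) = ρ.S p ξ * star (ρ.S q η) := by
  obtain ⟨θ, hθ⟩ := exists_extension_ketBra (ρ.repSum p q) (ρ.norm_repSum_le hρ p q)
  refine ⟨θ, fun ξ η => ?_⟩
  have h := hθ (Finsupp.single (ξ, η) 1)
  rw [ketBraSum, repSum, Finsupp.linearCombination_single, Finsupp.linearCombination_single,
    one_smul, one_smul] at h
  exact h

/-- The map `𝕂(E_q, E_p) → D`, `|ξ⟩⟨η| ↦ S(ξ) S(η)*`, of a covariant representation. -/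
def θ (hρ : ρ.IsCuntzPimsnerCovariant) (p q : P) : X.K p q →L[ℂ] D :=
  (ρ.exists_θ hρ p q).choose

variable {ρ} (hρ : ρ.IsCuntzPimsnerCovariant)

theorem θ_ketBra {p q : P} (ξ : X.E p) (η : X.E q) :
    ρ.θ hρ p q (ketBra A ξ η) = ρ.S p ξ * star (ρ.S q η) :=
  (ρ.exists_θ hρ p q).choose_spec ξ η

theorem θ_comp {p q r : P} (T : X.K p q) (S : X.K q r) :
    ρ.θ hρ p r (compComp T S) = ρ.θ hρ p q T * ρ.θ hρ q r S := by
  induction T using compact_induction with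
  | add T T' hT hT' => rw [compComp_add_left, map_add, map_add, add_mul, hT, hT']
  | smul c T hT => rw [compComp_smul_left, map_smul, map_smul, smul_mul_assoc, hT]
  | closed =>
    exact isClosed_eq ((ρ.θ hρ p r).continuous.comp (continuous_compComp_left S))
      ((ρ.θ hρ p q).continuous.mul continuous_const)
  | rank ξ η =>
    induction S using compact_induction with
    | add S S' hS hS' => rw [compComp_add_right, map_add, map_add, mul_add, hS, hS']
    | smul c S hS => rw [compComp_smul_right, map_smul, map_smul, mul_smul_comm, hS]
    | closed =>
      exact isClosed_eq ((ρ.θ hρ p r).continuous.comp (continuous_compComp_right _))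
        (continuous_const.mul (ρ.θ hρ q r).continuous)
    | rank ξ' η' =>
      rw [compComp_ketBra_ketBra, θ_ketBra, θ_ketBra, θ_ketBra, ← ρ.S_mul_π, ← ρ.star_S_mul]
      simp only [_root_.mul_assoc]

theorem θ_adj {p q : P} (T : X.K p q) : ρ.θ hρ q p (compAdj T) = star (ρ.θ hρ p q T) := by
  induction T using compact_induction with
  | add T T' hT hT' => rw [compAdj_add, map_add, map_add, star_add, hT, hT']
  | smul c T hT => rw [compAdj_smul, map_smul, map_smul, star_smul, hT]
  | closed =>
    exact isClosed_eq ((ρ.θ hρ q p).continuous.comp continuous_compAdj)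
      (ρ.θ hρ p q).continuous.star
  | rank ξ η => rw [compAdj_ketBra, θ_ketBra, θ_ketBra, star_mul, star_star]

theorem θ_left (hX : X.IsProper) (q : P) (a : A) :
    ρ.θ hρ q q (leftHom (hX q) a) = ρ.π a := by
  obtain ⟨ϑ, hϑ, hπ⟩ := hρ q
  have hc : Continuous fun T : X.K q q => ϑ T := by
    refine AddMonoidHomClass.continuous_of_bound
      (AddMonoidHom.mk' (fun T : X.K q q => ϑ T) fun T S => map_add ϑ T S) 1 fun T => ?_
    exact (NonUnitalStarAlgHom.norm_apply_le ϑ T).trans_eq (one_mul _).symm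
  have h (T : X.K q q) : ρ.θ hρ q q T = ϑ T := by
    induction T using compact_induction with
    | add T T' hT hT' => rw [map_add, map_add, hT, hT']
    | smul c T hT => rw [map_smul, map_smul, hT]
    | closed => exact isClosed_eq (ρ.θ hρ q q).continuous hc
    | rank ξ η => rw [θ_ketBra]; exact (hϑ ξ η).symm
  rw [h]
  exact hπ a (hX q a)

/-- The map `R ↦ L_ξ R L_η*` given by creation operators `L_ξ` and `L_η`. -/
def sandwich (hX : X.IsProper) {p₁ p₂ q r₁ r₂ : P} (h₁ : p₁ * q = r₁) (h₂ : p₂ * q = r₂)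
    (ξ : X.E p₁) (η : X.E p₂) : X.K q q →L[ℂ] X.K r₁ r₂ :=
  ((((ContinuousLinearMap.compL ℂ (X.E r₂) (X.E q) (X.E r₁) (creation hX h₁ ξ)) ∘L
    (ContinuousLinearMap.compL ℂ (X.E r₂) (X.E q) (X.E q)).flip (annihilation hX h₂ η)) ∘L
      (compactOperators A (X.E q) (X.E q)).subtypeL)).codRestrict _ fun R =>
    (isAdjoint_creation hX h₁ ξ).comp_compact_mem
      ⟨_, (isAdjoint_creation hX h₂ η).symm.compact_comp_mem R⟩

theorem sandwich_ketBra (hX : X.IsProper) {p₁ p₂ q r₁ r₂ : P} (h₁ : p₁ * q = r₁)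
    (h₂ : p₂ * q = r₂) (ξ : X.E p₁) (η : X.E p₂) (x y : X.E q) :
    sandwich hX h₁ h₂ ξ η (ketBra A x y) = ketBra A (X.mul h₁ ξ x) (X.mul h₂ η y) := by
  refine Subtype.ext ?_
  change (creation hX h₁ ξ).comp ((rankOne A x y).comp (annihilation hX h₂ η)) = _
  rw [(isAdjoint_creation hX h₂ η).symm.rankOne_comp, (isAdjoint_creation hX h₁ ξ).comp_rankOne]
  rfl

theorem θ_sandwich (hX : X.IsProper) {p₁ p₂ q r₁ r₂ : P} (h₁ : p₁ * q = r₁) (h₂ : p₂ * q = r₂)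
    (ξ : X.E p₁) (η : X.E p₂) (R : X.K q q) :
    ρ.θ hρ r₁ r₂ (sandwich hX h₁ h₂ ξ η R) =
      ρ.S p₁ ξ * ρ.θ hρ q q R * star (ρ.S p₂ η) := by
  induction R using compact_induction with
  | add R R' h h' => rw [map_add, map_add, map_add, mul_add, add_mul, h, h']
  | smul c R h => rw [map_smul, map_smul, map_smul, mul_smul_comm, smul_mul_assoc, h]
  | closed =>
    exact isClosed_eq ((ρ.θ hρ r₁ r₂).continuous.comp (sandwich hX h₁ h₂ ξ η).continuous)
      ((continuous_const.mul (ρ.θ hρ q q).continuous).mul continuous_const)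
  | rank x y =>
    rw [sandwich_ketBra, θ_ketBra, θ_ketBra, ← ρ.S_mul_eq, ← ρ.S_mul_eq, star_mul]
    simp only [_root_.mul_assoc]

/-- Cuntz--Pimsner covariance makes `θ` compatible with amplification: on `|ξ a⟩⟨η|` it says
`S(ξ) π(a) S(η)* = S(ξ) θ(φ_q(a)) S(η)*`. -/
theorem θ_amp (hX : X.IsProper) {p₁ p₂ q r₁ r₂ : P} (h₁ : p₁ * q = r₁) (h₂ : p₂ * q = r₂)
    (T : X.K p₁ p₂) : ρ.θ hρ r₁ r₂ (amp hX h₁ h₂ T) = ρ.θ hρ p₁ p₂ T := by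
  induction T using compact_induction_act with
  | add R R' h h' => rw [map_add, map_add, map_add, h, h']
  | smul c R h => rw [map_smul, map_smul, map_smul, h]
  | closed =>
    exact isClosed_eq ((ρ.θ hρ r₁ r₂).continuous.comp (amp hX h₁ h₂).continuous)
      (ρ.θ hρ p₁ p₂).continuous
  | rank ξ a η =>
    have h : amp hX h₁ h₂ (ketBra A (act ξ a) η) = sandwich hX h₁ h₂ ξ η (leftHom (hX q) a) :=
      Subtype.ext (ampL_ketBra hX h₁ h₂ ξ a η)
    rw [h, θ_sandwich, θ_left, θ_ketBra, ρ.S_mul_π]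

/-- The representation of compact operators given by a covariant representation. -/
def toCompactRep (hX : X.IsProper) : CompactRep hX D where
  θ p q := (ρ.θ hρ p q).toLinearMap
  θ_comp := θ_comp hρ
  θ_adj := θ_adj hρ
  θ_amp := θ_amp hρ hX

theorem toCompactRep_ket (hX : X.IsProper) {p : P} (ξ : X.E p) :
    (toCompactRep hρ hX).θ p 1 (ket hX p ξ) = ρ.S p ξ := by
  have hc : IsClosed {ξ | (toCompactRep hρ hX).θ p 1 (ket hX p ξ) = ρ.S p ξ} :=
    isClosed_eq (((toCompactRep hρ hX).continuous_θ p 1).comp (ket hX p).continuous)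
      (ρ.continuous_S p)
  refine hc.closure_subset_iff.2 ?_ (mem_closure_act A ξ)
  rintro _ ⟨b, rfl⟩
  change ρ.θ hρ p 1 (ket hX p (act ξ b)) = ρ.S p (act ξ b)
  rw [ket_act, θ_ketBra, ρ.S_unit, ← map_star, star_star, ρ.S_mul_π]

end Representation

end ProductSystem

/-! ### C⋆-algebras generated by universal families -/

/-- Restriction of bounded families along a map of index sets. -/
def lpReindex {I J : Type*} {C : J → Type*} [∀ j, NonUnitalCStarAlgebra (C j)] (e : I → J) :
    lp C ∞ →⋆ₙₐ[ℂ] lp (fun i => C (e i)) ∞ where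
  toFun f := ⟨fun i => f (e i), memℓp_infty ⟨‖f‖, by
    rintro _ ⟨i, rfl⟩
    exact lp.norm_apply_le_norm ENNReal.top_ne_zero f (e i)⟩⟩
  map_smul' _ _ := rfl
  map_zero' := rfl
  map_add' _ _ := rfl
  map_mul' _ _ := rfl
  map_star' _ := rfl

section closure

variable {L M : Type*} [NonUnitalCStarAlgebra L] [NonUnitalCStarAlgebra M]

open NonUnitalStarAlgebra

theorem continuous_nonUnitalStarAlgHom (Φ : L →⋆ₙₐ[ℂ] M) : Continuous Φ :=
  AddMonoidHomClass.continuous_of_bound Φ 1 fun x =>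
    (NonUnitalStarAlgHom.norm_apply_le Φ x).trans_eq (one_mul _).symm

theorem map_mem_closure_adjoin {s : Set L} {N : NonUnitalStarSubalgebra ℂ M}
    (hN : IsClosed (N : Set M)) (Φ : L →⋆ₙₐ[ℂ] M) (h : ∀ x ∈ s, Φ x ∈ N) {x : L}
    (hx : x ∈ (adjoin ℂ s).topologicalClosure) : Φ x ∈ N :=
  NonUnitalStarSubalgebra.topologicalClosure_minimal (t := N.comap Φ) _ (adjoin_le h)
    (hN.preimage (continuous_nonUnitalStarAlgHom Φ)) hx

theorem eq_self_of_mem_closure_adjoin {s : Set L} (Φ : L →⋆ₙₐ[ℂ] L) (h : ∀ x ∈ s, Φ x = x) {x : L}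
    (hx : x ∈ (adjoin ℂ s).topologicalClosure) : Φ x = x :=
  NonUnitalStarSubalgebra.topologicalClosure_minimal
    (t := NonUnitalStarAlgHom.equalizer Φ (NonUnitalStarAlgHom.id ℂ L)) _ (adjoin_le h)
    (isClosed_eq (continuous_nonUnitalStarAlgHom Φ) continuous_id) hx

/-- Two ⋆-homomorphisms that map generators to elements of the generated C⋆-algebras and are inverse
to each other on generators restrict to an isomorphism between the generated C⋆-algebras. -/
theorem nonempty_starAlgEquiv_closure_adjoin {s : Set L} {t : Set M} (Φ : L →⋆ₙₐ[ℂ] M)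
    (Ψ : M →⋆ₙₐ[ℂ] L) (hΦ : ∀ x ∈ s, Φ x ∈ (adjoin ℂ t).topologicalClosure)
    (hΨ : ∀ y ∈ t, Ψ y ∈ (adjoin ℂ s).topologicalClosure) (hs : ∀ x ∈ s, Ψ (Φ x) = x)
    (ht : ∀ y ∈ t, Φ (Ψ y) = y) :
    Nonempty ((adjoin ℂ s).topologicalClosure ≃⋆ₐ[ℂ] (adjoin ℂ t).topologicalClosure) :=
  ⟨{ toFun := fun x => ⟨Φ x, map_mem_closure_adjoin
        (NonUnitalStarSubalgebra.isClosed_topologicalClosure _) Φ hΦ x.2⟩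
     invFun := fun y => ⟨Ψ y, map_mem_closure_adjoin
        (NonUnitalStarSubalgebra.isClosed_topologicalClosure _) Ψ hΨ y.2⟩
     left_inv := fun x => Subtype.ext (eq_self_of_mem_closure_adjoin (Ψ.comp Φ) hs x.2)
     right_inv := fun y => Subtype.ext (eq_self_of_mem_closure_adjoin (Φ.comp Ψ) ht y.2)
     map_mul' := fun x y => Subtype.ext (map_mul Φ (x : L) y)
     map_add' := fun x y => Subtype.ext (map_add Φ (x : L) y)
     map_star' := fun x => Subtype.ext (map_star Φ (x : L))
     map_smul' := fun c x => Subtype.ext (map_smul Φ c (x : L)) }⟩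

end closure

namespace ProductSystem

open HilbertModule Correspondence RightOreMonoid

variable {P : Type w} [Monoid P] [RightOreMonoid P] {A : Type u} [NonUnitalCStarAlgebra A]
  {X : ProductSystem P A} {hX : X.IsProper}

/-! ### Representations of the Fell bundle -/

section

variable {D : Type*} [NonUnitalCStarAlgebra D]

theorem fellRep_toFiber (σ : (fellBundle hX).Representation D) {g : GroupCompletion P} {p q : P}
    (e : frac p q = g) (T : X.K p q) :
    σ.π g (toFiber hX e T) = σ.π (frac p q) (toFiber hX rfl T) := by
  subst e
  rfl

/-- A representation of the Fell bundle restricts to compact operators. -/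
def CompactRep.ofFellRep (σ : (fellBundle hX).Representation D) : CompactRep hX D where
  θ p q := σ.π (frac p q) ∘ₗ (toFiber hX rfl).toLinearMap
  θ_comp {p q r} T S := by
    have h := σ.map_mul (frac_mul_frac_cancel p q r) (toFiber hX rfl T) (toFiber hX rfl S)
    exact (congrArg (σ.π _) (fiberMul_toFiber _ rfl rfl rfl T S).symm).trans h
  θ_adj {p q} T := by
    have h := σ.map_adj (inv_frac p q) (toFiber hX rfl T)
    exact (congrArg (σ.π _) (fiberAdj_toFiber _ rfl rfl T).symm).trans h
  θ_amp {p q t p' q'} h h' T := by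
    have e : frac p q = frac p' q' := by rw [← h, ← h', frac_mul_right]
    exact (congrArg (σ.π _) (toFiber_amp e rfl h h' T)).trans (fellRep_toFiber σ e T)

namespace CompactRep

variable (Θ : CompactRep hX D)

theorem exists_fellRep_map (g : GroupCompletion P) :
    ∃ Ψ : Fiber hX g →L[ℂ] D, (∀ y, ‖Ψ y‖ ≤ 1 * ‖y‖) ∧
      ∀ {p q : P} (e : frac p q = g) (T : X.K p q), Ψ (toFiber hX e T) = Θ.θ p q T :=
  exists_extension (fun {p q} _ => Θ.θ p q) zero_le_one
    (fun _ T => (Θ.norm_le T).trans_eq (one_mul _).symm) fun _ _ h h' T => Θ.θ_amp h h' T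

/-- The map on a fibre of the Fell bundle induced by a representation of compact operators. -/
def fellRepMap (g : GroupCompletion P) : Fiber hX g →L[ℂ] D := (Θ.exists_fellRep_map g).choose

theorem fellRepMap_toFiber {g : GroupCompletion P} {p q : P} (e : frac p q = g) (T : X.K p q) :
    Θ.fellRepMap g (toFiber hX e T) = Θ.θ p q T :=
  (Θ.exists_fellRep_map g).choose_spec.2 e T

/-- Representations of compact operators extend to the Fell bundle. -/
def toFellRep : (fellBundle hX).Representation D where
  π g := (Θ.fellRepMap g).toLinearMap
  map_mul {g h k} e a b := by
    change Θ.fellRepMap k (fiberMul hX e a b) = Θ.fellRepMap g a * Θ.fellRepMap h b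
    induction a, b using Fiber.induction₂ with
    | closed => exact isClosed_eq (by fun_prop) (by fun_prop)
    | base e₁ e₂ T S =>
      have e₃ := frac_mul_frac_eq e e₁ e₂ (mul_one _) (mul_one _) (mul_one _) (mul_one _)
      rw [fiberMul_toFiber e e₁ e₂ e₃, fellRepMap_toFiber, fellRepMap_toFiber,
        fellRepMap_toFiber, Θ.θ_comp]
  map_adj {g k} e a := by
    change Θ.fellRepMap k (fiberAdj hX e a) = star (Θ.fellRepMap g a)
    induction a using Fiber.induction with
    | closed => exact isClosed_eq (by fun_prop) (by fun_prop)
    | base e₁ T =>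
      rw [fiberAdj_toFiber e e₁ (frac_swap_eq e e₁), fellRepMap_toFiber, fellRepMap_toFiber,
        Θ.θ_adj]

theorem toFellRep_π_toFiber {g : GroupCompletion P} {p q : P} (e : frac p q = g) (T : X.K p q) :
    Θ.toFellRep.π g (toFiber hX e T) = Θ.θ p q T := Θ.fellRepMap_toFiber e T

omit [RightOreMonoid P] in
/-- Representations of compact operators are determined by their values on vectors. -/
theorem toCompactRep_toRepresentation {p q : P} (T : X.K p q) :
    (Representation.toCompactRep Θ.toRepresentation_covariant hX).θ p q T = Θ.θ p q T := by
  induction T using compact_induction with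
  | add T S h h' => rw [map_add, map_add, h, h']
  | smul c T h => rw [map_smul, map_smul, h]
  | closed => exact isClosed_eq (continuous_θ _ p q) (Θ.continuous_θ p q)
  | rank ξ η =>
    exact (Representation.θ_ketBra Θ.toRepresentation_covariant ξ η).trans (Θ.θ_ketBra ξ η).symm

end CompactRep

end

/-! ### The Cuntz--Pimsner algebra as a sectional algebra -/

/-- The representation of the Fell bundle on the same C⋆-algebra given by a Cuntz--Pimsner covariant
representation. -/
def CovariantRep.toFellRep (hX : X.IsProper) (ρ : X.CovariantRep) : (fellBundle hX).Rep where
  D := ρ.D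
  rep := (Representation.toCompactRep ρ.covariant hX).toFellRep

/-- The Cuntz--Pimsner covariant representation on the same C⋆-algebra given by a representation of
the Fell bundle. -/
def CovariantRep.ofFellRep (hX : X.IsProper) (σ : (fellBundle hX).Rep) : X.CovariantRep where
  D := σ.D
  rep := (CompactRep.ofFellRep σ.rep).toRepresentation
  covariant := (CompactRep.ofFellRep σ.rep).toRepresentation_covariant

theorem CovariantRep.toFellRep_ket (ρ : X.CovariantRep) {p : P} (ξ : X.E p) :
    (ρ.toFellRep hX).rep.π (frac p 1) (toFiber hX rfl (ket hX p ξ)) = ρ.rep.S p ξ :=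
  (CompactRep.toFellRep_π_toFiber _ rfl _).trans (Representation.toCompactRep_ket ρ.covariant hX ξ)

theorem CovariantRep.toFellRep_ofFellRep (σ : (fellBundle hX).Rep) (g : GroupCompletion P)
    (a : Fiber hX g) : ((ofFellRep hX σ).toFellRep hX).rep.π g a = σ.rep.π g a := by
  induction a using Fiber.induction with
  | closed =>
    exact isClosed_eq
      (AddMonoidHomClass.continuous_of_bound (((ofFellRep hX σ).toFellRep hX).rep.π g) 1
        fun a => (FellBundle.Representation.norm_le _ g a).trans_eq (one_mul _).symm)
      (AddMonoidHomClass.continuous_of_bound (σ.rep.π g) 1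
        fun a => (FellBundle.Representation.norm_le _ g a).trans_eq (one_mul _).symm)
  | base e T =>
    refine (CompactRep.toFellRep_π_toFiber _ e T).trans ?_
    refine (CompactRep.toCompactRep_toRepresentation (CompactRep.ofFellRep σ.rep) T).trans ?_
    exact (fellRep_toFiber σ.rep e T).symm

/-- The representation of the Fell bundle given by all Cuntz--Pimsner covariant representations. -/
def fellUniversal (hX : X.IsProper) (g : GroupCompletion P) :
    Fiber hX g →L[ℂ] lp (fun ρ : X.CovariantRep => ρ.D) ∞ :=
  LinearMap.mkContinuous
    { toFun := fun a => ⟨fun ρ => (ρ.toFellRep hX).rep.π g a, memℓp_infty ⟨‖a‖, by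
        rintro _ ⟨ρ, rfl⟩; exact (ρ.toFellRep hX).rep.norm_le g a⟩⟩
      map_add' := fun a b => lp.ext (funext fun ρ => map_add ((ρ.toFellRep hX).rep.π g) a b)
      map_smul' := fun c a => lp.ext (funext fun ρ => map_smul ((ρ.toFellRep hX).rep.π g) c a) }
    1 fun a => by
      rw [one_mul]
      exact lp.norm_le_of_forall_le (norm_nonneg a) fun ρ => (ρ.toFellRep hX).rep.norm_le g a

/-- The image of `O_g` lies in the Cuntz--Pimsner algebra because `|ξ⟩⟨η|` is sent to `S(ξ) S(η)*`. -/
theorem fellUniversal_mem (hX : X.IsProper) (g : GroupCompletion P) (a : Fiber hX g) :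
    fellUniversal hX g a ∈ X.cuntzPimsnerSubalgebra := by
  have hN : IsClosed (X.cuntzPimsnerSubalgebra : Set (lp (fun ρ : X.CovariantRep => ρ.D) ∞)) :=
    NonUnitalStarSubalgebra.isClosed_topologicalClosure _
  have hS {p : P} (ξ : X.E p) : X.universalS p ξ ∈ X.cuntzPimsnerSubalgebra :=
    NonUnitalStarSubalgebra.le_topologicalClosure _
      (NonUnitalStarAlgebra.subset_adjoin ℂ _ ⟨p, ξ, rfl⟩)
  have hc := hN.preimage (fellUniversal hX g).continuous
  induction a using Fiber.induction with
  | closed => exact hc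
  | @base p q e T =>
    induction T using compact_induction with
    | add T S h h' => rw [map_add, map_add]; exact add_mem h h'
    | smul c T h => rw [map_smul, map_smul]; exact SMulMemClass.smul_mem c h
    | closed => exact hc.preimage (toFiber hX e).continuous
    | rank ξ η =>
      have h : fellUniversal hX g (toFiber hX e (ketBra A ξ η)) =
          X.universalS p ξ * star (X.universalS q η) :=
        lp.ext (funext fun ρ => (CompactRep.toFellRep_π_toFiber _ e _).trans
          (Representation.θ_ketBra ρ.covariant ξ η))
      rw [h]
      exact mul_mem (hS ξ) (star_mem (hS η))

theorem nonempty_cuntzPimsnerAlgebra_equiv (hX : X.IsProper) :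
    Nonempty (X.CuntzPimsnerAlgebra ≃⋆ₐ[ℂ] (fellBundle hX).FullSectionalAlgebra) := by
  refine nonempty_starAlgEquiv_closure_adjoin (lpReindex (CovariantRep.ofFellRep hX))
    (lpReindex (CovariantRep.toFellRep hX)) ?_ ?_ ?_ ?_
  · rintro _ ⟨p, ξ, rfl⟩
    exact NonUnitalStarSubalgebra.le_topologicalClosure _ (NonUnitalStarAlgebra.subset_adjoin ℂ _
      ⟨frac p 1, toFiber hX rfl (ket hX p ξ), rfl⟩)
  · rintro _ ⟨g, a, rfl⟩
    exact fellUniversal_mem hX g a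
  · rintro _ ⟨p, ξ, rfl⟩
    exact lp.ext (funext fun ρ => CovariantRep.toFellRep_ket ρ ξ)
  · rintro _ ⟨g, a, rfl⟩
    exact lp.ext (funext fun σ => CovariantRep.toFellRep_ofFellRep σ g a)

end ProductSystem

end

theorem mainTheorem1 {P : Type w} [Monoid P] [RightOreMonoid P] {A : Type u}
    [NonUnitalCStarAlgebra A] (X : ProductSystem P A) (hX : X.IsProper) :
    -- the structure maps of the diagrams are well defined
    (∀ (p₁ p₂ q : P) (T : X.K p₁ p₂), ∃! T' : X.K (p₁ * q) (p₂ * q), X.IsAmplification q T T') ∧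
    ∃ (O : FellBundle.{w, max u w} (RightOreMonoid.GroupCompletion P))
      (ι : ∀ {g : RightOreMonoid.GroupCompletion P} {p₁ p₂ : P},
        RightOreMonoid.frac p₁ p₂ = g → X.K p₁ p₂ →L[ℂ] O.fiber g),
      -- the fibres are the Banach space colimits, with the induced Fell bundle structure
      X.IsColimitFellBundle O ι ∧
      -- the unit fibre is the colimit of the C⋆-algebras `𝕂(E_p)`
      (∃ ϑ : ∀ p : P, X.K p p →⋆ₙₐ[ℂ] O.fiber 1,
        (∀ (p : P) (T : X.K p p), ϑ p T = ι (RightOreMonoid.frac_self_eq_one p) T) ∧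
        X.IsCStarColimit ϑ) ∧
      -- the Cuntz--Pimsner algebra is the full sectional C⋆-algebra
      Nonempty (X.CuntzPimsnerAlgebra ≃⋆ₐ[ℂ] O.FullSectionalAlgebra) := by
  open ProductSystem in
  exact ⟨fun p₁ p₂ q T => ⟨amp hX rfl rfl T, (isAmplification_iff hX).2 rfl,
      fun T' h => (isAmplification_iff hX).1 h⟩,
    fellBundle hX, fun e => toFiber hX e, isColimitFellBundle_fellBundle hX,
    ⟨toUnitFiber hX, fun _ _ => rfl, isCStarColimit_toUnitFiber⟩,
    nonempty_cuntzPimsnerAlgebra_equiv hX⟩
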